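/- **Setting.** $m\ge 2$ nodes form a connected undirected graph. Node $i$ holds $f_i(x,y)=\frac1n\sum_{j=1}^n f_{ij}(x,y)$, $x\in\mathbb R^{d_x}$, $y\in\mathbb R^{d_y}$. Let $X,Y$ be nonempty, convex and compact, let $g:X\to\mathbb R$, $r:Y\to\mathbb R$ be convex and continuous, and let $z^\star=(x^\star,y^\star)\in X\times Y$ be a saddle point of $\Psi(x,y)=\frac1m\sum_{i=1}^m\big(f_i(x,y)+g(x)-r(y)\big)$ (min over $x\in X$, max over $y\in Y$). Assume, for $(x,y)\in X\times Y$: * each $f_i(\cdot,y)$ is $\mu_x$-strongly convex and each $f_i(x,\cdot)$ is $\mu_y$-strongly concave, with $\mu_x,\mu_y>0$; * the $f_{ij}$ are differentiable in $x$ and in $y$; $\nabla_x f_{ij}$ is $L_{xx}$-Lipschitz in $x$ and $L_{xy}$-Lipschitz in $y$; $\nabla_y f_{ij}$ is $L_{yy}$-Lipschitz in $y$ and $L_{yx}$-Lipschitz in $x$; $L_{xy},L_{yx}\ge0$, $\mu_x\le L_{xx}$, $\mu_y\le L_{yy}$; * $W\in\mathbb R^{m\times m}$ is symmetric with nonnegative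 entries and unit row sums, $W_{ii}>0$, $W_{ij}>0$ for $i\ne j$ exactly when $i,j$ are adjacent, and its eigenvalues satisfy $-1<\lambda_m(W)\le\dots\le\lambda_2(W)<\lambda_1(W)=1$; * the random compression operator $Q$ (on $\mathbb R^{d_x}$ and on $\mathbb R^{d_y}$) satisfies $E[Q(u)]=u$ and $E\|Q(u)-u\|^2\le\delta\|u\|^2$ for all $u$, with $0\le\delta\le1$; * $0<p\le1$, and node $i$ samples $j$ with probability $p_{ij}>0$, $\sum_jp_{ij}=1$; $p_{\min}=\min_{i,j}p_{ij}$. **Parameters.** $L=\max\{L_{xx},L_{yy},L_{xy},L_{yx}\}$, $\mu=\min\{\mu_x,\mu_y\}$, $\kappa_f=L/\mu$, $\kappa_g=\lambda_{\max}(I-W)/\lambda_{m-1}(I-W)$, where $\lambda_{m-1}(I-W)$ is the second smallest eigenvalue, and $$s=\frac{\mu np_{\min}}{24L^2},\quad \tilde c_x=\frac{8s^2(L_{xx}^2+L_{yx}^2)}{np_{\min}p},\quad \tilde c_y=\frac{8s^2(L_{yy}^2+L_{xy}^2)}{np_{\min}p},$$ $$b_x=s\mu_x-\frac{4s^2L_{yx}^2}{np_{\min}}-\tilde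 c_xp,\quad b_y=s\mu_y-\frac{4s^2L_{xy}^2}{np_{\min}}-\tilde c_yp,\quad \alpha_x=\frac{b_x}{1+\delta},\quad \alpha_y=\frac{b_y}{1+\delta},$$ $$\gamma_x=\min\Big\{\frac{b_x}{4\sqrt\delta(1+\delta)\lambda_{\max}(I-W)},\frac1{4(1+\delta)\lambda_{\max}(I-W)}\Big\},$$ the first term being omitted if $\delta=0$, and $\gamma_y$ likewise with $b_y$; $M_x=1-\frac{\sqrt\delta\alpha_x}{1-\frac{\gamma_x}2\lambda_{\max}(I-W)}$, $M_y=1-\frac{\sqrt\delta\alpha_y}{1-\frac{\gamma_y}2\lambda_{\max}(I-W)}$, and $$\rho=\max\Big\{\tfrac{1-b_x}{M_x},\tfrac{1-b_y}{M_y},1-\tfrac{\gamma_x}2\lambda_{m-1}(I-W),1-\tfrac{\gamma_y}2\lambda_{m-1}(I-W),1-\alpha_x,1-\alpha_y,1-\tfrac p2\Big\}.$$ **Method (C-DPSVRG).** Vectors are stacked over the nodes. Start from any $x_0^i,\tilde x_0^i\in X$, $y_0^i,\tilde y_0^i\in Y$ and $D^x=D^y=0$, $H^x=x_0$, $H^y=y_0$,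 $H^{w,x}=(W\otimes I)x_0$, $H^{w,y}=(W\otimes I)y_0$. In iteration $t$, node $i$: 1. (SVRG oracle) draws $l\sim(p_{ij})_j$ and sets $\mathcal G^{i,x}=\frac1{np_{il}}\big(\nabla_xf_{il}(z_t^i)-\nabla_xf_{il}(\tilde z_t^i)\big)+\nabla_xf_i(\tilde z_t^i)$, and $\mathcal G^{i,y}$ likewise with $\nabla_y$; here $z^i=(x^i,y^i)$, $\tilde z^i=(\tilde x^i,\tilde y^i)$; 2. sets $\nu^x=x_t-s\mathcal G^x-sD^x$; 3. (compressed communication) with its own draw of $Q$ sets $q^i=Q(\nu^{i,x}-H^{i,x})$, $\hat\nu^{i,x}=H^{i,x}+q^i$, $\hat\nu^{i,w,x}=H^{i,w,x}+\sum_jW_{ij}q^j$, and then replaces $H^x$ by $(1-\alpha_x)H^x+\alpha_x\hat\nu^x$ and $H^{w,x}$ by $(1-\alpha_x)H^{w,x}+\alpha_x\hat\nu^{w,x}$; 4. adds $\frac{\gamma_x}{2s}(\hat\nu^x-\hat\nu^{w,x})$ to $D^x$ and sets $x_{t+1}=\mathrm{prox}_{s(g+\delta_X)}\big(\nu^x-\frac{\gamma_x}2(\hat\nu^x-\hat\nu^{w,x})\big)$,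 where $\delta_X$ is the indicator of $X$; 5. does the same for $y$, with $\nu^y=y_t+s\mathcal G^y-sD^y$, $\gamma_y$, $\alpha_y$, $r$, $Y$; 6. sets $\tilde z_{t+1}^i=z_t^i$ with probability $p$, and $\tilde z_{t+1}^i=\tilde z_t^i$ otherwise. All draws are independent across iterations, and within an iteration the index draws, the Bernoulli draws and the draws of $Q$ for $x$ and for $y$ are independent of one another. **Lyapunov function.** With $\|D\|^2_{A^\dagger}=D^\top(A^\dagger\otimes I)D$ and $A^\dagger$ the pseudo-inverse, $D^{\star,i}_x=-\nabla_xf_i(z^\star)+\frac1m\sum_k\nabla_xf_k(z^\star)$, $D^{\star,i}_y=\nabla_yf_i(z^\star)-\frac1m\sum_k\nabla_yf_k(z^\star)$, $H^\star_x=\mathbf 1\big(x^\star-\frac sm\sum_k\nabla_xf_k(z^\star)\big)$ and $H^\star_y=\mathbf 1\big(y^\star+\frac sm\sum_k\nabla_yf_k(z^\star)\big)$, let $$\begin{aligned}\tilde\Phi_t={}&M_x\|x_t-\mathbf 1x^\star\|^2+\tfrac{2s^2}{\gamma_x}\|D^x_t-D^\star_x\|^2_{(I-W)^\dagger}+\sqrt\delta\|H^x_t-H^\star_x\|^2\\&+M_y\|y_t-\mathbf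 1y^\star\|^2+\tfrac{2s^2}{\gamma_y}\|D^y_t-D^\star_y\|^2_{(I-W)^\dagger}+\sqrt\delta\|H^y_t-H^\star_y\|^2\\&+\tilde c_x\|\tilde x_t-\mathbf 1x^\star\|^2+\tilde c_y\|\tilde y_t-\mathbf 1y^\star\|^2.\end{aligned}$$ **Theorem.** $0<\rho<1$, and $E[\tilde\Phi_t]\le\rho^t\tilde\Phi_0$ for all $t\ge0$. Moreover, there is an absolute constant $C$ such that for every $\varepsilon>0$ the method attains $E\big[\|x_t-\mathbf 1x^\star\|^2+\|y_t-\mathbf 1y^\star\|^2\big]\le\varepsilon$, and keeps it in all later iterations, after a number of gradient (SVRG) oracle calls per node and a number of compressed communication rounds each of which is at most $$C\,\max\Big\{\frac{\kappa_f^2}{np_{\min}},\frac{\sqrt\delta(1+\delta)\kappa_g\kappa_f^2}{np_{\min}},(1+\delta)\kappa_g,\frac{(1+\delta)\kappa_f^2}{np_{\min}},\frac2p\Big\}\cdot\max\Big\{1,\log_2\frac{\tilde\Phi_0}{\varepsilon}\Big\}.$$ -/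

import Mathlib

open MeasureTheory ProbabilityTheory

namespace CDPSVRG

/-- The Euclidean space `ℝ^d`. -/
abbrev E (d : ℕ) : Type := EuclideanSpace ℝ (Fin d)

/-! ### Matrices: ordered eigenvalues and pseudo-inverse -/

section MatrixDefs

/-- The `k`-th largest eigenvalue (counted with multiplicity, `k = 0, …, m - 1`) of a symmetric
real `m × m` matrix. -/
noncomputable def eigDesc {m : ℕ} (A : Matrix (Fin m) (Fin m) ℝ) (k : ℕ) : ℝ :=
  if h : A.IsHermitian ∧ k < m then
    h.1.eigenvalues₀ ⟨k, lt_of_lt_of_eq h.2 (Fintype.card_fin m).symm⟩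
  else 0

/-- The pseudo-inverse `A†` of a symmetric real matrix: the eigenvectors are kept, each nonzero
eigenvalue is inverted, and the eigenvalue `0` is kept (in Lean, `0⁻¹ = 0`). -/
noncomputable def pinv {m : ℕ} (A : Matrix (Fin m) (Fin m) ℝ) : Matrix (Fin m) (Fin m) ℝ :=
  cfc (fun x : ℝ => x⁻¹) A

/-- `pinv A` satisfies the four equations that characterize the Moore–Penrose inverse. -/
theorem pinv_penrose {m : ℕ} (A : Matrix (Fin m) (Fin m) ℝ) (hA : A.IsHermitian) :
    A * pinv A * A = A ∧ pinv A * A * pinv A = pinv A ∧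
      (A * pinv A).IsHermitian ∧ (pinv A * A).IsHermitian := by
  have hA' : IsSelfAdjoint A := hA
  have hfin : (spectrum ℝ A).Finite := A.finite_real_spectrum
  have hc : ∀ f : ℝ → ℝ, ContinuousOn f (spectrum ℝ A) := fun f => hfin.continuousOn f
  have h1 : A * pinv A = cfc (fun x : ℝ => x * x⁻¹) A := by
    rw [cfc_mul (fun x : ℝ => x) (fun x : ℝ => x⁻¹) A (hc _) (hc _), cfc_id' ℝ A, pinv]
  have h2 : pinv A * A = cfc (fun x : ℝ => x⁻¹ * x) A := by
    rw [cfc_mul (fun x : ℝ => x⁻¹) (fun x : ℝ => x) A (hc _) (hc _), cfc_id' ℝ A, pinv]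
  refine ⟨?_, ?_, ?_, ?_⟩
  · rw [h1]
    have h3 : cfc (fun x : ℝ => x * x⁻¹) A * A = cfc (fun x : ℝ => x * x⁻¹ * x) A := by
      rw [cfc_mul (fun x : ℝ => x * x⁻¹) (fun x : ℝ => x) A (hc _) (hc _), cfc_id' ℝ A]
    rw [h3]
    simpa using cfc_id' ℝ A
  · rw [h2]
    unfold pinv
    rw [← cfc_mul _ _ A (hc _) (hc _)]
    congr 1
    funext x
    by_cases hx : x = 0 <;> simp [hx]
  · rw [h1]; exact cfc_predicate _ A
  · rw [h2]; exact cfc_predicate _ A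

/-- `‖D‖²_{A†} = Dᵀ (A† ⊗ I_d) D` for a stacked vector `D = (D^1, …, D^m)` in `(ℝ^d)^m`. -/
noncomputable def pinvNormSq {m d : ℕ} (A : Matrix (Fin m) (Fin m) ℝ) (D : Fin m → E d) : ℝ :=
  ∑ i, ∑ j, pinv A i j * inner ℝ (D i) (D j)

/-- `‖u - v‖²` for stacked vectors. -/
noncomputable def sqDist {m d : ℕ} (u v : Fin m → E d) : ℝ := ∑ i, ‖u i - v i‖ ^ 2

end MatrixDefs

/-! ### Proximal step -/

section ProxDefs

/-- `prox_{s (g + δ_K)}(v)`, the minimizer of `g(u) + ‖u - v‖² / (2 s)` over `u ∈ K`. -/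
noncomputable def prox {d : ℕ} (K : Set (E d)) (g : E d → ℝ) (s : ℝ) (v : E d) : E d :=
  Classical.epsilon fun u =>
    u ∈ K ∧ IsMinOn (fun w => g w + 1 / (2 * s) * ‖w - v‖ ^ 2) K u

theorem prox_spec {d : ℕ} {K : Set (E d)} (hK : IsCompact K) (hne : K.Nonempty) {g : E d → ℝ}
    (hg : ContinuousOn g K) (s : ℝ) (v : E d) :
    prox K g s v ∈ K ∧
      IsMinOn (fun w => g w + 1 / (2 * s) * ‖w - v‖ ^ 2) K (prox K g s v) := by
  apply Classical.epsilon_spec (p := fun u => u ∈ K ∧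
    IsMinOn (fun w => g w + 1 / (2 * s) * ‖w - v‖ ^ 2) K u)
  obtain ⟨u, hu, hmin⟩ := hK.exists_isMinOn hne
    (f := fun w => g w + 1 / (2 * s) * ‖w - v‖ ^ 2)
    (hg.add (by fun_prop))
  exact ⟨u, hu, hmin⟩

end ProxDefs

/-! ### Compression operator and compressed communication -/

section CompressionDefs

/-- A random operator `u ↦ Q(θ, u)` on `ℝ^d`, with `θ` of law `τ`, which is unbiased and satisfies
`E ‖Q(u) - u‖² ≤ δ ‖u‖²`. -/
structure IsCompressor {d : ℕ} {Θ : Type*} [MeasurableSpace Θ] (τ : Measure Θ)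
    (Q : Θ → E d → E d) (δ : ℝ) : Prop where
  meas : Measurable fun z : Θ × E d => Q z.1 z.2
  integrable : ∀ u, Integrable (fun θ => Q θ u) τ
  unbiased : ∀ u, ∫ θ, Q θ u ∂τ = u
  sq_integrable : ∀ u, Integrable (fun θ => ‖Q θ u - u‖ ^ 2) τ
  variance : ∀ u, ∫ θ, ‖Q θ u - u‖ ^ 2 ∂τ ≤ δ * ‖u‖ ^ 2

/-- The four outputs `ν̂`, `ν̂^w`, `H_new`, `H^w_new` of the procedure COMM. -/
structure CommOut (m d : ℕ) where
  nuHat : Fin m → E d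
  nuHatW : Fin m → E d
  Hnew : Fin m → E d
  HWnew : Fin m → E d

/-- The compressed communication procedure COMM. Node `i` applies its realization `q i` of the
compression operator. -/
noncomputable def comm {m d : ℕ} (W : Matrix (Fin m) (Fin m) ℝ) (q : Fin m → E d → E d)
    (ν H HW : Fin m → E d) (α : ℝ) : CommOut m d :=
  let Qd : Fin m → E d := fun i => q i (ν i - H i)
  let nh : Fin m → E d := fun i => H i + Qd i
  let nhw : Fin m → E d := fun i => HW i + ∑ j, W i j • Qd j
  { nuHat := nh
    nuHatW := nhw
    Hnew := fun i => (1 - α) • H i + α • nh i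
    HWnew := fun i => (1 - α) • HW i + α • nhw i }

end CompressionDefs

/-! ### The problem, its parameters and the assumptions -/

section ProblemDefs

/-- The data: `m` nodes, `n` batches per node; `f i j` is the loss of batch `j` at node `i`;
`g`, `r`, `X`, `Y` are the nonsmooth terms and the feasible sets; `W` is the weight matrix;
`prob i j` the probability with which node `i` samples `j`; `p` the reference probability;
`δ` the compression factor; `μx`, `μy` the strong convexity / concavity parameters and
`Lxx`, `Lyy`, `Lxy`, `Lyx` the Lipschitz constants. -/
structure Data (m n dx dy : ℕ) where
  f : Fin m → Fin n → E dx → E dy → ℝ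
  g : E dx → ℝ
  r : E dy → ℝ
  X : Set (E dx)
  Y : Set (E dy)
  W : Matrix (Fin m) (Fin m) ℝ
  prob : Fin m → Fin n → ℝ
  p : ℝ
  δ : ℝ
  μx : ℝ
  μy : ℝ
  Lxx : ℝ
  Lyy : ℝ
  Lxy : ℝ
  Lyx : ℝ

namespace Data

variable {m n dx dy : ℕ} (D : Data m n dx dy)

/-- `f_i = (1/n) ∑_j f_{ij}`. -/
noncomputable def fi (i : Fin m) (x : E dx) (y : E dy) : ℝ := (1 / (n : ℝ)) * ∑ j, D.f i j x y

/-- `Ψ(x,y) = (1/m) ∑_i (f_i(x,y) + g(x) - r(y))`. -/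
noncomputable def Psi (x : E dx) (y : E dy) : ℝ :=
  (1 / (m : ℝ)) * ∑ i, (D.fi i x y + D.g x - D.r y)

/-- `∇_x f_{ij}(x,y)`. -/
noncomputable def gradXij (i : Fin m) (j : Fin n) (x : E dx) (y : E dy) : E dx :=
  gradient (fun x' => D.f i j x' y) x

/-- `∇_y f_{ij}(x,y)`. -/
noncomputable def gradYij (i : Fin m) (j : Fin n) (x : E dx) (y : E dy) : E dy :=
  gradient (fun y' => D.f i j x y') y

/-- `∇_x f_i(x,y)`. -/
noncomputable def gradX (i : Fin m) (x : E dx) (y : E dy) : E dx :=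
  gradient (fun x' => D.fi i x' y) x

/-- `∇_y f_i(x,y)`. -/
noncomputable def gradY (i : Fin m) (x : E dx) (y : E dy) : E dy :=
  gradient (fun y' => D.fi i x y') y

/-- `(x⋆, y⋆)` is a saddle point of `Ψ` on `X × Y`. -/
def IsSolution (xs : E dx) (ys : E dy) : Prop :=
  xs ∈ D.X ∧ ys ∈ D.Y ∧ IsSaddlePointOn D.X D.Y D.Psi xs ys

/-- `L = max {L_xx, L_yy, L_xy, L_yx}`. -/
noncomputable def L : ℝ := max (max D.Lxx D.Lyy) (max D.Lxy D.Lyx)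

/-- `μ = min {μ_x, μ_y}`. -/
noncomputable def μ : ℝ := min D.μx D.μy

/-- The condition number `κ_f = L / μ`. -/
noncomputable def kf : ℝ := D.L / D.μ

/-- `λ_max(I - W)`. -/
noncomputable def lamMax : ℝ := eigDesc (1 - D.W) 0

/-- The second smallest eigenvalue `λ_{m-1}(I - W)`. -/
noncomputable def lamSnd : ℝ := eigDesc (1 - D.W) (m - 2)

/-- The graph condition number `κ_g = λ_max(I - W) / λ_{m-1}(I - W)`. -/
noncomputable def kg : ℝ := D.lamMax / D.lamSnd

/-- `p_min = min_{i,j} p_{ij}`. -/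
noncomputable def pmin : ℝ := ⨅ k : Fin m × Fin n, D.prob k.1 k.2

/-- The product `n p_min`. -/
noncomputable def npmin : ℝ := (n : ℝ) * D.pmin

/-- The step size `s = μ n p_min / (24 L²)`. -/
noncomputable def s : ℝ := D.μ * D.npmin / (24 * D.L ^ 2)

noncomputable def ctx : ℝ := 8 * D.s ^ 2 * (D.Lxx ^ 2 + D.Lyx ^ 2) / (D.npmin * D.p)

noncomputable def cty : ℝ := 8 * D.s ^ 2 * (D.Lyy ^ 2 + D.Lxy ^ 2) / (D.npmin * D.p)

noncomputable def bX : ℝ := D.s * D.μx - 4 * D.s ^ 2 * D.Lyx ^ 2 / D.npmin - D.ctx * D.p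

noncomputable def bY : ℝ := D.s * D.μy - 4 * D.s ^ 2 * D.Lxy ^ 2 / D.npmin - D.cty * D.p

noncomputable def αx : ℝ := D.bX / (1 + D.δ)

noncomputable def αy : ℝ := D.bY / (1 + D.δ)

/-- `min { b / (4 √δ (1+δ) λ_max(I-W)), 1 / (4 (1+δ) λ_max(I-W)) }`, where for `δ = 0` the first
term is `+∞` and so is omitted. -/
noncomputable def gammaOf (b : ℝ) : ℝ :=
  if D.δ = 0 then 1 / (4 * (1 + D.δ) * D.lamMax)
  else min (b / (4 * Real.sqrt D.δ * (1 + D.δ) * D.lamMax)) (1 / (4 * (1 + D.δ) * D.lamMax))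

noncomputable def γx : ℝ := D.gammaOf D.bX

noncomputable def γy : ℝ := D.gammaOf D.bY

noncomputable def Mx : ℝ := 1 - Real.sqrt D.δ * D.αx / (1 - D.γx / 2 * D.lamMax)

noncomputable def My : ℝ := 1 - Real.sqrt D.δ * D.αy / (1 - D.γy / 2 * D.lamMax)

/-- The contraction factor `ρ`. -/
noncomputable def ρ : ℝ :=
  max ((1 - D.bX) / D.Mx) <| max ((1 - D.bY) / D.My) <|
  max (1 - D.γx / 2 * D.lamSnd) <| max (1 - D.γy / 2 * D.lamSnd) <|
  max (1 - D.αx) <| max (1 - D.αy) (1 - D.p / 2)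

/-- The maximum in the complexity bound. -/
noncomputable def complexityFactor : ℝ :=
  max (D.kf ^ 2 / D.npmin) <|
  max (Real.sqrt D.δ * (1 + D.δ) * D.kg * D.kf ^ 2 / D.npmin) <|
  max ((1 + D.δ) * D.kg) <|
  max ((1 + D.δ) * D.kf ^ 2 / D.npmin) (2 / D.p)

/-- The standing assumptions. `G` is the communication graph. -/
structure Assumptions (G : SimpleGraph (Fin m)) : Prop where
  two_le_m : 2 ≤ m
  graph_connected : G.Connected
  X_compact : IsCompact D.X
  X_convex : Convex ℝ D.X
  X_nonempty : D.X.Nonempty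
  Y_compact : IsCompact D.Y
  Y_convex : Convex ℝ D.Y
  Y_nonempty : D.Y.Nonempty
  g_convex : ConvexOn ℝ D.X D.g
  g_cont : ContinuousOn D.g D.X
  r_convex : ConvexOn ℝ D.Y D.r
  r_cont : ContinuousOn D.r D.Y
  /- smoothness and strong convexity / concavity -/
  diff_x : ∀ i j, ∀ x ∈ D.X, ∀ y ∈ D.Y, DifferentiableAt ℝ (fun x' => D.f i j x' y) x
  diff_y : ∀ i j, ∀ x ∈ D.X, ∀ y ∈ D.Y, DifferentiableAt ℝ (fun y' => D.f i j x y') y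
  μx_pos : 0 < D.μx
  μy_pos : 0 < D.μy
  strong_convex : ∀ i, ∀ y ∈ D.Y, StrongConvexOn D.X D.μx (fun x => D.fi i x y)
  strong_concave : ∀ i, ∀ x ∈ D.X, StrongConcaveOn D.Y D.μy (fun y => D.fi i x y)
  lip_xx : ∀ i j, ∀ y ∈ D.Y, ∀ x₁ ∈ D.X, ∀ x₂ ∈ D.X,
    ‖D.gradXij i j x₁ y - D.gradXij i j x₂ y‖ ≤ D.Lxx * ‖x₁ - x₂‖
  lip_yy : ∀ i j, ∀ x ∈ D.X, ∀ y₁ ∈ D.Y, ∀ y₂ ∈ D.Y,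
    ‖D.gradYij i j x y₁ - D.gradYij i j x y₂‖ ≤ D.Lyy * ‖y₁ - y₂‖
  lip_xy : ∀ i j, ∀ x ∈ D.X, ∀ y₁ ∈ D.Y, ∀ y₂ ∈ D.Y,
    ‖D.gradXij i j x y₁ - D.gradXij i j x y₂‖ ≤ D.Lxy * ‖y₁ - y₂‖
  lip_yx : ∀ i j, ∀ y ∈ D.Y, ∀ x₁ ∈ D.X, ∀ x₂ ∈ D.X,
    ‖D.gradYij i j x₁ y - D.gradYij i j x₂ y‖ ≤ D.Lyx * ‖x₁ - x₂‖
  Lxy_nonneg : 0 ≤ D.Lxy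
  Lyx_nonneg : 0 ≤ D.Lyx
  /- The next two conditions say that the condition numbers `L_xx / μ_x` and `L_yy / μ_y` are at
  least `1`. They follow from the conditions above as soon as `X` (resp. `Y`) has two points; when
  it is a single point, `μ_x` (resp. `μ_y`) would otherwise be unrestricted. -/
  μx_le : D.μx ≤ D.Lxx
  μy_le : D.μy ≤ D.Lyy
  /- compression factor, reference probability, sampling probabilities -/
  δ_nonneg : 0 ≤ D.δ
  δ_le_one : D.δ ≤ 1
  p_pos : 0 < D.p
  p_le_one : D.p ≤ 1
  prob_pos : ∀ i j, 0 < D.prob i j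
  prob_sum : ∀ i, ∑ j, D.prob i j = 1
  /- weight matrix -/
  W_symm : D.W.IsSymm
  W_nonneg : ∀ i j, 0 ≤ D.W i j
  W_row_sum : ∀ i, ∑ j, D.W i j = 1
  W_pos_iff : ∀ i j, i ≠ j → (0 < D.W i j ↔ G.Adj i j)
  W_diag_pos : ∀ i, 0 < D.W i i
  W_eig_first : eigDesc D.W 0 = 1
  W_eig_second : eigDesc D.W 1 < 1
  W_eig_last : -1 < eigDesc D.W (m - 1)

end Data

end ProblemDefs

/-! ### The algorithm -/

section AlgorithmDefs

/-- The state of the method: the iterates `x, y`, the variables `D^x, D^y, H^x, H^y, H^{w,x},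
H^{w,y}`, the reference points `x̃, ỹ`, and two cost counters: the number of calls of the gradient
oracle by each node, and the number of rounds of compressed communication (calls of COMM). -/
structure State (m dx dy : ℕ) where
  x : Fin m → E dx
  y : Fin m → E dy
  Dx : Fin m → E dx
  Dy : Fin m → E dy
  Hx : Fin m → E dx
  Hy : Fin m → E dy
  Hwx : Fin m → E dx
  Hwy : Fin m → E dy
  xr : Fin m → E dx
  yr : Fin m → E dy
  oracleCalls : ℕ
  commRounds : ℕ

namespace Data

variable {m n dx dy : ℕ} (D : Data m n dx dy)

/-- The initial state: `D^x = D^y = 0`, `H = (x₀, y₀)`, `H^w = (W ⊗ I) H`. -/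
noncomputable def init (x0 : Fin m → E dx) (y0 : Fin m → E dy) (xr0 : Fin m → E dx)
    (yr0 : Fin m → E dy) : State m dx dy where
  x := x0
  y := y0
  Dx := 0
  Dy := 0
  Hx := x0
  Hy := y0
  Hwx := fun i => ∑ j, D.W i j • x0 j
  Hwy := fun i => ∑ j, D.W i j • y0 j
  xr := xr0
  yr := yr0
  oracleCalls := 0
  commRounds := 0

/-- SVRG estimate `G^{i,x}` at node `i` when index `l` is sampled. -/
noncomputable def svrgX (i : Fin m) (l : Fin n) (x : E dx) (y : E dy) (xr : E dx) (yr : E dy) :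
    E dx :=
  (1 / ((n : ℝ) * D.prob i l)) • (D.gradXij i l x y - D.gradXij i l xr yr) + D.gradX i xr yr

/-- SVRG estimate `G^{i,y}` at node `i` when index `l` is sampled. -/
noncomputable def svrgY (i : Fin m) (l : Fin n) (x : E dx) (y : E dy) (xr : E dx) (yr : E dy) :
    E dy :=
  (1 / ((n : ℝ) * D.prob i l)) • (D.gradYij i l x y - D.gradYij i l xr yr) + D.gradY i xr yr

/-- One iteration: SVRG oracle, inexact primal dual hybrid updates with compressed communication,
reference point update. `l i` is the index sampled by node `i`, `c i` tells whether node `i`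
refreshes its reference point, and `qx i`, `qy i` are the realizations at node `i` of the
compression operator. -/
noncomputable def step (l : Fin m → Fin n) (c : Fin m → Bool) (qx : Fin m → E dx → E dx)
    (qy : Fin m → E dy → E dy) (S : State m dx dy) : State m dx dy :=
  let Gx : Fin m → E dx := fun i => D.svrgX i (l i) (S.x i) (S.y i) (S.xr i) (S.yr i)
  let Gy : Fin m → E dy := fun i => D.svrgY i (l i) (S.x i) (S.y i) (S.xr i) (S.yr i)
  let νx : Fin m → E dx := fun i => S.x i - D.s • Gx i - D.s • S.Dx i
  let cx := comm D.W qx νx S.Hx S.Hwx D.αx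
  let νy : Fin m → E dy := fun i => S.y i + D.s • Gy i - D.s • S.Dy i
  let cy := comm D.W qy νy S.Hy S.Hwy D.αy
  { x := fun i => prox D.X D.g D.s (νx i - (D.γx / 2) • (cx.nuHat i - cx.nuHatW i))
    y := fun i => prox D.Y D.r D.s (νy i - (D.γy / 2) • (cy.nuHat i - cy.nuHatW i))
    Dx := fun i => S.Dx i + (D.γx / (2 * D.s)) • (cx.nuHat i - cx.nuHatW i)
    Dy := fun i => S.Dy i + (D.γy / (2 * D.s)) • (cy.nuHat i - cy.nuHatW i)
    Hx := cx.Hnew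
    Hy := cy.Hnew
    Hwx := cx.HWnew
    Hwy := cy.HWnew
    xr := fun i => if c i then S.x i else S.xr i
    yr := fun i => if c i then S.y i else S.yr i
    oracleCalls := S.oracleCalls + 1
    commRounds := S.commRounds + 2 }

/-- The random sequence of states generated by the method from the initial state `S0`. -/
noncomputable def run {Ω Θx Θy : Type*} (Qx : Θx → E dx → E dx) (Qy : Θy → E dy → E dy)
    (idx : ℕ → Ω → Fin m → Fin n) (coin : ℕ → Ω → Fin m → Bool)
    (ξ : ℕ → Ω → Fin m → Θx) (η : ℕ → Ω → Fin m → Θy) (S0 : State m dx dy) (ω : Ω) :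
    ℕ → State m dx dy
  | 0 => S0
  | t + 1 => D.step (idx t ω) (coin t ω) (fun i => Qx (ξ t ω i)) (fun i => Qy (η t ω i))
      (run Qx Qy idx coin ξ η S0 ω t)

/-- The random inputs of the method: at iteration `t` node `i` draws the index `idx t · i` from
`P_i`, the Bernoulli(`p`) variable `coin t · i`, and the seeds `ξ t · i`, `η t · i` of its
compression operators. All draws are independent across iterations and across the four kinds.
Across nodes the draws of one kind in one iteration may be independent or not (for example, the
Bernoulli variable may be common to all nodes). -/
structure IsSampling {Ω Θx Θy : Type*} [MeasurableSpace Ω] [MeasurableSpace Θx]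
    [MeasurableSpace Θy] (P : Measure Ω) (τx : Measure Θx) (τy : Measure Θy)
    (idx : ℕ → Ω → Fin m → Fin n) (coin : ℕ → Ω → Fin m → Bool)
    (ξ : ℕ → Ω → Fin m → Θx) (η : ℕ → Ω → Fin m → Θy) : Prop where
  meas_idx : ∀ t, Measurable (idx t)
  meas_coin : ∀ t, Measurable (coin t)
  meas_ξ : ∀ t, Measurable (ξ t)
  meas_η : ∀ t, Measurable (η t)
  idx_law : ∀ t i j, P {ω | idx t ω i = j} = ENNReal.ofReal (D.prob i j)
  coin_law : ∀ t i, P {ω | coin t ω i = true} = ENNReal.ofReal D.p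
  ξ_law : ∀ t i, P.map (fun ω => ξ t ω i) = τx
  η_law : ∀ t i, P.map (fun ω => η t ω i) = τy
  indep : iIndep (fun k : ℕ × Fin 4 =>
    ![MeasurableSpace.comap (idx k.1) inferInstance, MeasurableSpace.comap (coin k.1) inferInstance,
      MeasurableSpace.comap (ξ k.1) inferInstance, MeasurableSpace.comap (η k.1) inferInstance] k.2)
    P

/-! ### Lyapunov function -/

/-- `D⋆_x = -(I - J) ∇_x F(1 z⋆)`, with `J = (1/m) 1 1ᵀ`. -/
noncomputable def DxStar (xs : E dx) (ys : E dy) (i : Fin m) : E dx :=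
  -(D.gradX i xs ys - (1 / (m : ℝ)) • ∑ k, D.gradX k xs ys)

/-- `D⋆_y = (I - J) ∇_y F(1 z⋆)`. -/
noncomputable def DyStar (xs : E dx) (ys : E dy) (i : Fin m) : E dy :=
  D.gradY i xs ys - (1 / (m : ℝ)) • ∑ k, D.gradY k xs ys

/-- `H⋆_x = 1 (x⋆ - (s/m) ∇_x f(z⋆))`, with `f = ∑_i f_i`. -/
noncomputable def HxStar (xs : E dx) (ys : E dy) (_ : Fin m) : E dx :=
  xs - (D.s / (m : ℝ)) • ∑ k, D.gradX k xs ys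

/-- `H⋆_y = 1 (y⋆ + (s/m) ∇_y f(z⋆))`. -/
noncomputable def HyStar (xs : E dx) (ys : E dy) (_ : Fin m) : E dy :=
  ys + (D.s / (m : ℝ)) • ∑ k, D.gradY k xs ys

/-- `Φ`. -/
noncomputable def Phi (xs : E dx) (ys : E dy) (S : State m dx dy) : ℝ :=
  D.Mx * sqDist S.x (fun _ => xs)
    + 2 * D.s ^ 2 / D.γx * pinvNormSq (1 - D.W) (fun i => S.Dx i - D.DxStar xs ys i)
    + Real.sqrt D.δ * sqDist S.Hx (D.HxStar xs ys)
    + D.My * sqDist S.y (fun _ => ys)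
    + 2 * D.s ^ 2 / D.γy * pinvNormSq (1 - D.W) (fun i => S.Dy i - D.DyStar xs ys i)
    + Real.sqrt D.δ * sqDist S.Hy (D.HyStar xs ys)

/-- The Lyapunov function `Φ̃`. -/
noncomputable def PhiTilde (xs : E dx) (ys : E dy) (S : State m dx dy) : ℝ :=
  D.Phi xs ys S + D.ctx * sqDist S.xr (fun _ => xs) + D.cty * sqDist S.yr (fun _ => ys)

end Data

/-- `‖x - 1 x⋆‖² + ‖y - 1 y⋆‖²`. -/
noncomputable def errSq {m dx dy : ℕ} (xs : E dx) (ys : E dy) (S : State m dx dy) : ℝ :=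
  sqDist S.x (fun _ => xs) + sqDist S.y (fun _ => ys)

end AlgorithmDefs

end CDPSVRG

/-!
The Lyapunov function contracts in expectation by the factor `ρ` in every iteration; the
complexity bound then follows by estimating `1 - ρ` from below.

**Deterministic part.** In an orthonormal eigenbasis of `I - W` the updates of the stacked vectors
`ν`, `D`, `H` decouple (`SpectralData`, `modeCoeff`), the consensus norm becomes
`∑ₖ aₖ⁻¹ ‖Dₖ‖²`, and it suffices to treat one eigenvalue `a` at a time (`mode_step`). The weight
`M` is exactly what makes the new primal error together with the `‖ν‖²` parts of the dual and
compression terms cost at most `‖ν - ν⋆‖²`. On the kernel of `I - W`, which by connectedness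
consists of the constant vectors, the dual error vanishes because `∑ᵢ Dᵢ = 0` is preserved. The
proximal step is nonexpansive towards `x⋆` thanks to the variational inequality at the saddle point
(`norm_sub_prox_le`, `saddle_variational_x`).

**Compression.** Conditionally on the past and on the sampled indices, the compression error is
uncorrelated with every known vector and has mean square at most `δ ‖ν - H‖²`
(`compressor_error`). The choice of `γ` and `α` makes this noise no larger than the negative
term `√δ α (1 - α) ‖ν - H‖²` produced by the update of `H` (`stepParams_of`,
`block_expectation`).

**Gradient oracle.** With `D⋆` and `H⋆` as in the statement, the errors of `ν` and `D` combine into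
the error after a plain stochastic gradient step (`nuX_error`). No cocoercivity is needed for it:
the strong convexity and concavity inequalities at `z` and at `z⋆`, added up, give strong
monotonicity of the saddle operator (`saddle_monotone`), and the second moment of the
variance-reduced estimator is controlled by `‖z - z⋆‖²` and `‖z̃ - z⋆‖²` through the Lipschitz
constants (`svrg_second_moment`). The step size `s = μ n p_min / (24 L²)` leaves the contraction
amounts `b_x`, `b_y` (`oracle_step`), and the reference-point terms absorb the `‖z̃ - z⋆‖²` part
while shrinking by `1 - p / 2` (`reference_expectation`).

**Rate.** All these factors are at most `ρ`, and each member of the maximum defining `ρ` is at most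
`1 - 1 / (1152 F)`, where `F` is the maximum in the complexity bound (`rho_le`).
-/

open MeasureTheory ProbabilityTheory

namespace CDPSVRG

/-! ### Spectral decomposition of the gossip matrix -/

/-- A real orthonormal eigenbasis `φ 0, …, φ (m - 1)` of the symmetric matrix `A`, with
eigenvalues `a`, such that all eigenvalues lie in `[0, lmax]` and each of them is either at least
`l2` or equal to `0` with a constant eigenvector. In `pinv_apply` the convention `0⁻¹ = 0` is the one
of the pseudo-inverse. -/
structure SpectralData {m : ℕ} (A : Matrix (Fin m) (Fin m) ℝ) (lmax l2 : ℝ)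
    (a : Fin m → ℝ) (φ : Fin m → Fin m → ℝ) : Prop where
  complete : ∀ i j, ∑ k, φ k i * φ k j = if i = j then 1 else 0
  eig : ∀ k j, ∑ i, A i j * φ k i = a k * φ k j
  pinv_apply : ∀ i j, pinv A i j = ∑ k, (a k)⁻¹ * (φ k i * φ k j)
  nonneg : ∀ k, 0 ≤ a k
  le_max : ∀ k, a k ≤ lmax
  gap : ∀ k, l2 ≤ a k ∨ (a k = 0 ∧ ∃ c, ∀ i, φ k i = c)

/-- The component of the stacked vector `D` along the vector `φ k` of `ℝ^m`. -/
noncomputable def modeCoeff {m d : ℕ} (φ : Fin m → Fin m → ℝ) (D : Fin m → E d) (k : Fin m) : E d :=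
  ∑ i, φ k i • D i

section Modes

variable {m d : ℕ} {φ : Fin m → Fin m → ℝ}

theorem modeCoeff_add (u v : Fin m → E d) (k : Fin m) :
    modeCoeff φ (fun i => u i + v i) k = modeCoeff φ u k + modeCoeff φ v k := by
  simp [modeCoeff, smul_add, Finset.sum_add_distrib]

theorem modeCoeff_sub (u v : Fin m → E d) (k : Fin m) :
    modeCoeff φ (fun i => u i - v i) k = modeCoeff φ u k - modeCoeff φ v k := by
  simp [modeCoeff, smul_sub, Finset.sum_sub_distrib]

theorem modeCoeff_smul (c : ℝ) (u : Fin m → E d) (k : Fin m) :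
    modeCoeff φ (fun i => c • u i) k = c • modeCoeff φ u k := by
  simp only [modeCoeff, Finset.smul_sum]
  exact Finset.sum_congr rfl fun i _ => smul_comm _ _ _

theorem inner_modeCoeff_left (u : Fin m → E d) (w : E d) (k : Fin m) :
    inner ℝ (modeCoeff φ u k) w = ∑ i, inner ℝ (u i) (φ k i • w) := by
  simp only [modeCoeff, sum_inner, inner_smul_left, inner_smul_right]
  simp

theorem sum_inner_modeCoeff (h : ∀ i j, ∑ k, φ k i * φ k j = if i = j then 1 else 0)
    (u v : Fin m → E d) :
    ∑ k, inner ℝ (modeCoeff φ u k) (modeCoeff φ v k) = ∑ i, inner ℝ (u i) (v i) := by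
  have : ∀ k, inner ℝ (modeCoeff φ u k) (modeCoeff φ v k)
      = ∑ i, ∑ j, φ k i * φ k j * inner ℝ (u i) (v j) := by
    intro k
    simp only [modeCoeff, sum_inner, inner_sum, real_inner_smul_left, real_inner_smul_right]
    rw [Finset.sum_comm]
    refine Finset.sum_congr rfl fun i _ => Finset.sum_congr rfl fun j _ => ?_
    ring
  simp only [this]
  rw [Finset.sum_comm]
  refine Finset.sum_congr rfl fun i _ => ?_
  rw [Finset.sum_comm]
  simp only [← Finset.sum_mul, h]
  simp

/-- Parseval's identity for the node-wise squared norm. -/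
theorem sum_norm_sq_modeCoeff (h : ∀ i j, ∑ k, φ k i * φ k j = if i = j then 1 else 0)
    (u : Fin m → E d) :
    ∑ k, ‖modeCoeff φ u k‖ ^ 2 = ∑ i, ‖u i‖ ^ 2 := by
  simpa only [real_inner_self_eq_norm_sq] using sum_inner_modeCoeff h u u

namespace SpectralData

variable {A : Matrix (Fin m) (Fin m) ℝ} {lmax l2 : ℝ} {a : Fin m → ℝ}

theorem modeCoeff_mul (h : SpectralData A lmax l2 a φ) (u : Fin m → E d) (k : Fin m) :
    modeCoeff φ (fun i => ∑ j, A i j • u j) k = a k • modeCoeff φ u k := by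
  simp only [modeCoeff, Finset.smul_sum, smul_smul]
  rw [Finset.sum_comm]
  refine Finset.sum_congr rfl fun j _ => ?_
  rw [← Finset.sum_smul, ← h.eig k j]
  simp only [mul_comm]

theorem pinvNormSq_eq (h : SpectralData A lmax l2 a φ) (u : Fin m → E d) :
    pinvNormSq A u = ∑ k, (a k)⁻¹ * ‖modeCoeff φ u k‖ ^ 2 := by
  have : ∀ k, (a k)⁻¹ * ‖modeCoeff φ u k‖ ^ 2
      = ∑ i, ∑ j, (a k)⁻¹ * (φ k i * φ k j) * inner ℝ (u i) (u j) := by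
    intro k
    rw [← real_inner_self_eq_norm_sq]
    simp only [modeCoeff, sum_inner, inner_sum, real_inner_smul_left, real_inner_smul_right,
      Finset.mul_sum]
    rw [Finset.sum_comm]
    refine Finset.sum_congr rfl fun i _ => Finset.sum_congr rfl fun j _ => ?_
    ring
  simp only [this]
  rw [Finset.sum_comm]
  unfold pinvNormSq
  refine Finset.sum_congr rfl fun i _ => ?_
  rw [Finset.sum_comm]
  refine Finset.sum_congr rfl fun j _ => ?_
  rw [h.pinv_apply, Finset.sum_mul]

/-- A stacked vector with zero sum has no component along the kernel of `A`. -/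
theorem modeCoeff_eq_zero_or (h : SpectralData A lmax l2 a φ) {u : Fin m → E d}
    (hu : ∑ i, u i = 0) (k : Fin m) : l2 ≤ a k ∨ modeCoeff φ u k = 0 := by
  rcases h.gap k with h1 | ⟨_, c, hc⟩
  · exact Or.inl h1
  · right
    simp only [modeCoeff, hc, ← Finset.smul_sum, hu, smul_zero]

end SpectralData

end Modes

/-- For a symmetric matrix with unit row sums, `vᵀ (I - W) v` is the Dirichlet form
`½ ∑ᵢⱼ Wᵢⱼ (vᵢ - vⱼ)²`. -/
theorem dirichlet_form {m : ℕ} {W : Matrix (Fin m) (Fin m) ℝ} (hs : W.IsSymm)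
    (hr : ∀ i, ∑ j, W i j = 1) (v : Fin m → ℝ) :
    2 * ∑ j, (∑ i, (1 - W) i j * v i) * v j = ∑ i, ∑ j, W i j * (v i - v j) ^ 2 := by
  have hsy : ∀ i j, W j i = W i j := fun i j => hs.apply i j
  have h1 : ∀ j, ∑ i, (1 - W) i j * v i = v j - ∑ i, W i j * v i := by
    intro j
    simp [Matrix.sub_apply, sub_mul, Matrix.one_apply, Finset.sum_sub_distrib]
  have h2 : ∑ i, ∑ j, W i j * (v i - v j) ^ 2
      = ∑ i, ∑ j, W i j * v i ^ 2 + ∑ i, ∑ j, W i j * v j ^ 2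
        - 2 * ∑ i, ∑ j, W i j * v i * v j := by
    simp only [Finset.mul_sum, ← Finset.sum_add_distrib, ← Finset.sum_sub_distrib]
    exact Finset.sum_congr rfl fun i _ => Finset.sum_congr rfl fun j _ => by ring
  have h3 : ∑ i, ∑ j, W i j * v i ^ 2 = ∑ i, v i ^ 2 := by
    simp only [← Finset.sum_mul, hr, one_mul]
  have h4 : ∑ i, ∑ j, W i j * v j ^ 2 = ∑ i, v i ^ 2 := by
    rw [Finset.sum_comm, ← h3]
    simp only [hsy]
  have h5 : ∑ j, (∑ i, W i j * v i) * v j = ∑ i, ∑ j, W i j * v i * v j := by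
    simp only [Finset.sum_mul]
    rw [Finset.sum_comm]
  rw [h2, h3, h4, ← h5]
  simp only [h1, sub_mul, Finset.sum_sub_distrib]
  simp only [pow_two]
  ring

/-- Nonnegativity of the Dirichlet form, and constancy of its zeros on a connected graph. -/
theorem laplacian_eig {m : ℕ} {W : Matrix (Fin m) (Fin m) ℝ} (hs : W.IsSymm)
    (hr : ∀ i, ∑ j, W i j = 1) (h0 : ∀ i j, 0 ≤ W i j) {G : SimpleGraph (Fin m)}
    (hG : G.Connected) (hW : ∀ i j, i ≠ j → (0 < W i j ↔ G.Adj i j))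
    {v : Fin m → ℝ} {a : ℝ} (hv : ∀ j, ∑ i, (1 - W) i j * v i = a * v j)
    (hn : ∑ i, v i ^ 2 = 1) : 0 ≤ a ∧ (a = 0 → ∀ i j, v i = v j) := by
  have hd := dirichlet_form hs hr v
  simp only [hv] at hd
  have h1 : ∑ j, a * v j * v j = a := by
    calc ∑ j, a * v j * v j = a * ∑ i, v i ^ 2 := by
          rw [Finset.mul_sum]
          exact Finset.sum_congr rfl fun i _ => by ring
      _ = a := by rw [hn, mul_one]
  rw [h1] at hd
  have hnn : ∀ i j, 0 ≤ W i j * (v i - v j) ^ 2 := fun i j => mul_nonneg (h0 i j) (sq_nonneg _)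
  refine ⟨?_, ?_⟩
  · have : 0 ≤ 2 * a := by
      rw [hd]; exact Finset.sum_nonneg fun i _ => Finset.sum_nonneg fun j _ => hnn i j
    linarith
  · intro ha
    rw [ha, mul_zero] at hd
    have h2 : ∀ i j, W i j * (v i - v j) ^ 2 = 0 := by
      intro i j
      have h3 := (Finset.sum_eq_zero_iff_of_nonneg
        (fun i _ => Finset.sum_nonneg fun j _ => hnn i j)).1 hd.symm i (Finset.mem_univ _)
      exact (Finset.sum_eq_zero_iff_of_nonneg (fun j _ => hnn i j)).1 h3 j (Finset.mem_univ _)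
    have hadj : ∀ i j, G.Adj i j → v i = v j := by
      intro i j hij
      have hpos := (hW i j hij.ne).2 hij
      have := (mul_eq_zero.1 (h2 i j)).resolve_left hpos.ne'
      exact sub_eq_zero.1 (pow_eq_zero_iff (two_ne_zero) |>.1 this)
    intro i j
    obtain ⟨w⟩ := hG.preconnected i j
    induction w with
    | nil => rfl
    | cons h _ ih => exact (hadj _ _ h).trans ih

theorem pinv_apply_eq {m : ℕ} {A : Matrix (Fin m) (Fin m) ℝ} (hA : A.IsHermitian) (i j : Fin m) :
    pinv A i j = ∑ k, (hA.eigenvalues k)⁻¹ *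
      (hA.eigenvectorBasis k i * hA.eigenvectorBasis k j) := by
  unfold pinv
  rw [Matrix.IsHermitian.cfc_eq hA, Matrix.IsHermitian.cfc, Unitary.conjStarAlgAut_apply,
    Matrix.mul_apply]
  refine Finset.sum_congr rfl fun k _ => ?_
  rw [Matrix.mul_diagonal, Matrix.star_apply]
  simp only [Matrix.IsHermitian.eigenvectorUnitary_apply, Function.comp_apply]
  simp
  ring

theorem exists_spectralData {m : ℕ} {W : Matrix (Fin m) (Fin m) ℝ} (hm : 2 ≤ m) (hs : W.IsSymm)
    (hr : ∀ i, ∑ j, W i j = 1) (h0 : ∀ i j, 0 ≤ W i j) {G : SimpleGraph (Fin m)}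
    (hG : G.Connected) (hW : ∀ i j, i ≠ j → (0 < W i j ↔ G.Adj i j)) :
    0 < eigDesc (1 - W) (m - 2) ∧ eigDesc (1 - W) (m - 2) ≤ eigDesc (1 - W) 0 ∧
    ∃ a φ, SpectralData (1 - W) (eigDesc (1 - W) 0) (eigDesc (1 - W) (m - 2)) a φ := by
  have hA : (1 - W).IsHermitian := by
    have : W.IsHermitian := by
      rw [Matrix.IsHermitian, Matrix.conjTranspose_eq_transpose_of_trivial]; exact hs
    exact Matrix.isHermitian_one.sub this
  have hev : ∀ i, hA.eigenvalues i = hA.eigenvalues₀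
      ((Fintype.equivOfCardEq (Fintype.card_fin _)).symm i) := fun i => rfl
  set σ : Fin m ≃ Fin (Fintype.card (Fin m)) :=
    (Fintype.equivOfCardEq (Fintype.card_fin _)).symm with hσ
  have hdesc : ∀ k (hk : k < m), eigDesc (1 - W) k =
      hA.eigenvalues (σ.symm ⟨k, lt_of_lt_of_eq hk (Fintype.card_fin m).symm⟩) := by
    intro k hk
    rw [eigDesc, dif_pos ⟨hA, hk⟩, hev, Equiv.apply_symm_apply]
  have heig : ∀ k j, ∑ i, (1 - W) i j * hA.eigenvectorBasis k i
      = hA.eigenvalues k * hA.eigenvectorBasis k j := by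
    intro k j
    have := congrFun (hA.mulVec_eigenvectorBasis k) j
    simp only [Matrix.mulVec, dotProduct, Pi.smul_apply, smul_eq_mul] at this
    rw [← this]
    refine Finset.sum_congr rfl fun i _ => ?_
    have h1 := hA.apply i j
    simp only [star_trivial] at h1
    rw [h1]
  have hnorm : ∀ k, ∑ i, hA.eigenvectorBasis k i ^ 2 = 1 := by
    intro k
    have h1 := hA.eigenvectorBasis.orthonormal.1 k
    have h2 := EuclideanSpace.norm_sq_eq (hA.eigenvectorBasis k)
    rw [h1] at h2
    simpa using h2.symm
  have hlap := fun k => laplacian_eig hs hr h0 hG hW (heig k) (hnorm k)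
  have huniq : ∀ k l, k ≠ l → hA.eigenvalues k = 0 → hA.eigenvalues l = 0 → False := by
    intro k l hkl hk hl
    have h1 : inner ℝ (hA.eigenvectorBasis k) (hA.eigenvectorBasis l) = 0 :=
      hA.eigenvectorBasis.orthonormal.2 hkl
    set i0 : Fin m := ⟨0, by omega⟩
    have ck := fun i => (hlap k).2 hk i i0
    have cl := fun i => (hlap l).2 hl i i0
    have nk := hnorm k
    have nl := hnorm l
    rw [PiLp.inner_apply, Finset.sum_congr rfl fun i _ => by rw [ck i, cl i]] at h1
    rw [Finset.sum_congr rfl fun i _ => by rw [ck i]] at nk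
    rw [Finset.sum_congr rfl fun i _ => by rw [cl i]] at nl
    simp at nk nl h1
    rcases h1 with h1 | h1 | h1
    · omega
    · simp [h1] at nl
    · simp [h1] at nk
  have hanti := hA.eigenvalues₀_antitone
  have hm2 : m - 2 < m := by omega
  have hcard : Fintype.card (Fin m) = m := Fintype.card_fin m
  -- an eigenvalue of index at most `m - 2` is bounded below by the one of index `m - 2`
  have hge : ∀ k, (σ k : ℕ) ≤ m - 2 → eigDesc (1 - W) (m - 2) ≤ hA.eigenvalues k := by
    intro k hk
    rw [hdesc _ hm2, hev, hev, Equiv.apply_symm_apply]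
    exact hanti (Fin.le_def.2 hk)
  have hlast : m - 1 < m := by omega
  have hpos : 0 < eigDesc (1 - W) (m - 2) := by
    rw [hdesc _ hm2]
    refine lt_of_le_of_ne (hlap _).1 fun h => ?_
    set k := σ.symm ⟨m - 2, lt_of_lt_of_eq hm2 (Fintype.card_fin m).symm⟩ with hk
    set l := σ.symm ⟨m - 1, lt_of_lt_of_eq hlast (Fintype.card_fin m).symm⟩ with hl
    have hl0 : hA.eigenvalues l = 0 := by
      refine le_antisymm ?_ (hlap l).1
      rw [h, hev, hev, hk, hl, Equiv.apply_symm_apply, Equiv.apply_symm_apply]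
      apply hanti
      rw [Fin.le_def]
      simp only
      omega
    refine huniq k l ?_ h.symm hl0
    intro hkl
    have := σ.symm.injective hkl
    simp only [Fin.mk.injEq] at this
    omega
  have hmax : ∀ k, hA.eigenvalues k ≤ eigDesc (1 - W) 0 := by
    intro k
    rw [hdesc _ (by omega), hev, hev, Equiv.apply_symm_apply]
    apply hanti
    rw [Fin.le_def]
    simp
  have hcomplete : ∀ i j, ∑ k, hA.eigenvectorBasis k i * hA.eigenvectorBasis k j
      = if i = j then 1 else 0 := by
    intro i j
    have h1 := hA.eigenvectorBasis.sum_inner_mul_inner (EuclideanSpace.single i 1)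
      (EuclideanSpace.single j 1)
    simp only [EuclideanSpace.inner_single_left, EuclideanSpace.inner_single_right] at h1
    simp [EuclideanSpace.single] at h1
    simp only [h1, eq_comm]
  -- the constant vector is not orthogonal to all eigenvectors, so one eigenvalue vanishes
  obtain ⟨k0, hk0⟩ : ∃ k, ∑ i, hA.eigenvectorBasis k i ≠ 0 := by
    by_contra! hall
    have h1 : ∑ j, ∑ k, hA.eigenvectorBasis k ⟨0, by omega⟩ * hA.eigenvectorBasis k j = 1 := by
      simp only [hcomplete]; simp
    rw [Finset.sum_comm] at h1
    simp only [← Finset.mul_sum, hall] at h1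
    simp at h1
  have hzero : hA.eigenvalues k0 = 0 := by
    have h1 : hA.eigenvalues k0 * ∑ j, hA.eigenvectorBasis k0 j = 0 := by
      rw [Finset.mul_sum]
      simp only [← heig]
      rw [Finset.sum_comm]
      refine Finset.sum_eq_zero fun i _ => ?_
      rw [← Finset.sum_mul]
      simp [Matrix.sub_apply, Matrix.one_apply, hr]
    exact (mul_eq_zero.1 h1).resolve_right hk0
  refine ⟨hpos, ?_, hA.eigenvalues, fun k i => hA.eigenvectorBasis k i, hcomplete, heig,
    pinv_apply_eq hA, fun k => (hlap k).1, hmax, ?_⟩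
  · rw [hdesc _ hm2]; exact hmax _
  · intro k
    by_cases hk : (σ k : ℕ) ≤ m - 2
    · exact Or.inl (hge k hk)
    · have hk0' : ¬ (σ k0 : ℕ) ≤ m - 2 := fun h => by
        have := hge k0 h; linarith
      have h1 := (σ k).2
      have h2 := (σ k0).2
      have : k = k0 := σ.injective (Fin.ext (by omega))
      subst this
      exact Or.inr ⟨hzero, hA.eigenvectorBasis k ⟨0, by omega⟩, fun i => (hlap k).2 hzero _ _⟩

/-! ### Directional first-order conditions and the proximal step -/

section FirstOrder

variable {d : ℕ}

/-- If `f (x + t (y - x)) ≤ f x + t c` for small `t > 0`, up to a quadratic error, then the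
directional derivative of `f` at `x` towards `y` is at most `c`. -/
theorem inner_gradient_le {f : E d → ℝ} {x y : E d} (hf : DifferentiableAt ℝ f x) {c K : ℝ}
    (h : ∀ t : ℝ, 0 < t → t < 1 → f (x + t • (y - x)) ≤ f x + t * c + t ^ 2 * K) :
    inner ℝ (gradient f x) (y - x) ≤ c := by
  have hg : HasFDerivAt f (InnerProductSpace.toDual ℝ (E d) (gradient f x)) x :=
    hf.hasGradientAt.hasFDerivAt
  have hl : HasDerivAt (fun t : ℝ => x + t • (y - x)) (y - x) 0 := by
    simpa using ((hasDerivAt_id (0 : ℝ)).smul_const (y - x)).const_add x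
  have hd : HasDerivAt (fun t : ℝ => f (x + t • (y - x))) (inner ℝ (gradient f x) (y - x)) 0 := by
    have h0 : HasFDerivAt f (InnerProductSpace.toDual ℝ (E d) (gradient f x))
        (x + (0 : ℝ) • (y - x)) := by simpa using hg
    exact h0.comp_hasDerivAt (0 : ℝ) hl
  have hs := (hasDerivAt_iff_tendsto_slope_zero.1 hd).mono_left
    (nhdsWithin_mono 0 (fun t (ht : 0 < t) => ne_of_gt ht) :
      nhdsWithin (0 : ℝ) (Set.Ioi 0) ≤ nhdsWithin 0 {0}ᶜ)
  have hb : Filter.Tendsto (fun t : ℝ => c + t * K) (nhdsWithin 0 (Set.Ioi 0)) (nhds c) := by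
    have : Filter.Tendsto (fun t : ℝ => c + t * K) (nhds 0) (nhds (c + 0 * K)) := by
      apply Continuous.tendsto; fun_prop
    simpa using this.mono_left nhdsWithin_le_nhds
  refine le_of_tendsto_of_tendsto hs hb ?_
  have hmem : Set.Ioo (0 : ℝ) 1 ∈ nhdsWithin (0 : ℝ) (Set.Ioi 0) := Ioo_mem_nhdsGT one_pos
  filter_upwards [hmem] with t ht
  have h1 := h t ht.1 ht.2
  simp only [zero_add, zero_smul, add_zero, smul_eq_mul]
  rw [inv_mul_le_iff₀ ht.1]
  nlinarith

/-- First-order lower bound of a strongly convex function, with the gradient at a point of the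
domain. -/
theorem strongConvexOn_gradient {f : E d → ℝ} {K : Set (E d)} {μ : ℝ} (hf : StrongConvexOn K μ f)
    {x y : E d} (hx : x ∈ K) (hy : y ∈ K) (hd : DifferentiableAt ℝ f x) :
    f x + inner ℝ (gradient f x) (y - x) + μ / 2 * ‖y - x‖ ^ 2 ≤ f y := by
  have h := inner_gradient_le (f := f) (x := x) (y := y) hd
    (c := f y - f x - μ / 2 * ‖y - x‖ ^ 2) (K := μ / 2 * ‖y - x‖ ^ 2) ?_
  · linarith
  · intro t h0 h1
    have h2 := hf.2 hx hy (by linarith : (0:ℝ) ≤ 1 - t) h0.le (by ring)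
    have h3 : (1 - t) • x + t • y = x + t • (y - x) := by module
    rw [h3, norm_sub_rev x y] at h2
    simp only [smul_eq_mul] at h2
    nlinarith

theorem gradient_neg' {f : E d → ℝ} (x : E d) :
    gradient (fun u => -f u) x = -gradient f x := by
  unfold gradient
  rw [fderiv_fun_neg, map_neg]

/-- First-order upper bound of a strongly concave function. -/
theorem strongConcaveOn_gradient {f : E d → ℝ} {K : Set (E d)} {μ : ℝ}
    (hf : StrongConcaveOn K μ f) {x y : E d} (hx : x ∈ K) (hy : y ∈ K)
    (hd : DifferentiableAt ℝ f x) :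
    f y ≤ f x + inner ℝ (gradient f x) (y - x) - μ / 2 * ‖y - x‖ ^ 2 := by
  have h1 : StrongConvexOn K μ (fun u => -f u) := hf.neg
  have h2 := strongConvexOn_gradient h1 hx hy hd.neg
  rw [gradient_neg', inner_neg_left] at h2
  linarith

/-- First-order optimality condition for the sum of a differentiable function and a convex one. -/
theorem isMinOn_add_gradient {f g : E d → ℝ} {K : Set (E d)} (hg : ConvexOn ℝ K g) {x : E d}
    (hx : x ∈ K) (hd : DifferentiableAt ℝ f x) (hmin : IsMinOn (fun u => f u + g u) K x)
    {y : E d} (hy : y ∈ K) : 0 ≤ inner ℝ (gradient f x) (y - x) + g y - g x := by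
  have h := inner_gradient_le (f := fun u => -f u) (x := x) (y := y) hd.neg
    (c := g y - g x) (K := 0) ?_
  · rw [gradient_neg', inner_neg_left] at h
    linarith
  · intro t h0 h1
    have h3 : (1 - t) • x + t • y = x + t • (y - x) := by module
    have h2 := hg.2 hx hy (by linarith : (0:ℝ) ≤ 1 - t) h0.le (by ring)
    have h4 := hg.1 hx hy (by linarith : (0:ℝ) ≤ 1 - t) h0.le (by ring)
    rw [h3] at h2 h4
    have h5 : f x + g x ≤ f (x + t • (y - x)) + g (x + t • (y - x)) := hmin h4
    simp only [smul_eq_mul] at h2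
    nlinarith

variable {K : Set (E d)} {g : E d → ℝ} {s : ℝ}

theorem gradient_half_sq (s : ℝ) (v x : E d) :
    DifferentiableAt ℝ (fun w => 1 / (2 * s) * ‖w - v‖ ^ 2) x ∧
      gradient (fun w => 1 / (2 * s) * ‖w - v‖ ^ 2) x = (1 / s) • (x - v) := by
  have h : HasGradientAt (fun w => 1 / (2 * s) * ‖w - v‖ ^ 2) ((1 / s) • (x - v)) x := by
    rw [hasGradientAt_iff_hasFDerivAt]
    have h1 : HasFDerivAt (fun w : E d => w - v) (ContinuousLinearMap.id ℝ (E d)) x :=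
      (hasFDerivAt_id x).sub_const v
    have h2 := (h1.norm_sq).const_mul (1 / (2 * s))
    refine h2.congr_fderiv ?_
    ext w
    simp
    ring
  exact ⟨h.differentiableAt, h.gradient⟩

/-- The variational inequality satisfied by the proximal point. -/
theorem prox_variational (hK : IsCompact K) (hne : K.Nonempty) (hg : ConvexOn ℝ K g)
    (hc : ContinuousOn g K) (hs : 0 < s) (v : E d) {u : E d} (hu : u ∈ K) :
    0 ≤ inner ℝ (prox K g s v - v) (u - prox K g s v) + s * (g u - g (prox K g s v)) := by
  obtain ⟨h1, h2⟩ := prox_spec hK hne hc s v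
  obtain ⟨h3, h4⟩ := gradient_half_sq s v (prox K g s v)
  have h5 : IsMinOn (fun w => 1 / (2 * s) * ‖w - v‖ ^ 2 + g w) K (prox K g s v) := by
    simpa only [add_comm] using h2
  have h6 := isMinOn_add_gradient hg h1 h3 h5 hu
  rw [h4, real_inner_smul_left] at h6
  have h7 := mul_nonneg hs.le h6
  have h8 : s * (1 / s * inner ℝ (prox K g s v - v) (u - prox K g s v))
      = inner ℝ (prox K g s v - v) (u - prox K g s v) := by
    field_simp
  linarith

/-- A point of `K` satisfying the variational inequality at `v` is within `‖v - w‖` of the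
proximal point of `w`. -/
theorem norm_sub_prox_le (hK : IsCompact K) (hne : K.Nonempty) (hg : ConvexOn ℝ K g)
    (hc : ContinuousOn g K) (hs : 0 < s) {v x : E d} (hx : x ∈ K)
    (hv : ∀ u ∈ K, 0 ≤ inner ℝ (x - v) (u - x) + s * (g u - g x)) (w : E d) :
    ‖prox K g s w - x‖ ≤ ‖w - v‖ := by
  have h1 := prox_variational hK hne hg hc hs w hx
  have h2 := hv _ (prox_spec hK hne hc s w).1
  set q := prox K g s w
  have h3 : ‖q - x‖ ^ 2 ≤ inner ℝ (w - v) (q - x) := by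
    rw [← real_inner_self_eq_norm_sq]
    have h4 : inner ℝ (q - w) (x - q) = inner ℝ (w - q) (q - x) := by
      rw [← inner_neg_neg, neg_sub, neg_sub]
    have h5 : inner ℝ (w - q) (q - x) + inner ℝ (x - v) (q - x)
        = inner ℝ (w - v) (q - x) - inner ℝ (q - x) (q - x) := by
      rw [← inner_add_left, ← inner_sub_left]; congr 1; abel
    rw [h4] at h1
    linarith
  have h6 := real_inner_le_norm (w - v) (q - x)
  rcases (norm_nonneg (q - x)).eq_or_lt with h7 | h7
  · rw [← h7]; exact norm_nonneg _
  · nlinarith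

theorem continuous_prox (hK : IsCompact K) (hne : K.Nonempty) (hg : ConvexOn ℝ K g)
    (hc : ContinuousOn g K) (hs : 0 < s) : Continuous (prox K g s) := by
  refine (LipschitzWith.of_dist_le_mul (K := 1) fun w v => ?_).continuous
  rw [NNReal.coe_one, one_mul, dist_eq_norm, dist_eq_norm]
  exact norm_sub_prox_le hK hne hg hc hs (prox_spec hK hne hc s v).1
    (fun u hu => prox_variational hK hne hg hc hs v hu) w

end FirstOrder

/-! ### One inexact primal-dual step, before taking expectations -/

/-- The relations between step size `s`, dual step `γ`, compression weight `r = √δ`, damping `α`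
and primal weight `M` under which one primal-dual step contracts. -/
structure StepParams (s γ r α M lmax l2 : ℝ) : Prop where
  s_pos : 0 < s
  γ_pos : 0 < γ
  l2_pos : 0 < l2
  lmax_nonneg : 0 ≤ lmax
  γ_le : γ / 2 * lmax ≤ 1
  r_nonneg : 0 ≤ r
  α_nonneg : 0 ≤ α
  α_le : α ≤ 1
  M_nonneg : 0 ≤ M
  M_le : M ≤ 1
  M_eq : (1 - M) * (1 - γ / 2 * lmax) = r * α

/-- The estimate of one primal-dual step for a single eigenvalue `a` of `I - W`: `v`, `d`, `h` are
the deviations of `ν`, `D`, `H` from their limits, and `e` is the compression error. -/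
theorem mode_step {s γ r α M lmax l2 a : ℝ} (hp : StepParams s γ r α M lmax l2) (ha0 : 0 ≤ a)
    (ha1 : a ≤ lmax) {n : ℕ} (v e d h : E n) (hgap : l2 ≤ a ∨ d = 0) :
    M * ‖v - (γ / 2) • a • (v + e)‖ ^ 2
      + 2 * s ^ 2 / γ * (a⁻¹ * ‖d + (γ / (2 * s)) • a • (v + e)‖ ^ 2)
      + r * ‖(1 - α) • h + α • (v + e)‖ ^ 2
    ≤ ‖v + s • d‖ ^ 2 + (1 - γ / 2 * l2) * (2 * s ^ 2 / γ * (a⁻¹ * ‖d‖ ^ 2))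
      + r * (1 - α) * ‖h‖ ^ 2 - r * α * (1 - α) * ‖v - h‖ ^ 2
      + inner ℝ e ((γ * a - M * γ * a * (1 - γ / 2 * a) + 2 * r * α ^ 2) • v + (2 * s) • d
          + (2 * r * α * (1 - α)) • h)
      + (α ^ 2 * r + γ * lmax / 2 + γ ^ 2 * lmax ^ 2 / 4) * ‖e‖ ^ 2 := by
  obtain ⟨hs, hγ, hl2, _, hγl, hr, hα0, hα1, hM0, hM1, hM⟩ := hp
  have e1 : ‖v - (γ / 2) • a • (v + e)‖ ^ 2 = (1 - γ / 2 * a) ^ 2 * ‖v‖ ^ 2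
      - 2 * ((1 - γ / 2 * a) * (γ / 2 * a)) * inner ℝ e v + (γ / 2 * a) ^ 2 * ‖e‖ ^ 2 := by
    have : v - (γ / 2) • a • (v + e) = (1 - γ / 2 * a) • v - (γ / 2 * a) • e := by module
    rw [this, norm_sub_sq_real, norm_smul, norm_smul, mul_pow, mul_pow, Real.norm_eq_abs,
      Real.norm_eq_abs, sq_abs, sq_abs, real_inner_smul_left, real_inner_smul_right,
      real_inner_comm e v]
    ring
  have e2 : ∀ c : ℝ, ‖d + c • (v + e)‖ ^ 2 = ‖d‖ ^ 2 + 2 * c * (inner ℝ v d + inner ℝ e d)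
      + c ^ 2 * (‖v‖ ^ 2 + 2 * inner ℝ e v + ‖e‖ ^ 2) := by
    intro c
    rw [norm_add_sq_real, norm_smul, mul_pow, Real.norm_eq_abs, sq_abs, real_inner_smul_right,
      inner_add_right, norm_add_sq_real, real_inner_comm v d, real_inner_comm e d,
      real_inner_comm e v]
    ring
  have e3 : ‖(1 - α) • h + α • (v + e)‖ ^ 2 = (1 - α) ^ 2 * ‖h‖ ^ 2
      + 2 * ((1 - α) * α) * (inner ℝ v h + inner ℝ e h)
      + α ^ 2 * (‖v‖ ^ 2 + 2 * inner ℝ e v + ‖e‖ ^ 2) := by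
    rw [norm_add_sq_real, norm_smul, norm_smul, mul_pow, mul_pow, Real.norm_eq_abs,
      Real.norm_eq_abs, sq_abs, sq_abs, real_inner_smul_left, real_inner_smul_right,
      inner_add_right, norm_add_sq_real, real_inner_comm v h, real_inner_comm e h,
      real_inner_comm e v]
    ring
  have e4 : ‖v + s • d‖ ^ 2 = ‖v‖ ^ 2 + 2 * s * inner ℝ v d + s ^ 2 * ‖d‖ ^ 2 := by
    rw [norm_add_sq_real, norm_smul, mul_pow, Real.norm_eq_abs, sq_abs, real_inner_smul_right]
    ring
  have e5 : ‖v - h‖ ^ 2 = ‖v‖ ^ 2 - 2 * inner ℝ v h + ‖h‖ ^ 2 := norm_sub_sq_real v h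
  -- the dual term, where the case `a = 0` only occurs with `d = 0`
  have e6 : 2 * s ^ 2 / γ * (a⁻¹ * ‖d + (γ / (2 * s)) • a • (v + e)‖ ^ 2)
      ≤ s ^ 2 * ‖d‖ ^ 2 + (1 - γ / 2 * l2) * (2 * s ^ 2 / γ * (a⁻¹ * ‖d‖ ^ 2))
        + 2 * s * (inner ℝ v d + inner ℝ e d)
        + γ / 2 * a * (‖v‖ ^ 2 + 2 * inner ℝ e v + ‖e‖ ^ 2) := by
    rcases ha0.eq_or_lt with h0 | h0
    · have hd : d = 0 := by
        rcases hgap with h1 | h1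
        · linarith
        · exact h1
      simp [← h0, hd]
    · have hla : l2 * (a⁻¹ * ‖d‖ ^ 2) ≤ ‖d‖ ^ 2 := by
        rcases hgap with h1 | h1
        · have h2 : l2 * a⁻¹ ≤ 1 := by rw [← div_eq_mul_inv]; exact (div_le_one h0).2 h1
          nlinarith [sq_nonneg ‖d‖]
        · simp [h1]
      rw [smul_smul, e2]
      have h3 : 2 * s ^ 2 / γ * (a⁻¹ * (‖d‖ ^ 2
          + 2 * (γ / (2 * s) * a) * (inner ℝ v d + inner ℝ e d)
          + (γ / (2 * s) * a) ^ 2 * (‖v‖ ^ 2 + 2 * inner ℝ e v + ‖e‖ ^ 2)))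
          = 2 * s ^ 2 / γ * (a⁻¹ * ‖d‖ ^ 2) + 2 * s * (inner ℝ v d + inner ℝ e d)
        + γ / 2 * a * (‖v‖ ^ 2 + 2 * inner ℝ e v + ‖e‖ ^ 2) := by
        field_simp
      have h4 : γ / 2 * l2 * (2 * s ^ 2 / γ * (a⁻¹ * ‖d‖ ^ 2))
          = s ^ 2 * (l2 * (a⁻¹ * ‖d‖ ^ 2)) := by field_simp
      have h5 := mul_le_mul_of_nonneg_left hla (sq_nonneg s)
      rw [h3]
      linarith
  have hga : γ / 2 * a ≤ γ / 2 * lmax := by gcongr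
  have hga0 : 0 ≤ γ / 2 * a := by positivity
  -- the role of `M`: it absorbs both `α √δ ‖v‖²` and the growth of the dual term
  have k1 : (M * (1 - γ / 2 * a) ^ 2 + γ / 2 * a + r * α) * ‖v‖ ^ 2 ≤ ‖v‖ ^ 2 := by
    have h1 : (1 - γ / 2 * a) ^ 2 ≤ 1 - γ / 2 * a := by nlinarith
    have h2 : (1 - M) * (1 - γ / 2 * lmax) ≤ (1 - M) * (1 - γ / 2 * a) :=
      mul_le_mul_of_nonneg_left (by linarith) (by linarith)
    have h3 : M * (1 - γ / 2 * a) ^ 2 ≤ M * (1 - γ / 2 * a) := mul_le_mul_of_nonneg_left h1 hM0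
    exact mul_le_of_le_one_left (sq_nonneg _) (by linarith)
  have k2 : (M * (γ / 2 * a) ^ 2 + γ / 2 * a) * ‖e‖ ^ 2
      ≤ (γ * lmax / 2 + γ ^ 2 * lmax ^ 2 / 4) * ‖e‖ ^ 2 := by
    refine mul_le_mul_of_nonneg_right ?_ (sq_nonneg _)
    have h1 : (γ / 2 * a) ^ 2 ≤ (γ / 2 * lmax) ^ 2 := pow_le_pow_left₀ hga0 hga 2
    have h2 : M * (γ / 2 * a) ^ 2 ≤ (γ / 2 * a) ^ 2 := mul_le_of_le_one_left (sq_nonneg _) hM1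
    linarith
  rw [e1, e3, e4, e5]
  simp only [inner_add_right, real_inner_smul_right]
  linarith

/-- The vector paired with the compression error in the one-step estimate. It depends only on
quantities known before the compression. -/
noncomputable def crossTerm {m d : ℕ} (s γ r α M : ℝ) (a : Fin m → ℝ) (φ : Fin m → Fin m → ℝ)
    (v dd h : Fin m → E d) (i : Fin m) : E d :=
  ∑ k, φ k i • ((γ * a k - M * γ * a k * (1 - γ / 2 * a k) + 2 * r * α ^ 2) • modeCoeff φ v k
    + (2 * s) • modeCoeff φ dd k + (2 * r * α * (1 - α)) • modeCoeff φ h k)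

/-- The one-step estimate for stacked vectors. -/
theorem stacked_step {m d : ℕ} {A : Matrix (Fin m) (Fin m) ℝ} {s γ r α M lmax l2 : ℝ}
    (hp : StepParams s γ r α M lmax l2) {a : Fin m → ℝ} {φ : Fin m → Fin m → ℝ}
    (hA : SpectralData A lmax l2 a φ) (v e dd h : Fin m → E d) (hdd : ∑ i, dd i = 0)
    (w : Fin m → E d)
    (hw : ∀ i, ‖w i‖ ≤ ‖v i - (γ / 2) • ∑ j, A i j • (v j + e j)‖) :
    M * ∑ i, ‖w i‖ ^ 2
      + 2 * s ^ 2 / γ * pinvNormSq A (fun i => dd i + (γ / (2 * s)) • ∑ j, A i j • (v j + e j))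
      + r * ∑ i, ‖(1 - α) • h i + α • (v i + e i)‖ ^ 2
    ≤ ∑ i, ‖v i + s • dd i‖ ^ 2 + (1 - γ / 2 * l2) * (2 * s ^ 2 / γ * pinvNormSq A dd)
      + r * (1 - α) * ∑ i, ‖h i‖ ^ 2 - r * α * (1 - α) * ∑ i, ‖v i - h i‖ ^ 2
      + ∑ i, inner ℝ (e i) (crossTerm s γ r α M a φ v dd h i)
      + (α ^ 2 * r + γ * lmax / 2 + γ ^ 2 * lmax ^ 2 / 4) * ∑ i, ‖e i‖ ^ 2 := by
  have hw2 : ∑ i, ‖w i‖ ^ 2 ≤ ∑ i, ‖v i - (γ / 2) • ∑ j, A i j • (v j + e j)‖ ^ 2 :=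
    Finset.sum_le_sum fun i _ => pow_le_pow_left₀ (norm_nonneg _) (hw i) 2
  refine le_trans (add_le_add (add_le_add (mul_le_mul_of_nonneg_left hw2 hp.M_nonneg) le_rfl)
    le_rfl) ?_
  have hψ : ∑ i, inner ℝ (e i) (crossTerm s γ r α M a φ v dd h i)
      = ∑ k, inner ℝ (modeCoeff φ e k)
        ((γ * a k - M * γ * a k * (1 - γ / 2 * a k) + 2 * r * α ^ 2) • modeCoeff φ v k
        + (2 * s) • modeCoeff φ dd k + (2 * r * α * (1 - α)) • modeCoeff φ h k) := by
    simp only [inner_modeCoeff_left]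
    rw [Finset.sum_comm]
    simp only [crossTerm, inner_sum]
  rw [hψ]
  have hP := fun u : Fin m → E d => (sum_norm_sq_modeCoeff hA.complete u).symm
  rw [hA.pinvNormSq_eq, hA.pinvNormSq_eq, hP fun i => v i - (γ / 2) • ∑ j, A i j • (v j + e j),
    hP fun i => (1 - α) • h i + α • (v i + e i), hP fun i => v i + s • dd i, hP h,
    hP fun i => v i - h i, hP e]
  simp only [modeCoeff_add, modeCoeff_sub, modeCoeff_smul,
    hA.modeCoeff_mul, Finset.mul_sum, ← Finset.sum_add_distrib, ← Finset.sum_sub_distrib]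
  exact Finset.sum_le_sum fun k _ => mode_step hp (hA.nonneg k) (hA.le_max k) _ _ _ _
    (hA.modeCoeff_eq_zero_or hdd k)

/-! ### The gradient oracle -/

section Svrg

variable {d n : ℕ}

theorem norm_sub_sq_le_two (u v : E d) : ‖u - v‖ ^ 2 ≤ 2 * ‖u‖ ^ 2 + 2 * ‖v‖ ^ 2 := by
  have h1 := norm_sub_sq_real u v
  have h2 := norm_add_sq_real u v
  nlinarith [sq_nonneg ‖u + v‖]

/-- The variance of a finite distribution is at most its second moment. -/
theorem sum_mul_norm_sub_mean_sq_le {p : Fin n → ℝ} (hp : ∑ l, p l = 1) (c : Fin n → E d) :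
    ∑ l, p l * ‖c l - ∑ k, p k • c k‖ ^ 2 ≤ ∑ l, p l * ‖c l‖ ^ 2 := by
  set b := ∑ k, p k • c k with hb
  have h1 : ∀ l, p l * ‖c l - b‖ ^ 2
      = p l * ‖c l‖ ^ 2 - 2 * inner ℝ (p l • c l) b + p l * ‖b‖ ^ 2 := by
    intro l
    rw [norm_sub_sq_real, real_inner_smul_left]; ring
  have h2 : ∑ l, p l * ‖c l - b‖ ^ 2 = ∑ l, p l * ‖c l‖ ^ 2 - ‖b‖ ^ 2 := by
    simp only [h1, Finset.sum_add_distrib, Finset.sum_sub_distrib, ← Finset.mul_sum,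
      ← Finset.sum_mul, hp, ← sum_inner, ← hb, real_inner_self_eq_norm_sq]
    ring
  rw [h2]
  linarith [sq_nonneg ‖b‖]

/-- The mean of the variance-reduced estimator. -/
theorem svrg_mean (hn : 0 < n) {p : Fin n → ℝ} (hp0 : ∀ l, 0 < p l) (hp : ∑ l, p l = 1)
    (a b : Fin n → E d) :
    ∑ l, p l • ((1 / ((n : ℝ) * p l)) • (a l - b l) + (1 / (n : ℝ)) • ∑ k, b k)
      = (1 / (n : ℝ)) • ∑ l, a l := by
  have hn' : (n : ℝ) ≠ 0 := by positivity
  have h1 : ∀ l, p l • ((1 / ((n : ℝ) * p l)) • (a l - b l) + (1 / (n : ℝ)) • ∑ k, b k)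
      = (1 / (n : ℝ)) • a l - (1 / (n : ℝ)) • b l + p l • ((1 / (n : ℝ)) • ∑ k, b k) := by
    intro l
    have h2 : p l * (1 / ((n : ℝ) * p l)) = 1 / n := by
      have := (hp0 l).ne'
      field_simp
    rw [smul_add, smul_smul, h2, smul_sub]
  simp only [h1, Finset.sum_add_distrib, Finset.sum_sub_distrib, ← Finset.smul_sum,
    ← Finset.sum_smul, hp, one_smul]
  abel

/-- The second moment of a variance-reduced estimator, where `a` and `b` stand for the gradients at
the current and the reference point, both relative to the gradients at the solution. The part coming
from `b` appears centered, so it contributes at most the second moment of the uncentered vector. -/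
theorem svrg_second_moment (hn : 0 < n) {p : Fin n → ℝ} (hp0 : ∀ l, 0 < p l)
    (hp : ∑ l, p l = 1) {q : ℝ} (hq0 : 0 < q) (hq : ∀ l, q ≤ n * p l) (a b : Fin n → E d)
    {Ka Kb : ℝ} (ha : ∀ l, ‖a l‖ ^ 2 ≤ Ka) (hb : ∀ l, ‖b l‖ ^ 2 ≤ Kb) :
    ∑ l, p l * ‖(1 / ((n : ℝ) * p l)) • (a l - b l) + (1 / (n : ℝ)) • ∑ k, b k‖ ^ 2
      ≤ 2 / q * (Ka + Kb) := by
  have hn' : (0 : ℝ) < n := by exact_mod_cast hn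
  have key : ∀ (c : Fin n → E d) (K : ℝ), (∀ l, ‖c l‖ ^ 2 ≤ K) →
      ∑ l, p l * ‖(1 / ((n : ℝ) * p l)) • c l‖ ^ 2 ≤ 1 / q * K := by
    intro c K hc
    have h1 : ∀ l ∈ Finset.univ, p l * ‖(1 / ((n : ℝ) * p l)) • c l‖ ^ 2 ≤ 1 / n * (1 / q * K) := by
      intro l _
      have hpl := hp0 l
      have hK : 0 ≤ K := (sq_nonneg _).trans (hc l)
      rw [norm_smul, mul_pow, Real.norm_eq_abs, sq_abs]
      have h2 : p l * ((1 / ((n : ℝ) * p l)) ^ 2 * ‖c l‖ ^ 2)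
          = 1 / n * (1 / (n * p l) * ‖c l‖ ^ 2) := by field_simp
      rw [h2]
      have h3 : 1 / ((n : ℝ) * p l) ≤ 1 / q := one_div_le_one_div_of_le hq0 (hq l)
      have h4 := hc l
      gcongr
    refine (Finset.sum_le_sum h1).trans (le_of_eq ?_)
    simp
    field_simp
  have hmean : ∑ k, p k • ((1 / ((n : ℝ) * p k)) • b k) = (1 / (n : ℝ)) • ∑ k, b k := by
    have h := svrg_mean hn hp0 hp b (fun _ => 0)
    simpa using h
  have h1 : ∀ l ∈ Finset.univ,
      p l * ‖(1 / ((n : ℝ) * p l)) • (a l - b l) + (1 / (n : ℝ)) • ∑ k, b k‖ ^ 2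
      ≤ 2 * (p l * ‖(1 / ((n : ℝ) * p l)) • a l‖ ^ 2)
        + 2 * (p l * ‖(1 / ((n : ℝ) * p l)) • b l
            - ∑ k, p k • ((1 / ((n : ℝ) * p k)) • b k)‖ ^ 2) := by
    intro l _
    have h2 : (1 / ((n : ℝ) * p l)) • (a l - b l) + (1 / (n : ℝ)) • ∑ k, b k
        = (1 / ((n : ℝ) * p l)) • a l - ((1 / ((n : ℝ) * p l)) • b l
            - ∑ k, p k • ((1 / ((n : ℝ) * p k)) • b k)) := by
      rw [hmean, smul_sub]; abel
    rw [h2]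
    have h3 := mul_le_mul_of_nonneg_left (norm_sub_sq_le_two ((1 / ((n : ℝ) * p l)) • a l)
      ((1 / ((n : ℝ) * p l)) • b l - ∑ k, p k • ((1 / ((n : ℝ) * p k)) • b k))) (hp0 l).le
    linarith
  refine (Finset.sum_le_sum h1).trans ?_
  rw [Finset.sum_add_distrib, ← Finset.mul_sum, ← Finset.mul_sum]
  have h4 := key a Ka ha
  have h5 := (sum_mul_norm_sub_mean_sq_le hp fun l => (1 / ((n : ℝ) * p l)) • b l).trans
    (key b Kb hb)
  have h6 : 2 / q * (Ka + Kb) = 2 * (1 / q * Ka) + 2 * (1 / q * Kb) := by ring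
  rw [h6]
  linarith

/-- Expansion of the mean squared distance after a step `-s c` whose direction is random. -/
theorem sum_mul_norm_sub_smul_sq {p : Fin n → ℝ} (hp : ∑ l, p l = 1) (x : E d) (s : ℝ)
    (c : Fin n → E d) :
    ∑ l, p l * ‖x - s • c l‖ ^ 2
      = ‖x‖ ^ 2 - 2 * s * inner ℝ x (∑ l, p l • c l) + s ^ 2 * ∑ l, p l * ‖c l‖ ^ 2 := by
  have h1 : ∀ l, p l * ‖x - s • c l‖ ^ 2
      = p l * ‖x‖ ^ 2 - 2 * s * inner ℝ x (p l • c l) + s ^ 2 * (p l * ‖c l‖ ^ 2) := by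
    intro l
    rw [norm_sub_sq_real, norm_smul, mul_pow, Real.norm_eq_abs, sq_abs, real_inner_smul_right,
      real_inner_smul_right]
    ring
  simp only [h1, Finset.sum_add_distrib, Finset.sum_sub_distrib, ← Finset.mul_sum,
    ← Finset.sum_mul, hp, ← inner_sum, one_mul]

end Svrg

namespace Data.Assumptions

variable {m n dx dy : ℕ} {D : Data m n dx dy} {G : SimpleGraph (Fin m)}

theorem m_pos (hD : D.Assumptions G) : 0 < m := by have := hD.two_le_m; omega

theorem n_pos (hD : D.Assumptions G) : 0 < n := by
  rcases Nat.eq_zero_or_pos n with h | h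
  · subst h
    have := hD.prob_sum ⟨0, hD.m_pos⟩
    simp at this
  · exact h

theorem hasGradientAt_fi_x (hD : D.Assumptions G) (i : Fin m) {x : E dx} {y : E dy} (hx : x ∈ D.X)
    (hy : y ∈ D.Y) :
    HasGradientAt (fun x' => D.fi i x' y) ((1 / (n : ℝ)) • ∑ j, D.gradXij i j x y) x := by
  rw [hasGradientAt_iff_hasFDerivAt]
  have h1 : HasFDerivAt (fun x' => ∑ j, D.f i j x' y)
      (∑ j, InnerProductSpace.toDual ℝ (E dx) (D.gradXij i j x y)) x :=
    HasFDerivAt.fun_sum fun j _ => (hD.diff_x i j x hx y hy).hasGradientAt.hasFDerivAt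
  have h2 := h1.const_mul (1 / (n : ℝ))
  unfold fi
  rw [map_smul, map_sum]
  exact h2

theorem hasGradientAt_fi_y (hD : D.Assumptions G) (i : Fin m) {x : E dx} {y : E dy} (hx : x ∈ D.X)
    (hy : y ∈ D.Y) :
    HasGradientAt (fun y' => D.fi i x y') ((1 / (n : ℝ)) • ∑ j, D.gradYij i j x y) y := by
  rw [hasGradientAt_iff_hasFDerivAt]
  have h1 : HasFDerivAt (fun y' => ∑ j, D.f i j x y')
      (∑ j, InnerProductSpace.toDual ℝ (E dy) (D.gradYij i j x y)) y :=
    HasFDerivAt.fun_sum fun j _ => (hD.diff_y i j x hx y hy).hasGradientAt.hasFDerivAt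
  have h2 := h1.const_mul (1 / (n : ℝ))
  unfold fi
  rw [map_smul, map_sum]
  exact h2

theorem gradX_eq (hD : D.Assumptions G) (i : Fin m) {x : E dx} {y : E dy} (hx : x ∈ D.X)
    (hy : y ∈ D.Y) : D.gradX i x y = (1 / (n : ℝ)) • ∑ j, D.gradXij i j x y :=
  (hD.hasGradientAt_fi_x i hx hy).gradient

theorem gradY_eq (hD : D.Assumptions G) (i : Fin m) {x : E dx} {y : E dy} (hx : x ∈ D.X)
    (hy : y ∈ D.Y) : D.gradY i x y = (1 / (n : ℝ)) • ∑ j, D.gradYij i j x y :=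
  (hD.hasGradientAt_fi_y i hx hy).gradient

/-- Strong monotonicity of the saddle operator `(∇ₓ fᵢ, -∇ᵧ fᵢ)` on `X × Y`. It follows from four
first-order inequalities in which all function values cancel. -/
theorem saddle_monotone (hD : D.Assumptions G) (i : Fin m) {x xs : E dx} {y ys : E dy}
    (hx : x ∈ D.X) (hy : y ∈ D.Y) (hxs : xs ∈ D.X) (hys : ys ∈ D.Y) :
    D.μx * ‖x - xs‖ ^ 2 + D.μy * ‖y - ys‖ ^ 2
      ≤ inner ℝ (x - xs) (D.gradX i x y - D.gradX i xs ys)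
        - inner ℝ (y - ys) (D.gradY i x y - D.gradY i xs ys) := by
  have h1 := strongConvexOn_gradient (hD.strong_convex i y hy) hx hxs
    (hD.hasGradientAt_fi_x i hx hy).differentiableAt
  have h2 := strongConvexOn_gradient (hD.strong_convex i ys hys) hxs hx
    (hD.hasGradientAt_fi_x i hxs hys).differentiableAt
  have h3 := strongConcaveOn_gradient (hD.strong_concave i x hx) hy hys
    (hD.hasGradientAt_fi_y i hx hy).differentiableAt
  have h4 := strongConcaveOn_gradient (hD.strong_concave i xs hxs) hys hy
    (hD.hasGradientAt_fi_y i hxs hys).differentiableAt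
  change D.fi i x y + inner ℝ (D.gradX i x y) (xs - x) + _ ≤ _ at h1
  change D.fi i xs ys + inner ℝ (D.gradX i xs ys) (x - xs) + _ ≤ _ at h2
  change D.fi i x ys ≤ D.fi i x y + inner ℝ (D.gradY i x y) (ys - y) - _ at h3
  change D.fi i xs y ≤ D.fi i xs ys + inner ℝ (D.gradY i xs ys) (y - ys) - _ at h4
  rw [norm_sub_rev xs x, ← neg_sub x xs, inner_neg_right] at h1
  rw [norm_sub_rev ys y, ← neg_sub y ys, inner_neg_right] at h3
  rw [inner_sub_right, inner_sub_right, real_inner_comm (D.gradX i x y),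
    real_inner_comm (D.gradX i xs ys), real_inner_comm (D.gradY i x y),
    real_inner_comm (D.gradY i xs ys)]
  linarith

theorem sq_add_le {a b c d e : ℝ} (h0 : 0 ≤ a) (h : a ≤ b * c + d * e) :
    a ^ 2 ≤ 2 * (b ^ 2 * c ^ 2 + d ^ 2 * e ^ 2) := by
  nlinarith [sq_nonneg (b * c - d * e)]

theorem gradXij_lip (hD : D.Assumptions G) (i : Fin m) (j : Fin n) {x xs : E dx} {y ys : E dy}
    (hx : x ∈ D.X) (hy : y ∈ D.Y) (hxs : xs ∈ D.X) (hys : ys ∈ D.Y) :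
    ‖D.gradXij i j x y - D.gradXij i j xs ys‖ ≤ D.Lxx * ‖x - xs‖ + D.Lxy * ‖y - ys‖ := by
  have h1 := hD.lip_xx i j y hy x hx xs hxs
  have h2 := hD.lip_xy i j xs hxs y hy ys hys
  have h3 := norm_sub_le_norm_sub_add_norm_sub (D.gradXij i j x y) (D.gradXij i j xs y)
    (D.gradXij i j xs ys)
  linarith

theorem gradYij_lip (hD : D.Assumptions G) (i : Fin m) (j : Fin n) {x xs : E dx} {y ys : E dy}
    (hx : x ∈ D.X) (hy : y ∈ D.Y) (hxs : xs ∈ D.X) (hys : ys ∈ D.Y) :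
    ‖D.gradYij i j x y - D.gradYij i j xs ys‖ ≤ D.Lyy * ‖y - ys‖ + D.Lyx * ‖x - xs‖ := by
  have h1 := hD.lip_yy i j x hx y hy ys hys
  have h2 := hD.lip_yx i j ys hys x hx xs hxs
  have h3 := norm_sub_le_norm_sub_add_norm_sub (D.gradYij i j x y) (D.gradYij i j x ys)
    (D.gradYij i j xs ys)
  linarith

theorem pmin_le (D : Data m n dx dy) (i : Fin m) (j : Fin n) : D.pmin ≤ D.prob i j :=
  ciInf_le (f := fun k : Fin m × Fin n => D.prob k.1 k.2) (Set.finite_range _).bddBelow (i, j)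

theorem npmin_pos (hD : D.Assumptions G) : 0 < D.npmin := by
  have : Nonempty (Fin m × Fin n) := ⟨(⟨0, hD.m_pos⟩, ⟨0, hD.n_pos⟩)⟩
  obtain ⟨k, hk⟩ := exists_eq_ciInf_of_finite (f := fun k : Fin m × Fin n => D.prob k.1 k.2)
  have h1 : 0 < D.pmin := by
    unfold pmin; rw [← hk]; exact hD.prob_pos _ _
  have h2 : (0 : ℝ) < n := by exact_mod_cast hD.n_pos
  exact mul_pos h2 h1

theorem npmin_le (D : Data m n dx dy) (i : Fin m) (j : Fin n) : D.npmin ≤ n * D.prob i j :=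
  mul_le_mul_of_nonneg_left (pmin_le D i j) (Nat.cast_nonneg n)

theorem npmin_le_one (hD : D.Assumptions G) : D.npmin ≤ 1 := by
  rw [← hD.prob_sum ⟨0, hD.m_pos⟩]
  calc D.npmin = ∑ _j : Fin n, D.pmin := by simp [npmin]
    _ ≤ _ := Finset.sum_le_sum fun j _ => pmin_le D _ j

/-- Mean of the oracle in the primal variable. -/
theorem svrgX_mean (hD : D.Assumptions G) (i : Fin m) {x xr xs : E dx} {y yr ys : E dy}
    (hx : x ∈ D.X) (hy : y ∈ D.Y) (hxr : xr ∈ D.X) (hyr : yr ∈ D.Y) :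
    ∑ l, D.prob i l • (D.svrgX i l x y xr yr - D.gradX i xs ys)
      = D.gradX i x y - D.gradX i xs ys := by
  simp only [svrgX, hD.gradX_eq i hxr hyr, smul_sub (D.prob i _) _ (D.gradX i xs ys),
    Finset.sum_sub_distrib, ← Finset.sum_smul, hD.prob_sum, one_smul]
  rw [svrg_mean hD.n_pos (hD.prob_pos i) (hD.prob_sum i), hD.gradX_eq i hx hy]

/-- Mean of the oracle in the dual variable. -/
theorem svrgY_mean (hD : D.Assumptions G) (i : Fin m) {x xr xs : E dx} {y yr ys : E dy}
    (hx : x ∈ D.X) (hy : y ∈ D.Y) (hxr : xr ∈ D.X) (hyr : yr ∈ D.Y) :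
    ∑ l, D.prob i l • (D.svrgY i l x y xr yr - D.gradY i xs ys)
      = D.gradY i x y - D.gradY i xs ys := by
  simp only [svrgY, hD.gradY_eq i hxr hyr, smul_sub (D.prob i _) _ (D.gradY i xs ys),
    Finset.sum_sub_distrib, ← Finset.sum_smul, hD.prob_sum, one_smul]
  rw [svrg_mean hD.n_pos (hD.prob_pos i) (hD.prob_sum i), hD.gradY_eq i hx hy]

theorem svrgX_second_moment (hD : D.Assumptions G) (i : Fin m) {x xr xs : E dx} {y yr ys : E dy}
    (hx : x ∈ D.X) (hy : y ∈ D.Y) (hxr : xr ∈ D.X) (hyr : yr ∈ D.Y) (hxs : xs ∈ D.X)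
    (hys : ys ∈ D.Y) :
    ∑ l, D.prob i l * ‖D.svrgX i l x y xr yr - D.gradX i xs ys‖ ^ 2
      ≤ 2 / D.npmin * (2 * (D.Lxx ^ 2 * ‖x - xs‖ ^ 2 + D.Lxy ^ 2 * ‖y - ys‖ ^ 2)
        + 2 * (D.Lxx ^ 2 * ‖xr - xs‖ ^ 2 + D.Lxy ^ 2 * ‖yr - ys‖ ^ 2)) := by
  have h := svrg_second_moment hD.n_pos (hD.prob_pos i) (hD.prob_sum i) hD.npmin_pos (npmin_le D i)
    (fun l => D.gradXij i l x y - D.gradXij i l xs ys)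
    (fun l => D.gradXij i l xr yr - D.gradXij i l xs ys)
    (fun l => sq_add_le (norm_nonneg _) (hD.gradXij_lip i l hx hy hxs hys))
    (fun l => sq_add_le (norm_nonneg _) (hD.gradXij_lip i l hxr hyr hxs hys))
  refine le_trans (le_of_eq (Finset.sum_congr rfl fun l _ => ?_)) h
  rw [svrgX, hD.gradX_eq i hxr hyr, hD.gradX_eq i hxs hys, Finset.sum_sub_distrib,
    smul_sub (1 / (n : ℝ)), sub_sub_sub_cancel_right, add_sub_assoc]

theorem svrgY_second_moment (hD : D.Assumptions G) (i : Fin m) {x xr xs : E dx} {y yr ys : E dy}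
    (hx : x ∈ D.X) (hy : y ∈ D.Y) (hxr : xr ∈ D.X) (hyr : yr ∈ D.Y) (hxs : xs ∈ D.X)
    (hys : ys ∈ D.Y) :
    ∑ l, D.prob i l * ‖D.svrgY i l x y xr yr - D.gradY i xs ys‖ ^ 2
      ≤ 2 / D.npmin * (2 * (D.Lyy ^ 2 * ‖y - ys‖ ^ 2 + D.Lyx ^ 2 * ‖x - xs‖ ^ 2)
        + 2 * (D.Lyy ^ 2 * ‖yr - ys‖ ^ 2 + D.Lyx ^ 2 * ‖xr - xs‖ ^ 2)) := by
  have h := svrg_second_moment hD.n_pos (hD.prob_pos i) (hD.prob_sum i) hD.npmin_pos (npmin_le D i)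
    (fun l => D.gradYij i l x y - D.gradYij i l xs ys)
    (fun l => D.gradYij i l xr yr - D.gradYij i l xs ys)
    (fun l => sq_add_le (norm_nonneg _) (hD.gradYij_lip i l hx hy hxs hys))
    (fun l => sq_add_le (norm_nonneg _) (hD.gradYij_lip i l hxr hyr hxs hys))
  refine le_trans (le_of_eq (Finset.sum_congr rfl fun l _ => ?_)) h
  rw [svrgY, hD.gradY_eq i hxr hyr, hD.gradY_eq i hxs hys, Finset.sum_sub_distrib,
    smul_sub (1 / (n : ℝ)), sub_sub_sub_cancel_right, add_sub_assoc]

/-! ### First-order optimality at the saddle point -/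

/-- Optimality of the primal part of the saddle point, in the form required by
`norm_sub_prox_le`: `x⋆` is the proximal point of `H⋆`. -/
theorem saddle_variational_x (hD : D.Assumptions G) {xs : E dx} {ys : E dy}
    (hz : D.IsSolution xs ys) (hs : 0 < D.s) (i : Fin m) :
    ∀ u ∈ D.X, 0 ≤ inner ℝ (xs - D.HxStar xs ys i) (u - xs) + D.s * (D.g u - D.g xs) := by
  intro u hu
  obtain ⟨hxs, hys, hsp⟩ := hz
  have hm : (m : ℝ) ≠ 0 := by have := hD.m_pos; positivity
  have hPsi : ∀ x y, D.Psi x y = ((1 / (m : ℝ)) * ∑ i, D.fi i x y - D.r y) + D.g x := by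
    intro x y
    unfold Psi
    simp only [Finset.sum_add_distrib, Finset.sum_sub_distrib, Finset.sum_const, Finset.card_univ,
      Fintype.card_fin, nsmul_eq_mul]
    field_simp
    ring
  have hg : HasGradientAt (fun x => (1 / (m : ℝ)) * ∑ i, D.fi i x ys - D.r ys)
      ((1 / (m : ℝ)) • ∑ i, D.gradX i xs ys) xs := by
    rw [hasGradientAt_iff_hasFDerivAt]
    have h1 : HasFDerivAt (fun x' => ∑ i, D.fi i x' ys)
        (∑ i, InnerProductSpace.toDual ℝ (E dx) (D.gradX i xs ys)) xs :=
      HasFDerivAt.fun_sum fun i _ =>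
        (hD.hasGradientAt_fi_x i hxs hys).differentiableAt.hasGradientAt.hasFDerivAt
    rw [map_smul, map_sum]
    exact (h1.const_mul (1 / (m : ℝ))).sub_const _
  have hmin : IsMinOn (fun x => ((1 / (m : ℝ)) * ∑ i, D.fi i x ys - D.r ys) + D.g x) D.X xs := by
    intro x hx
    have := hsp x hx ys hys
    rw [hPsi, hPsi] at this
    exact this
  have h := isMinOn_add_gradient hD.g_convex hxs hg.differentiableAt hmin hu
  rw [hg.gradient] at h
  have h2 : xs - D.HxStar xs ys i = D.s • ((1 / (m : ℝ)) • ∑ i, D.gradX i xs ys) := by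
    rw [HxStar, sub_sub_cancel, smul_smul]; congr 1; ring
  rw [h2, real_inner_smul_left]
  have h3 := mul_nonneg hs.le h
  linarith

/-- Optimality of the dual part of the saddle point. -/
theorem saddle_variational_y (hD : D.Assumptions G) {xs : E dx} {ys : E dy}
    (hz : D.IsSolution xs ys) (hs : 0 < D.s) (i : Fin m) :
    ∀ u ∈ D.Y, 0 ≤ inner ℝ (ys - D.HyStar xs ys i) (u - ys) + D.s * (D.r u - D.r ys) := by
  intro u hu
  obtain ⟨hxs, hys, hsp⟩ := hz
  have hm : (m : ℝ) ≠ 0 := by have := hD.m_pos; positivity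
  have hPsi : ∀ x y, -D.Psi x y = (-(1 / (m : ℝ)) * ∑ i, D.fi i x y - D.g x) + D.r y := by
    intro x y
    unfold Psi
    simp only [Finset.sum_add_distrib, Finset.sum_sub_distrib, Finset.sum_const, Finset.card_univ,
      Fintype.card_fin, nsmul_eq_mul]
    field_simp
    ring
  have hg : HasGradientAt (fun y => -(1 / (m : ℝ)) * ∑ i, D.fi i xs y - D.g xs)
      (-(1 / (m : ℝ)) • ∑ i, D.gradY i xs ys) ys := by
    rw [hasGradientAt_iff_hasFDerivAt]
    have h1 : HasFDerivAt (fun y' => ∑ i, D.fi i xs y')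
        (∑ i, InnerProductSpace.toDual ℝ (E dy) (D.gradY i xs ys)) ys :=
      HasFDerivAt.fun_sum fun i _ =>
        (hD.hasGradientAt_fi_y i hxs hys).differentiableAt.hasGradientAt.hasFDerivAt
    rw [map_smul, map_sum]
    exact (h1.const_mul (-(1 / (m : ℝ)))).sub_const _
  have hmin : IsMinOn (fun y => (-(1 / (m : ℝ)) * ∑ i, D.fi i xs y - D.g xs) + D.r y) D.Y ys := by
    intro y hy
    have := neg_le_neg (hsp xs hxs y hy)
    rw [hPsi, hPsi] at this
    exact this
  have h := isMinOn_add_gradient hD.r_convex hys hg.differentiableAt hmin hu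
  rw [hg.gradient] at h
  have h2 : ys - D.HyStar xs ys i = D.s • (-(1 / (m : ℝ)) • ∑ i, D.gradY i xs ys) := by
    rw [HyStar, sub_add_cancel_left, smul_smul, ← neg_smul]; congr 1; ring
  rw [h2, real_inner_smul_left]
  have h3 := mul_nonneg hs.le h
  linarith

end Data.Assumptions

namespace Data

variable {m n dx dy : ℕ}

/-! ### Parameters and rates -/

/-- The admissibility of the parameters produced from a contraction amount `b`, with the bound on
the compression noise and the lower bound on the primal weight. -/
theorem stepParams_of (D : Data m n dx dy) {b l2 : ℝ} (hs : 0 < D.s) (hδ0 : 0 ≤ D.δ) (hl2 : 0 < l2)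
    (hl : l2 ≤ D.lamMax) (hb0 : 0 < b) (hb : b ≤ 1 / 24) {M : ℝ}
    (hM : M = 1 - Real.sqrt D.δ * (b / (1 + D.δ)) / (1 - D.gammaOf b / 2 * D.lamMax)) :
    StepParams D.s (D.gammaOf b) (Real.sqrt D.δ) (b / (1 + D.δ)) M D.lamMax l2 ∧
    D.δ * ((b / (1 + D.δ)) ^ 2 * Real.sqrt D.δ + D.gammaOf b * D.lamMax / 2
        + (D.gammaOf b) ^ 2 * D.lamMax ^ 2 / 4)
      ≤ Real.sqrt D.δ * (b / (1 + D.δ)) * (1 - b / (1 + D.δ)) ∧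
    1 - 4 / 7 * b ≤ M := by
  set r := Real.sqrt D.δ with hr
  have hr0 : 0 ≤ r := Real.sqrt_nonneg _
  have hr2 : r ^ 2 = D.δ := Real.sq_sqrt hδ0
  have hlm : 0 < D.lamMax := hl2.trans_le hl
  have h1δ : 0 < 1 + D.δ := by linarith
  set α := b / (1 + D.δ) with hα
  have hα0 : 0 < α := div_pos hb0 h1δ
  have hαb : α * (1 + D.δ) = b := div_mul_cancel₀ _ h1δ.ne'
  have hαle : α ≤ b := by nlinarith
  set γ := D.gammaOf b with hγ
  have hden : 0 < 1 / (4 * (1 + D.δ) * D.lamMax) := by positivity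
  have hγ0 : 0 < γ := by
    rw [hγ, gammaOf]
    split_ifs with h0
    · exact hden
    · have : 0 < Real.sqrt D.δ := Real.sqrt_pos.2 (lt_of_le_of_ne hδ0 (Ne.symm h0))
      exact lt_min (by positivity) hden
  have hγ1 : γ ≤ 1 / (4 * (1 + D.δ) * D.lamMax) := by
    rw [hγ, gammaOf]
    split_ifs with h0
    · exact le_rfl
    · exact min_le_right _ _
  have hγl : γ * D.lamMax ≤ 1 / 4 := by
    have h1 : γ * D.lamMax ≤ 1 / (4 * (1 + D.δ) * D.lamMax) * D.lamMax := by gcongr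
    have h2 : 1 / (4 * (1 + D.δ) * D.lamMax) * D.lamMax = 1 / (4 * (1 + D.δ)) := by field_simp
    have h3 : 1 / (4 * (1 + D.δ)) ≤ 1 / 4 := one_div_le_one_div_of_le (by norm_num) (by linarith)
    linarith
  -- the first member of the minimum defining `γ`, which is only present for `δ ≠ 0`
  have hrγ : r * (γ * D.lamMax) ≤ α / 4 := by
    by_cases h0 : D.δ = 0
    · have : r = 0 := by rw [hr, h0, Real.sqrt_zero]
      rw [this, zero_mul]; positivity
    · have hrpos : 0 < r := Real.sqrt_pos.2 (lt_of_le_of_ne hδ0 (Ne.symm h0))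
      have h1 : γ ≤ b / (4 * r * (1 + D.δ) * D.lamMax) := by
        rw [hγ, gammaOf, if_neg h0]; exact min_le_left _ _
      calc r * (γ * D.lamMax) ≤ r * (b / (4 * r * (1 + D.δ) * D.lamMax) * D.lamMax) := by gcongr
        _ = α / 4 := by rw [hα]; field_simp
  have ht : 7 / 8 ≤ 1 - γ / 2 * D.lamMax := by linarith
  have htp : 0 < 1 - γ / 2 * D.lamMax := by linarith
  have hrα : r * α ≤ b / 2 := by
    have : r ≤ (1 + D.δ) / 2 := by nlinarith [sq_nonneg (r - 1)]
    nlinarith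
  have hq : r * α / (1 - γ / 2 * D.lamMax) ≤ 4 / 7 * b := by
    rw [div_le_iff₀ htp]; nlinarith
  have hq0 : 0 ≤ r * α / (1 - γ / 2 * D.lamMax) := by positivity
  refine ⟨⟨hs, hγ0, hl2, hlm.le, by linarith, hr0, hα0.le, by linarith, by rw [hM]; linarith,
    by rw [hM]; linarith, ?_⟩, ?_, by rw [hM]; linarith⟩
  · rw [hM, sub_sub_cancel, div_mul_cancel₀ _ htp.ne']
  · have hg0 : 0 ≤ γ * D.lamMax := by positivity
    have h1 : r * (γ * D.lamMax / 2 + γ ^ 2 * D.lamMax ^ 2 / 4) ≤ α * (1 - b) := by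
      have h2 : r * (γ * D.lamMax) * (γ * D.lamMax) ≤ α / 4 * (1 / 4) :=
        mul_le_mul hrγ hγl hg0 (by positivity)
      nlinarith
    have h3 : D.δ * (α ^ 2 * r + γ * D.lamMax / 2 + γ ^ 2 * D.lamMax ^ 2 / 4)
        = r * (α * (α * D.δ) + r * (γ * D.lamMax / 2 + γ ^ 2 * D.lamMax ^ 2 / 4)) := by
      rw [← hr2]; ring
    have h4 : r * α * (1 - α) = r * (α * (α * D.δ) + α * (1 - b)) := by
      rw [← hαb]; ring
    rw [h3, h4]
    gcongr

/-- The consensus rate in terms of the graph condition number. -/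
theorem gammaOf_rate (D : Data m n dx dy) {b k : ℝ} (hδ0 : 0 ≤ D.δ) (hl2 : 0 < D.lamSnd)
    (hl : D.lamSnd ≤ D.lamMax) (hk : 0 < k) (hb : 1 / (144 * k) ≤ b) {F : ℝ}
    (hF1 : Real.sqrt D.δ * (1 + D.δ) * D.kg * k ≤ F) (hF2 : (1 + D.δ) * D.kg ≤ F) :
    1 / (1152 * F) ≤ D.gammaOf b / 2 * D.lamSnd := by
  have hlm : 0 < D.lamMax := hl2.trans_le hl
  have h1δ : 0 < 1 + D.δ := by linarith
  have hkg : 0 < D.kg := div_pos hlm hl2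
  have hkg' : D.lamMax = D.kg * D.lamSnd := by rw [kg, div_mul_cancel₀ _ hl2.ne']
  have h2 : 1 / (1152 * F) ≤ 1 / (4 * (1 + D.δ) * D.lamMax) / 2 * D.lamSnd := by
    have h3 : 1 / (4 * (1 + D.δ) * D.lamMax) / 2 * D.lamSnd = 1 / (8 * ((1 + D.δ) * D.kg)) := by
      rw [hkg']; field_simp; norm_num
    rw [h3]
    have : 0 < (1 + D.δ) * D.kg := by positivity
    exact one_div_le_one_div_of_le (by positivity) (by nlinarith)
  rw [gammaOf]
  split_ifs with h0
  · exact h2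
  · have hr : 0 < Real.sqrt D.δ := Real.sqrt_pos.2 (lt_of_le_of_ne hδ0 (Ne.symm h0))
    rcases min_choice (b / (4 * Real.sqrt D.δ * (1 + D.δ) * D.lamMax))
      (1 / (4 * (1 + D.δ) * D.lamMax)) with h | h
    · rw [h]
      calc 1 / (1152 * F) ≤ 1 / (1152 * (Real.sqrt D.δ * (1 + D.δ) * D.kg * k)) :=
            one_div_le_one_div_of_le (by positivity) (by linarith)
        _ = 1 / (144 * k) / (4 * Real.sqrt D.δ * (1 + D.δ) * D.lamMax) / 2 * D.lamSnd := by
            rw [hkg']; field_simp; norm_num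
        _ ≤ _ := by gcongr
    · rw [h]; exact h2

/-- The primal rate `(1 - b) / M` in terms of `b`. -/
theorem primal_rate_le {b M : ℝ} (hb0 : 0 < b) (hb : b ≤ 1 / 24) (hM : 1 - 4 / 7 * b ≤ M) :
    (1 - b) / M ≤ 1 - 3 / 7 * b := by
  rw [div_le_iff₀ (by linarith)]
  nlinarith

namespace Assumptions

variable {D : Data m n dx dy} {G : SimpleGraph (Fin m)}

theorem mu_pos (hD : D.Assumptions G) : 0 < D.μ := lt_min hD.μx_pos hD.μy_pos

theorem mu_le_L (hD : D.Assumptions G) : D.μ ≤ D.L :=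
  (min_le_left _ _).trans (hD.μx_le.trans ((le_max_left _ _).trans (le_max_left _ _)))

theorem L_pos (hD : D.Assumptions G) : 0 < D.L := hD.mu_pos.trans_le hD.mu_le_L

theorem s_pos (hD : D.Assumptions G) : 0 < D.s := by
  have h1 := hD.mu_pos; have h2 := hD.L_pos; have h3 := hD.npmin_pos
  unfold s; positivity

theorem s_sq_div (hD : D.Assumptions G) : D.s ^ 2 * D.L ^ 2 / D.npmin = D.s * D.μ / 24 := by
  have h2 := hD.L_pos; have h3 := hD.npmin_pos
  unfold s; field_simp

/-- A Lipschitz constant below `L` contributes at most `s μ / 24`. -/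
theorem s_sq_mul_le (hD : D.Assumptions G) {A : ℝ} (h0 : 0 ≤ A) (hA : A ≤ D.L) :
    D.s ^ 2 * A ^ 2 / D.npmin ≤ D.s * D.μ / 24 := by
  rw [← hD.s_sq_div]
  have h3 := hD.npmin_pos
  gcongr

theorem ctx_mul_p (hD : D.Assumptions G) :
    D.ctx * D.p = 8 * (D.s ^ 2 * D.Lxx ^ 2 / D.npmin + D.s ^ 2 * D.Lyx ^ 2 / D.npmin) := by
  have h3 := hD.npmin_pos; have h4 := hD.p_pos
  unfold ctx; field_simp

theorem cty_mul_p (hD : D.Assumptions G) :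
    D.cty * D.p = 8 * (D.s ^ 2 * D.Lyy ^ 2 / D.npmin + D.s ^ 2 * D.Lxy ^ 2 / D.npmin) := by
  have h3 := hD.npmin_pos; have h4 := hD.p_pos
  unfold cty; field_simp

theorem Lxx_bounds (hD : D.Assumptions G) : 0 ≤ D.Lxx ∧ D.Lxx ≤ D.L :=
  ⟨hD.μx_pos.le.trans hD.μx_le, (le_max_left _ _).trans (le_max_left _ _)⟩

theorem Lyy_bounds (hD : D.Assumptions G) : 0 ≤ D.Lyy ∧ D.Lyy ≤ D.L :=
  ⟨hD.μy_pos.le.trans hD.μy_le, (le_max_right _ _).trans (le_max_left _ _)⟩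

theorem Lxy_bounds (hD : D.Assumptions G) : 0 ≤ D.Lxy ∧ D.Lxy ≤ D.L :=
  ⟨hD.Lxy_nonneg, (le_max_left _ _).trans (le_max_right _ _)⟩

theorem Lyx_bounds (hD : D.Assumptions G) : 0 ≤ D.Lyx ∧ D.Lyx ≤ D.L :=
  ⟨hD.Lyx_nonneg, (le_max_right _ _).trans (le_max_right _ _)⟩

theorem s_mul_le (hD : D.Assumptions G) {μ' : ℝ} (h : μ' ≤ D.L) : D.s * μ' ≤ 1 / 24 := by
  have h1 := hD.mu_pos; have h2 := hD.L_pos; have h3 := hD.npmin_pos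
  calc D.s * μ' ≤ D.s * D.L := by have := hD.s_pos; gcongr
    _ = (D.μ / D.L) * D.npmin / 24 := by unfold s; field_simp
    _ ≤ 1 * 1 / 24 := by
        have := (div_le_one h2).2 hD.mu_le_L
        have := hD.npmin_le_one
        gcongr
    _ = 1 / 24 := by norm_num

theorem bX_bounds (hD : D.Assumptions G) : D.s * D.μ / 6 ≤ D.bX ∧ D.bX ≤ 1 / 24 := by
  have hc := hD.ctx_mul_p
  have h1 := hD.s_sq_mul_le hD.Lxx_bounds.1 hD.Lxx_bounds.2
  have h2 := hD.s_sq_mul_le hD.Lyx_bounds.1 hD.Lyx_bounds.2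
  have h3 := hD.s_mul_le (hD.μx_le.trans hD.Lxx_bounds.2)
  have h4 : D.s * D.μ ≤ D.s * D.μx := mul_le_mul_of_nonneg_left (min_le_left _ _) hD.s_pos.le
  have h5 : 4 * D.s ^ 2 * D.Lyx ^ 2 / D.npmin = 4 * (D.s ^ 2 * D.Lyx ^ 2 / D.npmin) := by ring
  have h6 := hD.npmin_pos
  have h7 : 0 ≤ D.s ^ 2 * D.Lyx ^ 2 / D.npmin := by positivity
  have h8 : 0 ≤ D.s ^ 2 * D.Lxx ^ 2 / D.npmin := by positivity
  unfold bX
  rw [hc, h5]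
  constructor <;> linarith

theorem bY_bounds (hD : D.Assumptions G) : D.s * D.μ / 6 ≤ D.bY ∧ D.bY ≤ 1 / 24 := by
  have hc := hD.cty_mul_p
  have h1 := hD.s_sq_mul_le hD.Lyy_bounds.1 hD.Lyy_bounds.2
  have h2 := hD.s_sq_mul_le hD.Lxy_bounds.1 hD.Lxy_bounds.2
  have h3 := hD.s_mul_le (hD.μy_le.trans hD.Lyy_bounds.2)
  have h4 : D.s * D.μ ≤ D.s * D.μy := mul_le_mul_of_nonneg_left (min_le_right _ _) hD.s_pos.le
  have h5 : 4 * D.s ^ 2 * D.Lxy ^ 2 / D.npmin = 4 * (D.s ^ 2 * D.Lxy ^ 2 / D.npmin) := by ring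
  have h6 := hD.npmin_pos
  have h7 : 0 ≤ D.s ^ 2 * D.Lxy ^ 2 / D.npmin := by positivity
  have h8 : 0 ≤ D.s ^ 2 * D.Lyy ^ 2 / D.npmin := by positivity
  unfold bY
  rw [hc, h5]
  constructor <;> linarith

theorem smu_pos (hD : D.Assumptions G) : 0 < D.s * D.μ / 6 := by
  have := hD.s_pos; have := hD.mu_pos; positivity

theorem bX_pos (hD : D.Assumptions G) : 0 < D.bX := hD.smu_pos.trans_le hD.bX_bounds.1

theorem bY_pos (hD : D.Assumptions G) : 0 < D.bY := hD.smu_pos.trans_le hD.bY_bounds.1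

theorem lam_bounds (hD : D.Assumptions G) : 0 < D.lamSnd ∧ D.lamSnd ≤ D.lamMax := by
  have h := exists_spectralData hD.two_le_m hD.W_symm hD.W_row_sum hD.W_nonneg hD.graph_connected
    hD.W_pos_iff
  exact ⟨h.1, h.2.1⟩

theorem spectral (hD : D.Assumptions G) :
    ∃ a φ, SpectralData (1 - D.W) D.lamMax D.lamSnd a φ :=
  (exists_spectralData hD.two_le_m hD.W_symm hD.W_row_sum hD.W_nonneg hD.graph_connected
    hD.W_pos_iff).2.2

theorem stepParams_x (hD : D.Assumptions G) :
    StepParams D.s D.γx (Real.sqrt D.δ) D.αx D.Mx D.lamMax D.lamSnd ∧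
    D.δ * (D.αx ^ 2 * Real.sqrt D.δ + D.γx * D.lamMax / 2 + D.γx ^ 2 * D.lamMax ^ 2 / 4)
      ≤ Real.sqrt D.δ * D.αx * (1 - D.αx) ∧ 1 - 4 / 7 * D.bX ≤ D.Mx :=
  D.stepParams_of hD.s_pos hD.δ_nonneg hD.lam_bounds.1 hD.lam_bounds.2 hD.bX_pos hD.bX_bounds.2 rfl

theorem stepParams_y (hD : D.Assumptions G) :
    StepParams D.s D.γy (Real.sqrt D.δ) D.αy D.My D.lamMax D.lamSnd ∧
    D.δ * (D.αy ^ 2 * Real.sqrt D.δ + D.γy * D.lamMax / 2 + D.γy ^ 2 * D.lamMax ^ 2 / 4)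
      ≤ Real.sqrt D.δ * D.αy * (1 - D.αy) ∧ 1 - 4 / 7 * D.bY ≤ D.My :=
  D.stepParams_of hD.s_pos hD.δ_nonneg hD.lam_bounds.1 hD.lam_bounds.2 hD.bY_pos hD.bY_bounds.2 rfl

theorem half_le_Mx (hD : D.Assumptions G) : 1 / 2 ≤ D.Mx := by
  have := hD.stepParams_x.2.2; have := hD.bX_bounds.2; linarith

theorem half_le_My (hD : D.Assumptions G) : 1 / 2 ≤ D.My := by
  have := hD.stepParams_y.2.2; have := hD.bY_bounds.2; linarith

theorem two_le_complexityFactor (hD : D.Assumptions G) : 2 ≤ D.complexityFactor := by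
  have h1 : 2 / D.p ≤ D.complexityFactor := by
    unfold complexityFactor
    exact (le_max_right _ _).trans ((le_max_right _ _).trans ((le_max_right _ _).trans
      (le_max_right _ _)))
  have h2 : 2 ≤ 2 / D.p := by
    rw [le_div_iff₀ hD.p_pos]; linarith [hD.p_le_one]
  linarith

/-- The contraction factor is separated from `1` by the inverse of the complexity factor. -/
theorem rho_le (hD : D.Assumptions G) : D.ρ ≤ 1 - 1 / (1152 * D.complexityFactor) := by
  set F := D.complexityFactor with hF
  have hF2 : 2 ≤ F := hD.two_le_complexityFactor
  have hF0 : 0 < F := by linarith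
  have c1 : D.kf ^ 2 / D.npmin ≤ F := le_max_left _ _
  have c2 : Real.sqrt D.δ * (1 + D.δ) * D.kg * (D.kf ^ 2 / D.npmin) ≤ F := by
    rw [← mul_div_assoc]
    exact (le_max_left _ _).trans (le_max_right _ _)
  have c3 : (1 + D.δ) * D.kg ≤ F :=
    (le_max_left _ _).trans ((le_max_right _ _).trans (le_max_right _ _))
  have c4 : (1 + D.δ) * (D.kf ^ 2 / D.npmin) ≤ F := by
    rw [← mul_div_assoc]
    exact (le_max_left _ _).trans ((le_max_right _ _).trans ((le_max_right _ _).trans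
      (le_max_right _ _)))
  have c5 : 2 / D.p ≤ F :=
    (le_max_right _ _).trans ((le_max_right _ _).trans ((le_max_right _ _).trans
      (le_max_right _ _)))
  have hμ := hD.mu_pos; have hL := hD.L_pos; have hnp := hD.npmin_pos
  have hδ := hD.δ_nonneg
  have hk : 0 < D.kf ^ 2 / D.npmin := by unfold kf; positivity
  have hsm : D.s * D.μ / 6 = 1 / (144 * (D.kf ^ 2 / D.npmin)) := by
    unfold s kf; field_simp; norm_num
  have hb : ∀ b, D.s * D.μ / 6 ≤ b → 1 / (1152 * F) ≤ 3 / 7 * b := by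
    intro b hb
    have h1 : 1 / (1152 * F) ≤ 1 / (1152 * (D.kf ^ 2 / D.npmin)) :=
      one_div_le_one_div_of_le (by positivity) (by linarith)
    have h2 : 1 / (1152 * (D.kf ^ 2 / D.npmin)) = 1 / 8 * (1 / (144 * (D.kf ^ 2 / D.npmin))) := by
      field_simp; norm_num
    have := hD.smu_pos
    rw [h2, ← hsm] at h1
    linarith
  have hα : ∀ b, D.s * D.μ / 6 ≤ b → 1 / (1152 * F) ≤ b / (1 + D.δ) := by
    intro b hb
    have h1 : 1 / (1152 * F) ≤ 1 / (144 * ((1 + D.δ) * (D.kf ^ 2 / D.npmin))) :=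
      one_div_le_one_div_of_le (by positivity) (by linarith)
    have h2 : 1 / (144 * ((1 + D.δ) * (D.kf ^ 2 / D.npmin)))
        = 1 / (144 * (D.kf ^ 2 / D.npmin)) / (1 + D.δ) := by field_simp
    rw [h2, ← hsm] at h1
    refine h1.trans ?_
    gcongr
  have hγ : ∀ b, D.s * D.μ / 6 ≤ b → 1 / (1152 * F) ≤ D.gammaOf b / 2 * D.lamSnd := fun b hb =>
    D.gammaOf_rate hδ hD.lam_bounds.1 hD.lam_bounds.2 hk (hsm ▸ hb) c2 c3
  have hp : 1 / (1152 * F) ≤ D.p / 2 := by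
    have h0 := hD.p_pos
    calc 1 / (1152 * F) ≤ 1 / (2 / D.p) :=
          one_div_le_one_div_of_le (by positivity) (by linarith)
      _ = D.p / 2 := one_div_div _ _
  have hbx := hD.bX_bounds
  have hby := hD.bY_bounds
  have q1 := primal_rate_le hD.bX_pos hbx.2 hD.stepParams_x.2.2
  have q2 := primal_rate_le hD.bY_pos hby.2 hD.stepParams_y.2.2
  have r1 := hb _ hbx.1
  have r2 := hb _ hby.1
  have r3 : 1 / (1152 * F) ≤ D.γx / 2 * D.lamSnd := hγ _ hbx.1
  have r4 : 1 / (1152 * F) ≤ D.γy / 2 * D.lamSnd := hγ _ hby.1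
  have r5 : 1 / (1152 * F) ≤ D.αx := hα _ hbx.1
  have r6 : 1 / (1152 * F) ≤ D.αy := hα _ hby.1
  unfold ρ
  refine max_le ?_ (max_le ?_ (max_le ?_ (max_le ?_ (max_le ?_ (max_le ?_ ?_))))) <;> linarith

theorem rho_lt_one (hD : D.Assumptions G) : D.ρ < 1 := by
  have h1 := hD.rho_le
  have h2 := hD.two_le_complexityFactor
  have h3 : 0 < 1 / (1152 * D.complexityFactor) := by positivity
  linarith

theorem rho_bounds (D : Data m n dx dy) : (1 - D.bX) / D.Mx ≤ D.ρ ∧ (1 - D.bY) / D.My ≤ D.ρ ∧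
    1 - D.γx / 2 * D.lamSnd ≤ D.ρ ∧ 1 - D.γy / 2 * D.lamSnd ≤ D.ρ ∧ 1 - D.αx ≤ D.ρ ∧
    1 - D.αy ≤ D.ρ ∧ 1 - D.p / 2 ≤ D.ρ := by
  simp [ρ]

theorem rho_pos (hD : D.Assumptions G) : 0 < D.ρ := by
  have h1 := (rho_bounds D).2.2.2.2.2.2
  have h2 := hD.p_le_one
  linarith

/-- Mean contraction of a gradient step at one node, in the primal and dual variables together. -/
theorem oracle_step (hD : D.Assumptions G) (i : Fin m) {x xr xs : E dx} {y yr ys : E dy}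
    (hx : x ∈ D.X) (hy : y ∈ D.Y) (hxr : xr ∈ D.X) (hyr : yr ∈ D.Y) (hxs : xs ∈ D.X)
    (hys : ys ∈ D.Y) :
    ∑ l, D.prob i l * ‖x - xs - D.s • (D.svrgX i l x y xr yr - D.gradX i xs ys)‖ ^ 2
      + ∑ l, D.prob i l * ‖y - ys + D.s • (D.svrgY i l x y xr yr - D.gradY i xs ys)‖ ^ 2
    ≤ (1 - D.bX - D.ctx * D.p) * ‖x - xs‖ ^ 2 + (1 - D.bY - D.cty * D.p) * ‖y - ys‖ ^ 2
      + D.ctx * D.p / 2 * ‖xr - xs‖ ^ 2 + D.cty * D.p / 2 * ‖yr - ys‖ ^ 2 := by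
  have hY : ∀ l, y - ys + D.s • (D.svrgY i l x y xr yr - D.gradY i xs ys)
      = y - ys - (-D.s) • (D.svrgY i l x y xr yr - D.gradY i xs ys) := by
    intro l; rw [neg_smul, sub_neg_eq_add]
  simp only [hY]
  rw [sum_mul_norm_sub_smul_sq (hD.prob_sum i), sum_mul_norm_sub_smul_sq (hD.prob_sum i),
    hD.svrgX_mean i hx hy hxr hyr, hD.svrgY_mean i hx hy hxr hyr]
  have h1 := hD.svrgX_second_moment i hx hy hxr hyr hxs hys
  have h2 := hD.svrgY_second_moment i hx hy hxr hyr hxs hys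
  have h3 := hD.saddle_monotone i hx hy hxs hys
  have hs := hD.s_pos
  have h1' := mul_le_mul_of_nonneg_left h1 (sq_nonneg D.s)
  have h2' := mul_le_mul_of_nonneg_left h2 (sq_nonneg D.s)
  have h3' := mul_le_mul_of_nonneg_left h3 (by linarith : 0 ≤ 2 * D.s)
  have b1 : D.bX = D.s * D.μx - 4 * (D.s ^ 2 * D.Lyx ^ 2 / D.npmin) - D.ctx * D.p := by
    unfold bX; ring
  have b2 : D.bY = D.s * D.μy - 4 * (D.s ^ 2 * D.Lxy ^ 2 / D.npmin) - D.cty * D.p := by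
    unfold bY; ring
  rw [b1, b2, hD.ctx_mul_p, hD.cty_mul_p]
  have e1 := hD.s_sq_mul_le hD.Lxx_bounds.1 hD.Lxx_bounds.2
  have e2 := hD.s_sq_mul_le hD.Lyy_bounds.1 hD.Lyy_bounds.2
  have m1 : D.s * D.μ ≤ D.s * D.μx := mul_le_mul_of_nonneg_left (min_le_left _ _) hs.le
  have m2 : D.s * D.μ ≤ D.s * D.μy := mul_le_mul_of_nonneg_left (min_le_right _ _) hs.le
  have hμ : 0 < D.s * D.μ := mul_pos hs hD.mu_pos
  -- half of the strong monotonicity pays for the noise in the own variable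
  have t1 : 4 * (D.s ^ 2 * D.Lxx ^ 2 / D.npmin) * ‖x - xs‖ ^ 2 ≤ D.s * D.μx * ‖x - xs‖ ^ 2 :=
    mul_le_mul_of_nonneg_right (by linarith) (sq_nonneg _)
  have t2 : 4 * (D.s ^ 2 * D.Lyy ^ 2 / D.npmin) * ‖y - ys‖ ^ 2 ≤ D.s * D.μy * ‖y - ys‖ ^ 2 :=
    mul_le_mul_of_nonneg_right (by linarith) (sq_nonneg _)
  rw [neg_sq]
  generalize ‖x - xs‖ ^ 2 = nx at *
  generalize ‖y - ys‖ ^ 2 = ny at *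
  generalize ‖xr - xs‖ ^ 2 = nxr at *
  generalize ‖yr - ys‖ ^ 2 = nyr at *
  have q1 : D.s ^ 2 * (2 / D.npmin * (2 * (D.Lxx ^ 2 * nx + D.Lxy ^ 2 * ny)
        + 2 * (D.Lxx ^ 2 * nxr + D.Lxy ^ 2 * nyr)))
      = 4 * (D.s ^ 2 * D.Lxx ^ 2 / D.npmin) * nx + 4 * (D.s ^ 2 * D.Lxy ^ 2 / D.npmin) * ny
        + 4 * (D.s ^ 2 * D.Lxx ^ 2 / D.npmin) * nxr
        + 4 * (D.s ^ 2 * D.Lxy ^ 2 / D.npmin) * nyr := by ring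
  have q2 : D.s ^ 2 * (2 / D.npmin * (2 * (D.Lyy ^ 2 * ny + D.Lyx ^ 2 * nx)
        + 2 * (D.Lyy ^ 2 * nyr + D.Lyx ^ 2 * nxr)))
      = 4 * (D.s ^ 2 * D.Lyy ^ 2 / D.npmin) * ny + 4 * (D.s ^ 2 * D.Lyx ^ 2 / D.npmin) * nx
        + 4 * (D.s ^ 2 * D.Lyy ^ 2 / D.npmin) * nyr
        + 4 * (D.s ^ 2 * D.Lyx ^ 2 / D.npmin) * nxr := by ring
  rw [q1] at h1'
  rw [q2] at h2'
  linarith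

end Assumptions

end Data

/-! ### Fresh randomness: compression errors and discrete draws -/

section Probability

variable {Ω : Type*} {m₁ mΩ : MeasurableSpace Ω} {P : Measure Ω}

theorem integrable_norm_sq {d : ℕ} {u : Ω → E d} (hu : MemLp u 2 P) :
    Integrable (fun ω => ‖u ω‖ ^ 2) P :=
  (memLp_two_iff_integrable_sq_norm hu.1).1 hu

theorem integrable_inner_of_memLp {d : ℕ} {u v : Ω → E d} (hu : MemLp u 2 P) (hv : MemLp v 2 P) :
    Integrable (fun ω => inner ℝ (u ω) (v ω)) P := by
  have h : Integrable (fun ω => ‖u ω‖ * ‖v ω‖) P := hu.norm.integrable_mul hv.norm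
  exact h.mono' (hu.1.inner hv.1) (Filter.Eventually.of_forall fun ω => norm_inner_le_norm _ _)

theorem integrable_sum_norm_sq {m d : ℕ} {u : Ω → Fin m → E d}
    (hu : ∀ i, MemLp (fun ω => u ω i) 2 P) : Integrable (fun ω => ∑ i, ‖u ω i‖ ^ 2) P :=
  integrable_finsetSum _ fun i _ => integrable_norm_sq (hu i)

theorem integrable_sum_inner {m d : ℕ} {u v : Ω → Fin m → E d}
    (hu : ∀ i, MemLp (fun ω => u ω i) 2 P) (hv : ∀ i, MemLp (fun ω => v ω i) 2 P) :
    Integrable (fun ω => ∑ i, inner ℝ (u ω i) (v ω i)) P :=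
  integrable_finsetSum _ fun i _ => integrable_inner_of_memLp (hu i) (hv i)

theorem integrable_pinvNormSq {m d : ℕ} (A : Matrix (Fin m) (Fin m) ℝ) {u : Ω → Fin m → E d}
    (hu : ∀ i, MemLp (fun ω => u ω i) 2 P) : Integrable (fun ω => pinvNormSq A (u ω)) P :=
  integrable_finsetSum _ fun i _ => integrable_finsetSum _ fun j _ =>
    (integrable_inner_of_memLp (hu i) (hu j)).const_mul _

/-- The error of a compressor with a fresh seed, applied to an already known vector `U`: it is
square integrable, of mean square at most `δ E‖U‖²`, and uncorrelated with every known vector. -/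
theorem compressor_error [IsProbabilityMeasure P] {d : ℕ} {Θ : Type*} [MeasurableSpace Θ]
    {τ : Measure Θ}
    {Q : Θ → E d → E d} {δ : ℝ} (hQ : IsCompressor τ Q δ) (hm : m₁ ≤ mΩ)
    {ζ : Ω → Θ} (hζ : Measurable ζ) (hτ : P.map ζ = τ)
    (hind : Indep m₁ (MeasurableSpace.comap ζ inferInstance) P)
    {U : Ω → E d} (hU : Measurable[m₁] U) (hU2 : MemLp U 2 P) :
    MemLp (fun ω => Q (ζ ω) (U ω) - U ω) 2 P ∧
    ∫ ω, ‖Q (ζ ω) (U ω) - U ω‖ ^ 2 ∂P ≤ δ * ∫ ω, ‖U ω‖ ^ 2 ∂P ∧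
    ∀ V : Ω → E d, Measurable[m₁] V → MemLp V 2 P →
      ∫ ω, inner ℝ (Q (ζ ω) (U ω) - U ω) (V ω) ∂P = 0 := by
  have : IsProbabilityMeasure τ := hτ ▸ Measure.isProbabilityMeasure_map hζ.aemeasurable
  have hprod : ∀ {β : Type} [MeasurableSpace β] (w : Ω → β), Measurable[m₁] w →
      Measure.map (fun ω => (w ω, ζ ω)) P = (Measure.map w P).prod τ := by
    intro β _ w hw
    have h1 : IndepFun w ζ P := by
      rw [IndepFun_iff_Indep]
      exact indep_of_indep_of_le_left hind hw.comap_le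
    rw [← hτ]
    exact (indepFun_iff_map_prod_eq_prod_map_map (hw.mono hm le_rfl).aemeasurable
      hζ.aemeasurable).1 h1
  have hU' : Measurable U := hU.mono hm le_rfl
  have hQm := hQ.meas
  have hFm : Measurable fun z : E d × Θ => Q z.2 z.1 - z.1 :=
    (hQm.comp (measurable_snd.prodMk measurable_fst)).sub measurable_fst
  have hem : Measurable fun ω => Q (ζ ω) (U ω) - U ω := hFm.comp (hU'.prodMk hζ)
  have hUsq := integrable_norm_sq hU2
  have hUsq' : Integrable (fun u => δ * ‖u‖ ^ 2) (Measure.map U P) := by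
    rw [integrable_map_measure (by fun_prop) hU'.aemeasurable]
    exact hUsq.const_mul δ
  have hmap := hprod U hU
  have hsm : StronglyMeasurable fun z : E d × Θ => ‖Q z.2 z.1 - z.1‖ ^ 2 :=
    (hFm.norm.pow_const 2).stronglyMeasurable
  have hinner : Integrable (fun u => ∫ θ, ‖Q θ u - u‖ ^ 2 ∂τ) (Measure.map U P) := by
    refine hUsq'.mono' (StronglyMeasurable.integral_prod_right
      (f := fun u θ => ‖Q θ u - u‖ ^ 2) hsm).aestronglyMeasurable
      (Filter.Eventually.of_forall fun u => ?_)
    rw [Real.norm_eq_abs, abs_of_nonneg (integral_nonneg fun θ => sq_nonneg _)]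
    exact hQ.variance u
  have hint : Integrable (fun z : E d × Θ => ‖Q z.2 z.1 - z.1‖ ^ 2)
      ((Measure.map U P).prod τ) := by
    rw [integrable_prod_iff hsm.aestronglyMeasurable]
    refine ⟨Filter.Eventually.of_forall fun u => hQ.sq_integrable u, ?_⟩
    simpa only [norm_pow, norm_norm] using hinner
  have hint' := hint
  rw [← hmap, integrable_map_measure hsm.aestronglyMeasurable (hU'.prodMk hζ).aemeasurable] at hint'
  have he2 : MemLp (fun ω => Q (ζ ω) (U ω) - U ω) 2 P :=
    (memLp_two_iff_integrable_sq_norm hem.aestronglyMeasurable).2 hint'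
  refine ⟨he2, ?_, ?_⟩
  · calc ∫ ω, ‖Q (ζ ω) (U ω) - U ω‖ ^ 2 ∂P
        = ∫ z, ‖Q z.2 z.1 - z.1‖ ^ 2 ∂(Measure.map (fun ω => (U ω, ζ ω)) P) :=
          (integral_map (hU'.prodMk hζ).aemeasurable hsm.aestronglyMeasurable).symm
      _ = ∫ u, ∫ θ, ‖Q θ u - u‖ ^ 2 ∂τ ∂(Measure.map U P) := by
          rw [hmap, integral_prod _ hint]
      _ ≤ ∫ u, δ * ‖u‖ ^ 2 ∂(Measure.map U P) :=
          integral_mono hinner hUsq' fun u => hQ.variance u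
      _ = δ * ∫ ω, ‖U ω‖ ^ 2 ∂P := by
          rw [integral_map hU'.aemeasurable (by fun_prop), integral_const_mul]
  · intro V hV hV2
    have hV' : Measurable V := hV.mono hm le_rfl
    have hmap2 := hprod (fun ω => (U ω, V ω)) (hU.prodMk hV)
    have hGm : StronglyMeasurable fun z : (E d × E d) × Θ =>
        (inner ℝ (Q z.2 z.1.1 - z.1.1) z.1.2 : ℝ) := by
      have h1 : Measurable fun z : (E d × E d) × Θ => Q z.2 z.1.1 - z.1.1 :=
        hFm.comp ((measurable_fst.comp measurable_fst).prodMk measurable_snd)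
      exact (h1.inner (measurable_snd.comp measurable_fst)).stronglyMeasurable
    have hUV : Measurable fun ω => ((U ω, V ω), ζ ω) := (hU'.prodMk hV').prodMk hζ
    have hintG : Integrable (fun z : (E d × E d) × Θ =>
        (inner ℝ (Q z.2 z.1.1 - z.1.1) z.1.2 : ℝ))
        ((Measure.map (fun ω => (U ω, V ω)) P).prod τ) := by
      rw [← hmap2, integrable_map_measure hGm.aestronglyMeasurable hUV.aemeasurable]
      exact integrable_inner_of_memLp he2 hV2
    calc ∫ ω, inner ℝ (Q (ζ ω) (U ω) - U ω) (V ω) ∂P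
        = ∫ z, (inner ℝ (Q z.2 z.1.1 - z.1.1) z.1.2 : ℝ)
            ∂(Measure.map (fun ω => ((U ω, V ω), ζ ω)) P) :=
          (integral_map hUV.aemeasurable hGm.aestronglyMeasurable).symm
      _ = ∫ w, ∫ θ, (inner ℝ (Q θ w.1 - w.1) w.2 : ℝ) ∂τ
            ∂(Measure.map (fun ω => (U ω, V ω)) P) := by
          rw [hmap2, integral_prod _ hintG]
      _ = 0 := by
          refine integral_eq_zero_of_ae (Filter.Eventually.of_forall fun w => ?_)
          have h1 : Integrable (fun θ => Q θ w.1 - w.1) τ :=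
            (hQ.integrable w.1).sub (integrable_const _)
          have h2 : ∫ θ, (Q θ w.1 - w.1) ∂τ = 0 := by
            rw [integral_sub (hQ.integrable w.1) (integrable_const _), hQ.unbiased]
            simp
          simp only [Pi.zero_apply]
          rw [show (fun θ => (inner ℝ (Q θ w.1 - w.1) w.2 : ℝ))
            = fun θ => inner ℝ w.2 (Q θ w.1 - w.1) from funext fun θ => real_inner_comm _ _,
            integral_inner h1, h2, inner_zero_right]

/-- Averaging over a fresh discrete draw. -/
theorem integral_fresh_draw {ι : Type*} [Fintype ι] [MeasurableSpace ι] [MeasurableSingletonClass ι]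
    {c : Ω → ι} (hc : Measurable c)
    (hind : Indep m₁ (MeasurableSpace.comap c inferInstance) P)
    {F : ι → Ω → ℝ} (hF : ∀ l, Measurable[m₁] (F l)) (hFi : ∀ l, Integrable (F l) P) :
    Integrable (fun ω => F (c ω) ω) P ∧
    ∫ ω, F (c ω) ω ∂P = ∑ l, P.real {ω | c ω = l} * ∫ ω, F l ω ∂P := by
  classical
  have hset : ∀ l, MeasurableSet {ω | c ω = l} := fun l => hc (measurableSet_singleton l)
  have hdec : (fun ω => F (c ω) ω)
      = fun ω => ∑ l, ({ω | c ω = l}.indicator (fun _ => (1 : ℝ)) ω) * F l ω := by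
    funext ω
    rw [Finset.sum_eq_single (c ω)]
    · simp
    · intro l _ hl
      have : ω ∉ {ω | c ω = l} := fun h => hl h.symm
      simp [this]
    · simp
  have hint : ∀ l, Integrable
      (fun ω => ({ω | c ω = l}.indicator (fun _ => (1 : ℝ)) ω) * F l ω) P := by
    intro l
    refine (hFi l).mono ((measurable_const.indicator (hset l)).aestronglyMeasurable.mul
      (hFi l).1) (Filter.Eventually.of_forall fun ω => ?_)
    by_cases h : ω ∈ {ω | c ω = l} <;> simp [Set.indicator, h]
  rw [hdec]
  refine ⟨integrable_finsetSum _ fun l _ => hint l, ?_⟩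
  rw [integral_finsetSum _ fun l _ => hint l]
  refine Finset.sum_congr rfl fun l _ => ?_
  have hI : IndepFun ({ω | c ω = l}.indicator (fun _ => (1 : ℝ))) (F l) P := by
    rw [IndepFun_iff_Indep]
    refine indep_of_indep_of_le_left (indep_of_indep_of_le_right hind.symm (hF l).comap_le) ?_
    have : Measurable[MeasurableSpace.comap c inferInstance]
        ({ω | c ω = l}.indicator (fun _ => (1 : ℝ))) :=
      Measurable.indicator measurable_const ⟨{l}, measurableSet_singleton l, rfl⟩
    exact this.comap_le
  rw [hI.integral_fun_mul_eq_mul_integral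
    (measurable_const.indicator (hset l)).aestronglyMeasurable (hFi l).1,
    integral_indicator_const _ (hset l)]
  simp

end Probability

/-! ### The communication block -/

section Block

variable {m d : ℕ} {W : Matrix (Fin m) (Fin m) ℝ} {q : Fin m → E d → E d}
  {ν H HW : Fin m → E d} {α : ℝ}

/-- When `H^w = W H`, the two estimates produced by `comm` differ by `(I - W) ν̂`. -/
theorem comm_sub (hHW : ∀ i, HW i = ∑ j, W i j • H j) (i : Fin m) :
    (comm W q ν H HW α).nuHat i - (comm W q ν H HW α).nuHatW i
      = ∑ j, (1 - W) i j • (H j + q j (ν j - H j)) := by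
  simp only [comm, hHW, Matrix.sub_apply, sub_smul, Finset.sum_sub_distrib, Matrix.one_apply,
    ite_smul, one_smul, zero_smul, smul_add, Finset.sum_add_distrib]
  simp
  abel

/-- The block `comm` preserves the relation `H^w = W H`. -/
theorem comm_HWnew (hHW : ∀ i, HW i = ∑ j, W i j • H j) (i : Fin m) :
    (comm W q ν H HW α).HWnew i = ∑ j, W i j • (comm W q ν H HW α).Hnew j := by
  simp only [comm, hHW, smul_add, smul_smul, Finset.smul_sum, ← Finset.sum_add_distrib]
  refine Finset.sum_congr rfl fun j _ => ?_
  simp only [mul_comm (W i j)]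

theorem sum_one_sub_smul (hr : ∀ i, ∑ j, W i j = 1) (c : E d) (i : Fin m) :
    ∑ j, (1 - W) i j • c = 0 := by
  rw [← Finset.sum_smul]
  simp [Matrix.sub_apply, Matrix.one_apply, hr]

/-- The range of `I - W` consists of vectors with zero sum. -/
theorem sum_sum_one_sub_smul (hs : W.IsSymm) (hr : ∀ i, ∑ j, W i j = 1) (u : Fin m → E d) :
    ∑ i, ∑ j, (1 - W) i j • u j = 0 := by
  rw [Finset.sum_comm]
  refine Finset.sum_eq_zero fun j _ => ?_
  rw [← Finset.sum_smul]
  have hsy : ∀ i, W i j = W j i := fun i => hs.apply j i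
  simp [Matrix.sub_apply, Matrix.one_apply, hsy, hr]

variable {K : Set (E d)} {g : E d → ℝ}

/-- The one-step estimate for the primal and dual updates and the compression state, for a given
realization of the compressor. -/
theorem block_step {s γ r M lmax l2 : ℝ} (hp : StepParams s γ r α M lmax l2)
    {a : Fin m → ℝ} {φ : Fin m → Fin m → ℝ} (hA : SpectralData (1 - W) lmax l2 a φ)
    (hr : ∀ i, ∑ j, W i j = 1)
    (hK : IsCompact K) (hne : K.Nonempty) (hg : ConvexOn ℝ K g) (hc : ContinuousOn g K)
    (hHW : ∀ i, HW i = ∑ j, W i j • H j) {Dd Ds : Fin m → E d} (hDd : ∑ i, Dd i = 0)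
    (hDs : ∑ i, Ds i = 0) {xs hs : E d} (hxs : xs ∈ K)
    (hvar : ∀ u ∈ K, 0 ≤ inner ℝ (xs - hs) (u - xs) + s * (g u - g xs)) :
    M * sqDist (fun i => prox K g s (ν i - (γ / 2) •
        ((comm W q ν H HW α).nuHat i - (comm W q ν H HW α).nuHatW i))) (fun _ => xs)
      + 2 * s ^ 2 / γ * pinvNormSq (1 - W) (fun i => (Dd i + (γ / (2 * s)) •
        ((comm W q ν H HW α).nuHat i - (comm W q ν H HW α).nuHatW i)) - Ds i)
      + r * sqDist (comm W q ν H HW α).Hnew (fun _ => hs)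
    ≤ ∑ i, ‖ν i - hs + s • (Dd i - Ds i)‖ ^ 2
      + (1 - γ / 2 * l2) * (2 * s ^ 2 / γ * pinvNormSq (1 - W) (fun i => Dd i - Ds i))
      + r * (1 - α) * sqDist H (fun _ => hs) - r * α * (1 - α) * ∑ i, ‖ν i - H i‖ ^ 2
      + ∑ i, inner ℝ (q i (ν i - H i) - (ν i - H i))
          (crossTerm s γ r α M a φ (fun i => ν i - hs) (fun i => Dd i - Ds i)
            (fun i => H i - hs) i)
      + (α ^ 2 * r + γ * lmax / 2 + γ ^ 2 * lmax ^ 2 / 4)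
          * ∑ i, ‖q i (ν i - H i) - (ν i - H i)‖ ^ 2 := by
  have hdiff : ∀ i, (comm W q ν H HW α).nuHat i - (comm W q ν H HW α).nuHatW i
      = ∑ j, (1 - W) i j • ((ν j - hs) + (q j (ν j - H j) - (ν j - H j))) := by
    intro i
    rw [comm_sub hHW, ← sub_zero (∑ j, (1 - W) i j • (H j + q j (ν j - H j))),
      ← sum_one_sub_smul hr hs i, ← Finset.sum_sub_distrib]
    refine Finset.sum_congr rfl fun j _ => ?_
    rw [← smul_sub]; congr 1; abel
  simp only [hdiff]
  have hDsum : ∑ i, (Dd i - Ds i) = 0 := by rw [Finset.sum_sub_distrib, hDd, hDs, sub_zero]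
  have h := stacked_step hp hA (fun i => ν i - hs) (fun i => q i (ν i - H i) - (ν i - H i))
    (fun i => Dd i - Ds i) (fun i => H i - hs) hDsum
    (fun i => prox K g s (ν i - (γ / 2) •
      ∑ j, (1 - W) i j • ((ν j - hs) + (q j (ν j - H j) - (ν j - H j)))) - xs) ?_
  · have e1 : ∀ i, (1 - α) • (H i - hs) + α • (ν i - hs + (q i (ν i - H i) - (ν i - H i)))
        = (comm W q ν H HW α).Hnew i - hs := by
      intro i; simp only [comm]; module
    have e2 : ∀ i, ν i - hs - (H i - hs) = ν i - H i := fun i => by abel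
    have e3 : ∀ i, Dd i + (γ / (2 * s)) •
        (∑ j, (1 - W) i j • ((ν j - hs) + (q j (ν j - H j) - (ν j - H j)))) - Ds i
        = Dd i - Ds i + (γ / (2 * s)) •
        (∑ j, (1 - W) i j • ((ν j - hs) + (q j (ν j - H j) - (ν j - H j)))) := fun i => by abel
    simp only [e1, e2] at h
    simp only [e3, sqDist]
    exact h
  · intro i
    refine (norm_sub_prox_le hK hne hg hc hp.s_pos hxs hvar _).trans (le_of_eq ?_)
    congr 1
    abel

end Block

/-! ### The communication block in expectation -/

section BlockProbability

variable {m d : ℕ} {W : Matrix (Fin m) (Fin m) ℝ} {Ω Θ : Type*} [MeasurableSpace Θ]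

theorem measurable_crossTerm [MeasurableSpace Ω] (s γ r α M : ℝ) (a : Fin m → ℝ)
    (φ : Fin m → Fin m → ℝ) {v dd h : Ω → Fin m → E d} (hv : ∀ i, Measurable fun ω => v ω i)
    (hd : ∀ i, Measurable fun ω => dd ω i) (hh : ∀ i, Measurable fun ω => h ω i) (i : Fin m) :
    Measurable fun ω => crossTerm s γ r α M a φ (v ω) (dd ω) (h ω) i := by
  unfold crossTerm modeCoeff
  fun_prop

theorem memLp_fun_smul {mΩ : MeasurableSpace Ω} {P : Measure Ω} (c : ℝ) {u : Ω → E d}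
    (hu : MemLp u 2 P) : MemLp (fun ω => c • u ω) 2 P := hu.const_smul c

theorem memLp_fun_add {mΩ : MeasurableSpace Ω} {P : Measure Ω} {u v : Ω → E d}
    (hu : MemLp u 2 P) (hv : MemLp v 2 P) : MemLp (fun ω => u ω + v ω) 2 P := hu.add hv

theorem memLp_fun_sub {mΩ : MeasurableSpace Ω} {P : Measure Ω} {u v : Ω → E d}
    (hu : MemLp u 2 P) (hv : MemLp v 2 P) : MemLp (fun ω => u ω - v ω) 2 P := hu.sub hv

theorem memLp_crossTerm {mΩ : MeasurableSpace Ω} {P : Measure Ω} (s γ r α M : ℝ) (a : Fin m → ℝ)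
    (φ : Fin m → Fin m → ℝ) {v dd h : Ω → Fin m → E d} (hv : ∀ i, MemLp (fun ω => v ω i) 2 P)
    (hd : ∀ i, MemLp (fun ω => dd ω i) 2 P) (hh : ∀ i, MemLp (fun ω => h ω i) 2 P) (i : Fin m) :
    MemLp (fun ω => crossTerm s γ r α M a φ (v ω) (dd ω) (h ω) i) 2 P := by
  have hm : ∀ {u : Ω → Fin m → E d}, (∀ i, MemLp (fun ω => u ω i) 2 P) → ∀ k,
      MemLp (fun ω => modeCoeff φ (u ω) k) 2 P := fun hu k =>
    memLp_finsetSum _ fun i _ => memLp_fun_smul (φ k i) (hu i)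
  exact memLp_finsetSum _ fun k _ => memLp_fun_smul _ (memLp_fun_add (memLp_fun_add
    (memLp_fun_smul _ (hm hv k)) (memLp_fun_smul _ (hm hd k))) (memLp_fun_smul _ (hm hh k)))

/-- Measurability of the outputs of the communication block. -/
theorem measurable_block [MeasurableSpace Ω] {K : Set (E d)} {g : E d → ℝ} {s γ α : ℝ}
    (hprox : Continuous (prox K g s)) {Q : Θ → E d → E d}
    (hQ : Measurable fun z : Θ × E d => Q z.1 z.2) {ζ : Ω → Fin m → Θ} (hζ : Measurable ζ)
    {ν H HW Dd : Ω → Fin m → E d} (hν : ∀ i, Measurable fun ω => ν ω i)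
    (hH : ∀ i, Measurable fun ω => H ω i) (hD : ∀ i, Measurable fun ω => Dd ω i)
    (hHW : ∀ ω i, HW ω i = ∑ j, W i j • H ω j) (i : Fin m) :
    (Measurable fun ω => prox K g s (ν ω i - (γ / 2) •
        ((comm W (fun i => Q (ζ ω i)) (ν ω) (H ω) (HW ω) α).nuHat i
        - (comm W (fun i => Q (ζ ω i)) (ν ω) (H ω) (HW ω) α).nuHatW i))) ∧
    (Measurable fun ω => Dd ω i + (γ / (2 * s)) •
        ((comm W (fun i => Q (ζ ω i)) (ν ω) (H ω) (HW ω) α).nuHat i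
        - (comm W (fun i => Q (ζ ω i)) (ν ω) (H ω) (HW ω) α).nuHatW i)) ∧
    Measurable fun ω => (comm W (fun i => Q (ζ ω i)) (ν ω) (H ω) (HW ω) α).Hnew i := by
  have hq : ∀ j, Measurable fun ω => Q (ζ ω j) (ν ω j - H ω j) := fun j =>
    hQ.comp (((measurable_pi_apply j).comp hζ).prodMk ((hν j).sub (hH j)))
  have hdiff : Measurable fun ω => (comm W (fun i => Q (ζ ω i)) (ν ω) (H ω) (HW ω) α).nuHat i
      - (comm W (fun i => Q (ζ ω i)) (ν ω) (H ω) (HW ω) α).nuHatW i := by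
    simp only [fun ω => comm_sub (q := fun i => Q (ζ ω i)) (ν := ν ω) (α := α) (hHW ω) i]
    fun_prop
  refine ⟨?_, (hD i).add (hdiff.fun_const_smul _), ?_⟩
  · exact hprox.measurable.comp ((hν i).sub (hdiff.fun_const_smul _))
  · have h1 := hH i
    have h2 := hq i
    simp only [comm]
    fun_prop

/-- One communication block with fresh seeds: square integrability is preserved, and the
weighted sum of squared errors contracts in expectation, up to the primal error before the
proximal step. -/
theorem block_expectation {m₁ mΩ : MeasurableSpace Ω} {P : Measure Ω} [IsProbabilityMeasure P]
    (hm : m₁ ≤ mΩ) {δ s γ r α M lmax l2 : ℝ} (hp : StepParams s γ r α M lmax l2)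
    (hnoise : δ * (α ^ 2 * r + γ * lmax / 2 + γ ^ 2 * lmax ^ 2 / 4) ≤ r * α * (1 - α))
    {a : Fin m → ℝ} {φ : Fin m → Fin m → ℝ} (hA : SpectralData (1 - W) lmax l2 a φ)
    (hr : ∀ i, ∑ j, W i j = 1) {K : Set (E d)} {g : E d → ℝ}
    (hK : IsCompact K) (hne : K.Nonempty) (hg : ConvexOn ℝ K g) (hc : ContinuousOn g K)
    {τ : Measure Θ} {Q : Θ → E d → E d} (hQ : IsCompressor τ Q δ) {ζ : Ω → Fin m → Θ}
    (hζ : Measurable ζ) (hτ : ∀ i, P.map (fun ω => ζ ω i) = τ)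
    (hind : Indep m₁ (MeasurableSpace.comap ζ inferInstance) P)
    {x' ν H HW Dd D' H' : Ω → Fin m → E d} (hν : ∀ i, Measurable[m₁] fun ω => ν ω i)
    (hH : ∀ i, Measurable[m₁] fun ω => H ω i) (hD : ∀ i, Measurable[m₁] fun ω => Dd ω i)
    (hν2 : ∀ i, MemLp (fun ω => ν ω i) 2 P) (hH2 : ∀ i, MemLp (fun ω => H ω i) 2 P)
    (hD2 : ∀ i, MemLp (fun ω => Dd ω i) 2 P)
    (hHW : ∀ ω i, HW ω i = ∑ j, W i j • H ω j) (hDd : ∀ ω, ∑ i, Dd ω i = 0)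
    (hx' : ∀ ω i, x' ω i = prox K g s (ν ω i - (γ / 2) •
        ((comm W (fun i => Q (ζ ω i)) (ν ω) (H ω) (HW ω) α).nuHat i
        - (comm W (fun i => Q (ζ ω i)) (ν ω) (H ω) (HW ω) α).nuHatW i)))
    (hD' : ∀ ω i, D' ω i = Dd ω i + (γ / (2 * s)) •
        ((comm W (fun i => Q (ζ ω i)) (ν ω) (H ω) (HW ω) α).nuHat i
        - (comm W (fun i => Q (ζ ω i)) (ν ω) (H ω) (HW ω) α).nuHatW i))
    (hH' : ∀ ω i, H' ω i = (comm W (fun i => Q (ζ ω i)) (ν ω) (H ω) (HW ω) α).Hnew i)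
    {Ds : Fin m → E d} (hDs : ∑ i, Ds i = 0) {xs hs : E d} (hxs : xs ∈ K)
    (hvar : ∀ u ∈ K, 0 ≤ inner ℝ (xs - hs) (u - xs) + s * (g u - g xs)) :
    (∀ i, MemLp (fun ω => x' ω i) 2 P) ∧ (∀ i, MemLp (fun ω => D' ω i) 2 P) ∧
    (∀ i, MemLp (fun ω => H' ω i) 2 P) ∧
    ∫ ω, (M * sqDist (x' ω) (fun _ => xs)
        + 2 * s ^ 2 / γ * pinvNormSq (1 - W) (fun i => D' ω i - Ds i)
        + r * sqDist (H' ω) (fun _ => hs)) ∂P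
      ≤ ∫ ω, ∑ i, ‖ν ω i - hs + s • (Dd ω i - Ds i)‖ ^ 2 ∂P
        + (1 - γ / 2 * l2) * (2 * s ^ 2 / γ *
            ∫ ω, pinvNormSq (1 - W) (fun i => Dd ω i - Ds i) ∂P)
        + r * (1 - α) * ∫ ω, sqDist (H ω) (fun _ => hs) ∂P := by
  have hprox := continuous_prox hK hne hg hc hp.s_pos
  have hν' := fun i => (hν i).mono hm le_rfl
  have hH0 := fun i => (hH i).mono hm le_rfl
  have hD0 := fun i => (hD i).mono hm le_rfl
  have hmeas := measurable_block (γ := γ) (α := α) hprox hQ.meas hζ hν' hH0 hD0 hHW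
  have hcomp : ∀ i, _ := fun i => compressor_error (P := P) hQ hm
    ((measurable_pi_apply i).comp hζ) (hτ i)
    (indep_of_indep_of_le_right hind (by
      rw [← MeasurableSpace.comap_comp]
      exact MeasurableSpace.comap_mono (measurable_pi_apply i).comap_le))
    ((hν i).sub (hH i)) ((hν2 i).sub (hH2 i))
  simp only [Function.comp_apply, Pi.sub_apply] at hcomp
  set e : Ω → Fin m → E d := fun ω i => Q (ζ ω i) (ν ω i - H ω i) - (ν ω i - H ω i) with he
  have he2 : ∀ i, MemLp (fun ω => e ω i) 2 P := fun i => (hcomp i).1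
  have hνH2 : ∀ i, MemLp (fun ω => ν ω i - H ω i) 2 P := fun i => (hν2 i).sub (hH2 i)
  have hq2 : ∀ i, MemLp (fun ω => Q (ζ ω i) (ν ω i - H ω i)) 2 P := fun i => by
    have h := (he2 i).add (hνH2 i)
    refine h.ae_eq (Filter.Eventually.of_forall fun ω => ?_)
    simp [he]
  -- the proximal points lie in the compact set `K`
  have hx2 : ∀ i, MemLp (fun ω => x' ω i) 2 P := by
    intro i
    obtain ⟨C, hC⟩ := hK.isBounded.exists_norm_le
    have hmx := (hmeas i).1
    simp only [← hx'] at hmx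
    refine MemLp.of_bound hmx.aestronglyMeasurable C (Filter.Eventually.of_forall fun ω => ?_)
    rw [hx']
    exact hC _ (prox_spec hK hne hc s _).1
  have hD2' : ∀ i, MemLp (fun ω => D' ω i) 2 P := by
    intro i
    simp only [hD', fun ω => comm_sub (q := fun i => Q (ζ ω i)) (ν := ν ω) (α := α) (hHW ω) i]
    exact memLp_fun_add (hD2 i) (memLp_fun_smul _
      (memLp_finsetSum _ fun j _ => memLp_fun_smul _ (memLp_fun_add (hH2 j) (hq2 j))))
  have hH2' : ∀ i, MemLp (fun ω => H' ω i) 2 P := by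
    intro i
    simp only [hH', comm]
    exact memLp_fun_add (memLp_fun_smul _ (hH2 i))
      (memLp_fun_smul _ (memLp_fun_add (hH2 i) (hq2 i)))
  refine ⟨hx2, hD2', hH2', ?_⟩
  set ψ : Ω → Fin m → E d := fun ω => crossTerm s γ r α M a φ (fun i => ν ω i - hs)
    (fun i => Dd ω i - Ds i) (fun i => H ω i - hs) with hψ
  have hvs : ∀ i, MemLp (fun ω => ν ω i - hs) 2 P := fun i => (hν2 i).sub (memLp_const _)
  have hds : ∀ i, MemLp (fun ω => Dd ω i - Ds i) 2 P := fun i => (hD2 i).sub (memLp_const _)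
  have hhs : ∀ i, MemLp (fun ω => H ω i - hs) 2 P := fun i => (hH2 i).sub (memLp_const _)
  have hψ2 : ∀ i, MemLp (fun ω => ψ ω i) 2 P := memLp_crossTerm s γ r α M a φ hvs hds hhs
  have hψm : ∀ i, Measurable[m₁] fun ω => ψ ω i :=
    @measurable_crossTerm m d Ω m₁ s γ r α M a φ _ _ _ (fun i => (hν i).sub measurable_const)
      (fun i => (hD i).sub measurable_const) (fun i => (hH i).sub measurable_const)
  -- `ψ` is known before the compression, so the unbiased error does not correlate with it
  have hcross : ∫ ω, ∑ i, inner ℝ (e ω i) (ψ ω i) ∂P = 0 := by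
    rw [integral_finsetSum _ fun i _ => integrable_inner_of_memLp (he2 i) (hψ2 i)]
    exact Finset.sum_eq_zero fun i _ => (hcomp i).2.2 _ (hψm i) (hψ2 i)
  have hvarE : ∫ ω, ∑ i, ‖e ω i‖ ^ 2 ∂P ≤ δ * ∫ ω, ∑ i, ‖ν ω i - H ω i‖ ^ 2 ∂P := by
    rw [integral_finsetSum _ fun i _ => integrable_norm_sq (he2 i),
      integral_finsetSum _ fun i _ => integrable_norm_sq (hνH2 i), Finset.mul_sum]
    exact Finset.sum_le_sum fun i _ => (hcomp i).2.1
  have i0 : Integrable (fun ω => ∑ i, ‖ν ω i - hs + s • (Dd ω i - Ds i)‖ ^ 2) P :=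
    integrable_sum_norm_sq (u := fun ω i => ν ω i - hs + s • (Dd ω i - Ds i))
      fun i => (hvs i).add ((hds i).const_smul s)
  have i1 : Integrable (fun ω => pinvNormSq (1 - W) (fun i => Dd ω i - Ds i)) P :=
    integrable_pinvNormSq _ (u := fun ω i => Dd ω i - Ds i) hds
  have i2 : Integrable (fun ω => sqDist (H ω) (fun _ => hs)) P :=
    integrable_sum_norm_sq (u := fun ω i => H ω i - hs) hhs
  have i3 : Integrable (fun ω => ∑ i, ‖ν ω i - H ω i‖ ^ 2) P :=
    integrable_sum_norm_sq (u := fun ω i => ν ω i - H ω i) hνH2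
  have i4 : Integrable (fun ω => ∑ i, inner ℝ (e ω i) (ψ ω i)) P := integrable_sum_inner he2 hψ2
  have i5 : Integrable (fun ω => ∑ i, ‖e ω i‖ ^ 2) P := integrable_sum_norm_sq he2
  have j1 : Integrable (fun ω => sqDist (x' ω) (fun _ => xs)) P :=
    integrable_sum_norm_sq (u := fun ω i => x' ω i - xs) fun i => (hx2 i).sub (memLp_const _)
  have j2 : Integrable (fun ω => pinvNormSq (1 - W) (fun i => D' ω i - Ds i)) P :=
    integrable_pinvNormSq _ (u := fun ω i => D' ω i - Ds i) fun i => (hD2' i).sub (memLp_const _)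
  have j3 : Integrable (fun ω => sqDist (H' ω) (fun _ => hs)) P :=
    integrable_sum_norm_sq (u := fun ω i => H' ω i - hs) fun i => (hH2' i).sub (memLp_const _)
  have hpt : ∀ ω, M * sqDist (x' ω) (fun _ => xs)
        + 2 * s ^ 2 / γ * pinvNormSq (1 - W) (fun i => D' ω i - Ds i)
        + r * sqDist (H' ω) (fun _ => hs)
      ≤ ∑ i, ‖ν ω i - hs + s • (Dd ω i - Ds i)‖ ^ 2
        + (1 - γ / 2 * l2) * (2 * s ^ 2 / γ * pinvNormSq (1 - W) (fun i => Dd ω i - Ds i))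
        + r * (1 - α) * sqDist (H ω) (fun _ => hs)
        - r * α * (1 - α) * ∑ i, ‖ν ω i - H ω i‖ ^ 2
        + ∑ i, inner ℝ (e ω i) (ψ ω i)
        + (α ^ 2 * r + γ * lmax / 2 + γ ^ 2 * lmax ^ 2 / 4) * ∑ i, ‖e ω i‖ ^ 2 := by
    intro ω
    have h := block_step (q := fun i => Q (ζ ω i)) (ν := ν ω) hp hA hr hK hne hg hc (hHW ω)
      (hDd ω) hDs hxs hvar
    have hx'' : x' ω = fun i => prox K g s (ν ω i - (γ / 2) •
        ((comm W (fun i => Q (ζ ω i)) (ν ω) (H ω) (HW ω) α).nuHat i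
        - (comm W (fun i => Q (ζ ω i)) (ν ω) (H ω) (HW ω) α).nuHatW i)) := funext (hx' ω)
    have hH'' : H' ω = (comm W (fun i => Q (ζ ω i)) (ν ω) (H ω) (HW ω) α).Hnew := funext (hH' ω)
    rw [hx'', hH'']
    simp only [hD']
    exact h
  have hlhs := ((j1.const_mul M).add (j2.const_mul (2 * s ^ 2 / γ))).add (j3.const_mul r)
  have k1 := (i1.const_mul (2 * s ^ 2 / γ)).const_mul (1 - γ / 2 * l2)
  have k2 := i2.const_mul (r * (1 - α))
  have k3 := i3.const_mul (r * α * (1 - α))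
  have k5 := i5.const_mul (α ^ 2 * r + γ * lmax / 2 + γ ^ 2 * lmax ^ 2 / 4)
  have hmono := integral_mono hlhs (((((i0.add k1).add k2).sub k3).add i4).add k5) hpt
  refine hmono.trans ?_
  rw [integral_add' ((((i0.add k1).add k2).sub k3).add i4) k5,
    integral_add' (((i0.add k1).add k2).sub k3) i4, integral_sub' ((i0.add k1).add k2) k3,
    integral_add' (i0.add k1) k2, integral_add' i0 k1, hcross, integral_const_mul,
    integral_const_mul, integral_const_mul, integral_const_mul, integral_const_mul]
  have hcoef : 0 ≤ α ^ 2 * r + γ * lmax / 2 + γ ^ 2 * lmax ^ 2 / 4 := by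
    have := hp.r_nonneg
    have := hp.γ_pos
    have := hp.lmax_nonneg
    positivity
  have h1 := mul_le_mul_of_nonneg_left hvarE hcoef
  have h2 : 0 ≤ ∫ ω, ∑ i, ‖ν ω i - H ω i‖ ^ 2 ∂P :=
    integral_nonneg fun ω => Finset.sum_nonneg fun i _ => sq_nonneg _
  have h3 := mul_le_mul_of_nonneg_right hnoise h2
  linarith

end BlockProbability

namespace Data

variable {m n dx dy : ℕ} {D : Data m n dx dy} {G : SimpleGraph (Fin m)}

/-! ### Measurability and boundedness of the oracle -/

theorem _root_.CDPSVRG.measurable_comp_of_continuousOn {Ω β γ : Type*} [MeasurableSpace Ω]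
    [TopologicalSpace β] [MeasurableSpace β] [BorelSpace β] [TopologicalSpace γ]
    [MeasurableSpace γ] [BorelSpace γ] {f : β → γ} {K : Set β} (hf : ContinuousOn f K)
    {u : Ω → β} (hu : Measurable u) (hK : ∀ ω, u ω ∈ K) : Measurable fun ω => f (u ω) := by
  have h1 : Continuous (fun z : K => f z) := continuousOn_iff_continuous_domRestrict.1 hf
  exact h1.measurable.comp (hu.subtype_mk (h := hK))

theorem Assumptions.continuousOn_gradXij (hD : D.Assumptions G) (i : Fin m) (j : Fin n) :
    ContinuousOn (fun z : E dx × E dy => D.gradXij i j z.1 z.2) (D.X ×ˢ D.Y) := by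
  refine (LipschitzOnWith.of_dist_le_mul (K := (D.Lxx + D.Lxy).toNNReal)
    fun z hz z' hz' => ?_).continuousOn
  rw [Real.coe_toNNReal _ (add_nonneg hD.Lxx_bounds.1 hD.Lxy_nonneg), dist_eq_norm, add_mul]
  refine (hD.gradXij_lip i j hz.1 hz.2 hz'.1 hz'.2).trans (add_le_add ?_ ?_)
  · rw [← dist_eq_norm]
    exact mul_le_mul_of_nonneg_left (le_max_left _ _) hD.Lxx_bounds.1
  · rw [← dist_eq_norm]
    exact mul_le_mul_of_nonneg_left (le_max_right _ _) hD.Lxy_nonneg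

theorem Assumptions.continuousOn_gradYij (hD : D.Assumptions G) (i : Fin m) (j : Fin n) :
    ContinuousOn (fun z : E dx × E dy => D.gradYij i j z.1 z.2) (D.X ×ˢ D.Y) := by
  refine (LipschitzOnWith.of_dist_le_mul (K := (D.Lyy + D.Lyx).toNNReal)
    fun z hz z' hz' => ?_).continuousOn
  rw [Real.coe_toNNReal _ (add_nonneg hD.Lyy_bounds.1 hD.Lyx_nonneg), dist_eq_norm, add_mul]
  refine (hD.gradYij_lip i j hz.1 hz.2 hz'.1 hz'.2).trans (add_le_add ?_ ?_)
  · rw [← dist_eq_norm]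
    exact mul_le_mul_of_nonneg_left (le_max_right _ _) hD.Lyy_bounds.1
  · rw [← dist_eq_norm]
    exact mul_le_mul_of_nonneg_left (le_max_left _ _) hD.Lyx_nonneg

theorem Assumptions.continuousOn_svrgX (hD : D.Assumptions G) (i : Fin m) (l : Fin n) :
    ContinuousOn (fun w : (E dx × E dy) × (E dx × E dy) =>
      D.svrgX i l w.1.1 w.1.2 w.2.1 w.2.2) ((D.X ×ˢ D.Y) ×ˢ (D.X ×ˢ D.Y)) := by
  have h1 : ∀ j, ContinuousOn (fun w : (E dx × E dy) × (E dx × E dy) => D.gradXij i j w.1.1 w.1.2)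
      ((D.X ×ˢ D.Y) ×ˢ (D.X ×ˢ D.Y)) := fun j =>
    (hD.continuousOn_gradXij i j).comp continuousOn_fst fun w hw => hw.1
  have h2 : ∀ j, ContinuousOn (fun w : (E dx × E dy) × (E dx × E dy) => D.gradXij i j w.2.1 w.2.2)
      ((D.X ×ˢ D.Y) ×ˢ (D.X ×ˢ D.Y)) := fun j =>
    (hD.continuousOn_gradXij i j).comp continuousOn_snd fun w hw => hw.2
  have h3 : ContinuousOn (fun w : (E dx × E dy) × (E dx × E dy) => D.gradX i w.2.1 w.2.2)
      ((D.X ×ˢ D.Y) ×ˢ (D.X ×ˢ D.Y)) :=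
    ((continuousOn_finsetSum _ fun j _ => h2 j).const_smul (1 / (n : ℝ))).congr fun w hw =>
      hD.gradX_eq i hw.2.1 hw.2.2
  have h4 := h1 l
  have h5 := h2 l
  unfold svrgX
  fun_prop

theorem Assumptions.continuousOn_svrgY (hD : D.Assumptions G) (i : Fin m) (l : Fin n) :
    ContinuousOn (fun w : (E dx × E dy) × (E dx × E dy) =>
      D.svrgY i l w.1.1 w.1.2 w.2.1 w.2.2) ((D.X ×ˢ D.Y) ×ˢ (D.X ×ˢ D.Y)) := by
  have h1 : ∀ j, ContinuousOn (fun w : (E dx × E dy) × (E dx × E dy) => D.gradYij i j w.1.1 w.1.2)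
      ((D.X ×ˢ D.Y) ×ˢ (D.X ×ˢ D.Y)) := fun j =>
    (hD.continuousOn_gradYij i j).comp continuousOn_fst fun w hw => hw.1
  have h2 : ∀ j, ContinuousOn (fun w : (E dx × E dy) × (E dx × E dy) => D.gradYij i j w.2.1 w.2.2)
      ((D.X ×ˢ D.Y) ×ˢ (D.X ×ˢ D.Y)) := fun j =>
    (hD.continuousOn_gradYij i j).comp continuousOn_snd fun w hw => hw.2
  have h3 : ContinuousOn (fun w : (E dx × E dy) × (E dx × E dy) => D.gradY i w.2.1 w.2.2)
      ((D.X ×ˢ D.Y) ×ˢ (D.X ×ˢ D.Y)) :=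
    ((continuousOn_finsetSum _ fun j _ => h2 j).const_smul (1 / (n : ℝ))).congr fun w hw =>
      hD.gradY_eq i hw.2.1 hw.2.2
  have h4 := h1 l
  have h5 := h2 l
  unfold svrgY
  fun_prop

theorem _root_.CDPSVRG.memLp_of_continuousOn_compact {Ω β : Type*} {mΩ : MeasurableSpace Ω}
    {P : Measure Ω} [IsFiniteMeasure P] [TopologicalSpace β] [MeasurableSpace β] [BorelSpace β]
    {d : ℕ} {f : β → E d} {K : Set β} (hf : ContinuousOn f K) (hcpt : IsCompact K)
    {u : Ω → β} (hu : Measurable u) (hK : ∀ ω, u ω ∈ K) : MemLp (fun ω => f (u ω)) 2 P := by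
  obtain ⟨C, hC⟩ := (hcpt.image_of_continuousOn hf).isBounded.exists_norm_le
  exact MemLp.of_bound (measurable_comp_of_continuousOn hf hu hK).aestronglyMeasurable C
    (Filter.Eventually.of_forall fun ω => hC _ ⟨_, hK ω, rfl⟩)

/-! ### One iteration -/

section OneStep

variable {Ω Θx Θy : Type*}

/-- A random state of the method all of whose components are known at the `σ`-algebra `m₀`: its
points are feasible, its communication variables satisfy `H^w = W H` and `∑ᵢ Dᵢ = 0`, and all its
components are square integrable. -/
structure Admissible (D : Data m n dx dy) (m₀ : MeasurableSpace Ω) {mΩ : MeasurableSpace Ω}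
    (P : Measure Ω) (S : Ω → State m dx dy) : Prop where
  x_mem : ∀ ω i, (S ω).x i ∈ D.X
  y_mem : ∀ ω i, (S ω).y i ∈ D.Y
  xr_mem : ∀ ω i, (S ω).xr i ∈ D.X
  yr_mem : ∀ ω i, (S ω).yr i ∈ D.Y
  Hwx : ∀ ω i, (S ω).Hwx i = ∑ j, D.W i j • (S ω).Hx j
  Hwy : ∀ ω i, (S ω).Hwy i = ∑ j, D.W i j • (S ω).Hy j
  sum_Dx : ∀ ω, ∑ i, (S ω).Dx i = 0
  sum_Dy : ∀ ω, ∑ i, (S ω).Dy i = 0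
  meas_x : ∀ i, Measurable[m₀] fun ω => (S ω).x i
  meas_y : ∀ i, Measurable[m₀] fun ω => (S ω).y i
  meas_xr : ∀ i, Measurable[m₀] fun ω => (S ω).xr i
  meas_yr : ∀ i, Measurable[m₀] fun ω => (S ω).yr i
  meas_Dx : ∀ i, Measurable[m₀] fun ω => (S ω).Dx i
  meas_Dy : ∀ i, Measurable[m₀] fun ω => (S ω).Dy i
  meas_Hx : ∀ i, Measurable[m₀] fun ω => (S ω).Hx i
  meas_Hy : ∀ i, Measurable[m₀] fun ω => (S ω).Hy i
  memLp_x : ∀ i, MemLp (fun ω => (S ω).x i) 2 P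
  memLp_y : ∀ i, MemLp (fun ω => (S ω).y i) 2 P
  memLp_xr : ∀ i, MemLp (fun ω => (S ω).xr i) 2 P
  memLp_yr : ∀ i, MemLp (fun ω => (S ω).yr i) 2 P
  memLp_Dx : ∀ i, MemLp (fun ω => (S ω).Dx i) 2 P
  memLp_Dy : ∀ i, MemLp (fun ω => (S ω).Dy i) 2 P
  memLp_Hx : ∀ i, MemLp (fun ω => (S ω).Hx i) 2 P
  memLp_Hy : ∀ i, MemLp (fun ω => (S ω).Hy i) 2 P

/-- The draws of one iteration: `m₀` is the history before the iteration, `m₁` adds the sampled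
indices, `m₂` adds all draws of the iteration. -/
structure FreshDraws [MeasurableSpace Θx] [MeasurableSpace Θy] (D : Data m n dx dy)
    (m₀ m₁ m₂ : MeasurableSpace Ω) {mΩ : MeasurableSpace Ω} (P : Measure Ω) (τx : Measure Θx)
    (τy : Measure Θy) (idx : Ω → Fin m → Fin n) (coin : Ω → Fin m → Bool) (ξ : Ω → Fin m → Θx)
    (η : Ω → Fin m → Θy) : Prop where
  le₀₁ : m₀ ≤ m₁
  le₁₂ : m₁ ≤ m₂
  le₂ : m₂ ≤ mΩ
  meas_idx : Measurable[m₁] idx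
  meas_coin : Measurable[m₂] coin
  meas_ξ : Measurable[m₂] ξ
  meas_η : Measurable[m₂] η
  idx_law : ∀ i j, P.real {ω | idx ω i = j} = D.prob i j
  coin_law : ∀ i, P.real {ω | coin ω i = true} = D.p
  ξ_law : ∀ i, P.map (fun ω => ξ ω i) = τx
  η_law : ∀ i, P.map (fun ω => η ω i) = τy
  indep_idx : Indep m₀ (MeasurableSpace.comap idx inferInstance) P
  indep_coin : Indep m₀ (MeasurableSpace.comap coin inferInstance) P
  indep_ξ : Indep m₁ (MeasurableSpace.comap ξ inferInstance) P
  indep_η : Indep m₁ (MeasurableSpace.comap η inferInstance) P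

/-- The points of the method entering the oracle of node `i`. -/
def oraclePoint (S : State m dx dy) (i : Fin m) : (E dx × E dy) × (E dx × E dy) :=
  ((S.x i, S.y i), (S.xr i, S.yr i))

namespace Admissible

variable {m₀ mΩ : MeasurableSpace Ω} {P : Measure Ω} {S : Ω → State m dx dy}

theorem oraclePoint_mem (h : D.Admissible m₀ P S) (i : Fin m) (ω : Ω) :
    oraclePoint (S ω) i ∈ (D.X ×ˢ D.Y) ×ˢ (D.X ×ˢ D.Y) :=
  ⟨⟨h.x_mem ω i, h.y_mem ω i⟩, ⟨h.xr_mem ω i, h.yr_mem ω i⟩⟩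

theorem measurable_oraclePoint (h : D.Admissible m₀ P S) (i : Fin m) :
    Measurable[m₀] fun ω => oraclePoint (S ω) i :=
  ((h.meas_x i).prodMk (h.meas_y i)).prodMk ((h.meas_xr i).prodMk (h.meas_yr i))

end Admissible

theorem _root_.CDPSVRG.measurable_at_draw {ι β : Type*} [MeasurableSpace Ω] [MeasurableSpace β]
    [MeasurableSpace ι] [Countable ι] [MeasurableSingletonClass ι] {F : ι → Ω → β}
    (hF : ∀ l, Measurable (F l)) {c : Ω → ι} (hc : Measurable c) :
    Measurable fun ω => F (c ω) ω := by
  have h : Measurable fun z : Ω × ι => F z.2 z.1 := measurable_from_prod_countable_left hF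
  exact h.comp (measurable_id.prodMk hc)

theorem _root_.CDPSVRG.memLp_at_draw {ι : Type*} {mΩ : MeasurableSpace Ω} {P : Measure Ω}
    [MeasurableSpace ι] [Fintype ι] [MeasurableSingletonClass ι] {d : ℕ} {F : ι → Ω → E d}
    (hF : ∀ l, Measurable (F l)) (hF2 : ∀ l, MemLp (F l) 2 P) {c : Ω → ι} (hc : Measurable c) :
    MemLp (fun ω => F (c ω) ω) 2 P := by
  have hm := measurable_at_draw hF hc
  rw [memLp_two_iff_integrable_sq_norm hm.aestronglyMeasurable]
  have h1 : Integrable (fun ω => ∑ l, ‖F l ω‖ ^ 2) P :=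
    integrable_finsetSum _ fun l _ => integrable_norm_sq (hF2 l)
  refine h1.mono' (hm.norm.pow_const 2).aestronglyMeasurable
    (Filter.Eventually.of_forall fun ω => ?_)
  rw [Real.norm_eq_abs, abs_of_nonneg (sq_nonneg _)]
  exact Finset.single_le_sum (f := fun l => ‖F l ω‖ ^ 2) (fun l _ => sq_nonneg _)
    (Finset.mem_univ (c ω))

theorem sum_DxStar (hD : D.Assumptions G) (xs : E dx) (ys : E dy) :
    ∑ i, D.DxStar xs ys i = 0 := by
  have hm : (m : ℝ) ≠ 0 := by have := hD.m_pos; positivity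
  simp only [DxStar, Finset.sum_neg_distrib, Finset.sum_sub_distrib, Finset.sum_const,
    Finset.card_univ, Fintype.card_fin, ← Nat.cast_smul_eq_nsmul ℝ, smul_smul]
  rw [mul_one_div_cancel hm, one_smul, sub_self, neg_zero]

theorem sum_DyStar (hD : D.Assumptions G) (xs : E dx) (ys : E dy) :
    ∑ i, D.DyStar xs ys i = 0 := by
  have hm : (m : ℝ) ≠ 0 := by have := hD.m_pos; positivity
  simp only [DyStar, Finset.sum_sub_distrib, Finset.sum_const,
    Finset.card_univ, Fintype.card_fin, ← Nat.cast_smul_eq_nsmul ℝ, smul_smul]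
  rw [mul_one_div_cancel hm, one_smul, sub_self]

/-- The primal part of the state before its communication block. -/
noncomputable def nuX (D : Data m n dx dy) (l : Fin m → Fin n) (S : State m dx dy) (i : Fin m) :
    E dx := S.x i - D.s • D.svrgX i (l i) (S.x i) (S.y i) (S.xr i) (S.yr i) - D.s • S.Dx i

/-- The dual part of the state before its communication block. -/
noncomputable def nuY (D : Data m n dx dy) (l : Fin m → Fin n) (S : State m dx dy) (i : Fin m) :
    E dy := S.y i + D.s • D.svrgY i (l i) (S.x i) (S.y i) (S.xr i) (S.yr i) - D.s • S.Dy i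

/-- The errors of `ν` and `D` combine into the error after a stochastic gradient step: the mean
gradient in `H⋆` and the one in `D⋆` cancel. The index `i'` is arbitrary since `H⋆` is constant. -/
theorem nuX_error (D : Data m n dx dy) (l : Fin m → Fin n) (S : State m dx dy) (i i' : Fin m)
    (xs : E dx) (ys : E dy) :
    D.nuX l S i - D.HxStar xs ys i' + D.s • (S.Dx i - D.DxStar xs ys i)
      = S.x i - xs - D.s • (D.svrgX i (l i) (S.x i) (S.y i) (S.xr i) (S.yr i)
          - D.gradX i xs ys) := by
  have h : (D.s / (m : ℝ)) • ∑ k, D.gradX k xs ys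
      = D.s • ((1 / (m : ℝ)) • ∑ k, D.gradX k xs ys) := by
    rw [smul_smul]; congr 1; ring
  rw [nuX, HxStar, DxStar, h]
  module

theorem nuY_error (D : Data m n dx dy) (l : Fin m → Fin n) (S : State m dx dy) (i i' : Fin m)
    (xs : E dx) (ys : E dy) :
    D.nuY l S i - D.HyStar xs ys i' + D.s • (S.Dy i - D.DyStar xs ys i)
      = S.y i - ys + D.s • (D.svrgY i (l i) (S.x i) (S.y i) (S.xr i) (S.yr i)
          - D.gradY i xs ys) := by
  have h : (D.s / (m : ℝ)) • ∑ k, D.gradY k xs ys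
      = D.s • ((1 / (m : ℝ)) • ∑ k, D.gradY k xs ys) := by
    rw [smul_smul]; congr 1; ring
  rw [nuY, HyStar, DyStar, h]
  module

variable [MeasurableSpace Θx] [MeasurableSpace Θy]
  {m₀ m₁ m₂ mΩ : MeasurableSpace Ω} {P : Measure Ω} [IsProbabilityMeasure P]
  {τx : Measure Θx} {τy : Measure Θy} {Qx : Θx → E dx → E dx} {Qy : Θy → E dy → E dy}
  {idx : Ω → Fin m → Fin n} {coin : Ω → Fin m → Bool} {ξ : Ω → Fin m → Θx} {η : Ω → Fin m → Θy}
  {S S' : Ω → State m dx dy}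

theorem Admissible.measurable_svrg (hD : D.Assumptions G) (hS : D.Admissible m₀ P S)
    (hm : m₀ ≤ mΩ) (i : Fin m) (l : Fin n) :
    (Measurable[m₀] fun ω => D.svrgX i l ((S ω).x i) ((S ω).y i) ((S ω).xr i) ((S ω).yr i)) ∧
    (Measurable[m₀] fun ω => D.svrgY i l ((S ω).x i) ((S ω).y i) ((S ω).xr i) ((S ω).yr i)) ∧
    MemLp (fun ω => D.svrgX i l ((S ω).x i) ((S ω).y i) ((S ω).xr i) ((S ω).yr i)) 2 P ∧
    MemLp (fun ω => D.svrgY i l ((S ω).x i) ((S ω).y i) ((S ω).xr i) ((S ω).yr i)) 2 P := by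
  have hcpt := (hD.X_compact.prod hD.Y_compact).prod (hD.X_compact.prod hD.Y_compact)
  have hp := hS.measurable_oraclePoint i
  have hmem := hS.oraclePoint_mem i
  have cx := hD.continuousOn_svrgX i l
  have cy := hD.continuousOn_svrgY i l
  have h1 := @measurable_comp_of_continuousOn Ω _ _ m₀ _ _ _ _ _ _ _ _ cx _ hp hmem
  have h2 := @measurable_comp_of_continuousOn Ω _ _ m₀ _ _ _ _ _ _ _ _ cy _ hp hmem
  have h3 := memLp_of_continuousOn_compact (P := P) cx hcpt (hp.mono hm le_rfl) hmem
  have h4 := memLp_of_continuousOn_compact (P := P) cy hcpt (hp.mono hm le_rfl) hmem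
  exact ⟨h1, h2, h3, h4⟩

/-- Measurability and square integrability of the variables entering the communication blocks. -/
theorem Admissible.nu_regular (hD : D.Assumptions G) (hS : D.Admissible m₀ P S)
    (hF : D.FreshDraws m₀ m₁ m₂ P τx τy idx coin ξ η) (i : Fin m) :
    (Measurable[m₁] fun ω => D.nuX (idx ω) (S ω) i) ∧
    (Measurable[m₁] fun ω => D.nuY (idx ω) (S ω) i) ∧
    MemLp (fun ω => D.nuX (idx ω) (S ω) i) 2 P ∧ MemLp (fun ω => D.nuY (idx ω) (S ω) i) 2 P := by
  have h12 := hF.le₁₂.trans hF.le₂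
  have h0 := hF.le₀₁.trans h12
  have hidx : Measurable[m₁] fun ω => idx ω i := (measurable_pi_apply i).comp hF.meas_idx
  have hidx' : Measurable fun ω => idx ω i := hidx.mono h12 le_rfl
  have hsv := hS.measurable_svrg hD h0 i
  have hgx : Measurable[m₁] fun ω =>
      D.svrgX i (idx ω i) ((S ω).x i) ((S ω).y i) ((S ω).xr i) ((S ω).yr i) :=
    @measurable_at_draw Ω _ _ m₁ _ _ _ _ _ (fun l => (hsv l).1.mono hF.le₀₁ le_rfl) _ hidx
  have hgy : Measurable[m₁] fun ω =>
      D.svrgY i (idx ω i) ((S ω).x i) ((S ω).y i) ((S ω).xr i) ((S ω).yr i) :=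
    @measurable_at_draw Ω _ _ m₁ _ _ _ _ _ (fun l => (hsv l).2.1.mono hF.le₀₁ le_rfl) _ hidx
  have hgx2 := memLp_at_draw (fun l => (hsv l).1.mono h0 le_rfl) (fun l => (hsv l).2.2.1) hidx'
  have hgy2 := memLp_at_draw (fun l => (hsv l).2.1.mono h0 le_rfl) (fun l => (hsv l).2.2.2) hidx'
  have mx := (hS.meas_x i).mono hF.le₀₁ le_rfl
  have my := (hS.meas_y i).mono hF.le₀₁ le_rfl
  have mdx := (hS.meas_Dx i).mono hF.le₀₁ le_rfl
  have mdy := (hS.meas_Dy i).mono hF.le₀₁ le_rfl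
  exact ⟨(mx.sub (hgx.fun_const_smul D.s)).sub (mdx.fun_const_smul D.s),
    (my.add (hgy.fun_const_smul D.s)).sub (mdy.fun_const_smul D.s),
    memLp_fun_sub (memLp_fun_sub (hS.memLp_x i) (memLp_fun_smul D.s hgx2))
      (memLp_fun_smul D.s (hS.memLp_Dx i)),
    memLp_fun_sub (memLp_fun_add (hS.memLp_y i) (memLp_fun_smul D.s hgy2))
      (memLp_fun_smul D.s (hS.memLp_Dy i))⟩

/-- The mean squared primal and dual errors after the gradient step. -/
theorem Admissible.oracle_expectation (hD : D.Assumptions G) (hS : D.Admissible m₀ P S)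
    (hF : D.FreshDraws m₀ m₁ m₂ P τx τy idx coin ξ η) {xs : E dx} {ys : E dy} (hxs : xs ∈ D.X)
    (hys : ys ∈ D.Y) :
    ∫ ω, ∑ i, ‖(S ω).x i - xs - D.s • (D.svrgX i (idx ω i) ((S ω).x i) ((S ω).y i) ((S ω).xr i)
        ((S ω).yr i) - D.gradX i xs ys)‖ ^ 2 ∂P
      + ∫ ω, ∑ i, ‖(S ω).y i - ys + D.s • (D.svrgY i (idx ω i) ((S ω).x i) ((S ω).y i) ((S ω).xr i)
        ((S ω).yr i) - D.gradY i xs ys)‖ ^ 2 ∂P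
    ≤ (1 - D.bX - D.ctx * D.p) * ∫ ω, sqDist (S ω).x (fun _ => xs) ∂P
      + (1 - D.bY - D.cty * D.p) * ∫ ω, sqDist (S ω).y (fun _ => ys) ∂P
      + D.ctx * D.p / 2 * ∫ ω, sqDist (S ω).xr (fun _ => xs) ∂P
      + D.cty * D.p / 2 * ∫ ω, sqDist (S ω).yr (fun _ => ys) ∂P := by
  have h12 := hF.le₁₂.trans hF.le₂
  have h0 := hF.le₀₁.trans h12
  have hsv := fun i => hS.measurable_svrg hD h0 i
  set Fx : (i : Fin m) → Fin n → Ω → E dx := fun i l ω => (S ω).x i - xs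
    - D.s • (D.svrgX i l ((S ω).x i) ((S ω).y i) ((S ω).xr i) ((S ω).yr i) - D.gradX i xs ys)
    with hFx
  set Fy : (i : Fin m) → Fin n → Ω → E dy := fun i l ω => (S ω).y i - ys
    + D.s • (D.svrgY i l ((S ω).x i) ((S ω).y i) ((S ω).xr i) ((S ω).yr i) - D.gradY i xs ys)
    with hFy
  have mFx : ∀ i l, Measurable[m₀] (Fx i l) := fun i l =>
    ((hS.meas_x i).sub measurable_const).sub
      (((hsv i l).1.sub measurable_const).fun_const_smul D.s)
  have mFy : ∀ i l, Measurable[m₀] (Fy i l) := fun i l =>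
    ((hS.meas_y i).sub measurable_const).add
      (((hsv i l).2.1.sub measurable_const).fun_const_smul D.s)
  have lFx : ∀ i l, MemLp (Fx i l) 2 P := fun i l =>
    memLp_fun_sub (memLp_fun_sub (hS.memLp_x i) (memLp_const _))
      (memLp_fun_smul D.s (memLp_fun_sub (hsv i l).2.2.1 (memLp_const _)))
  have lFy : ∀ i l, MemLp (Fy i l) 2 P := fun i l =>
    memLp_fun_add (memLp_fun_sub (hS.memLp_y i) (memLp_const _))
      (memLp_fun_smul D.s (memLp_fun_sub (hsv i l).2.2.2 (memLp_const _)))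
  have hci : ∀ i, Measurable fun ω => idx ω i := fun i =>
    (measurable_pi_apply i).comp (hF.meas_idx.mono h12 le_rfl)
  have hind : ∀ i, Indep m₀ (MeasurableSpace.comap (fun ω => idx ω i) inferInstance) P := fun i =>
    indep_of_indep_of_le_right hF.indep_idx (by
      change MeasurableSpace.comap ((fun f : Fin m → Fin n => f i) ∘ idx) _ ≤ _
      rw [← MeasurableSpace.comap_comp]
      exact MeasurableSpace.comap_mono (measurable_pi_apply i).comap_le)
  have hnsq : ∀ d, Measurable fun v : E d => ‖v‖ ^ 2 := fun d => by fun_prop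
  have fx := fun i => integral_fresh_draw (P := P) (hci i) (hind i)
    (F := fun l ω => ‖Fx i l ω‖ ^ 2) (fun l => (hnsq _).comp (mFx i l))
    (fun l => integrable_norm_sq (lFx i l))
  have fy := fun i => integral_fresh_draw (P := P) (hci i) (hind i)
    (F := fun l ω => ‖Fy i l ω‖ ^ 2) (fun l => (hnsq _).comp (mFy i l))
    (fun l => integrable_norm_sq (lFy i l))
  have qx : ∀ i, Integrable (fun ω => ‖(S ω).x i - xs‖ ^ 2) P := fun i =>
    integrable_norm_sq (memLp_fun_sub (hS.memLp_x i) (memLp_const _))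
  have qy : ∀ i, Integrable (fun ω => ‖(S ω).y i - ys‖ ^ 2) P := fun i =>
    integrable_norm_sq (memLp_fun_sub (hS.memLp_y i) (memLp_const _))
  have qxr : ∀ i, Integrable (fun ω => ‖(S ω).xr i - xs‖ ^ 2) P := fun i =>
    integrable_norm_sq (memLp_fun_sub (hS.memLp_xr i) (memLp_const _))
  have qyr : ∀ i, Integrable (fun ω => ‖(S ω).yr i - ys‖ ^ 2) P := fun i =>
    integrable_norm_sq (memLp_fun_sub (hS.memLp_yr i) (memLp_const _))
  change ∫ ω, ∑ i, ‖Fx i (idx ω i) ω‖ ^ 2 ∂P + ∫ ω, ∑ i, ‖Fy i (idx ω i) ω‖ ^ 2 ∂P ≤ _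
  unfold sqDist
  rw [integral_finsetSum _ fun i _ => (fx i).1, integral_finsetSum _ fun i _ => (fy i).1,
    integral_finsetSum _ fun i _ => qx i, integral_finsetSum _ fun i _ => qy i,
    integral_finsetSum _ fun i _ => qxr i, integral_finsetSum _ fun i _ => qyr i]
  simp only [Finset.mul_sum, ← Finset.sum_add_distrib]
  refine Finset.sum_le_sum fun i _ => ?_
  rw [(fx i).2, (fy i).2]
  simp only [hF.idx_law, ← integral_const_mul]
  have ix : ∀ l, Integrable (fun ω => D.prob i l * ‖Fx i l ω‖ ^ 2) P := fun l =>
    (integrable_norm_sq (lFx i l)).const_mul _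
  have iy : ∀ l, Integrable (fun ω => D.prob i l * ‖Fy i l ω‖ ^ 2) P := fun l =>
    (integrable_norm_sq (lFy i l)).const_mul _
  have a1 := (qx i).const_mul (1 - D.bX - D.ctx * D.p)
  have a2 := (qy i).const_mul (1 - D.bY - D.cty * D.p)
  have a3 := (qxr i).const_mul (D.ctx * D.p / 2)
  have a4 := (qyr i).const_mul (D.cty * D.p / 2)
  have hmono := integral_mono ((integrable_finsetSum _ fun l _ => ix l).add
    (integrable_finsetSum _ fun l _ => iy l)) (((a1.add a2).add a3).add a4) fun ω =>
    hD.oracle_step i (hS.x_mem ω i) (hS.y_mem ω i) (hS.xr_mem ω i) (hS.yr_mem ω i) hxs hys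
  rw [integral_add' (integrable_finsetSum _ fun l _ => ix l)
    (integrable_finsetSum _ fun l _ => iy l), integral_finsetSum _ fun l _ => ix l,
    integral_finsetSum _ fun l _ => iy l, integral_add' ((a1.add a2).add a3) a4,
    integral_add' (a1.add a2) a3, integral_add' a1 a2] at hmono
  exact hmono

end OneStep

end Data

namespace Data

variable {m n dx dy : ℕ} {D : Data m n dx dy} {G : SimpleGraph (Fin m)}

section Step

variable {Ω Θx Θy : Type*} [MeasurableSpace Θx] [MeasurableSpace Θy]
  {m₀ m₁ m₂ mΩ : MeasurableSpace Ω} {P : Measure Ω} [IsProbabilityMeasure P]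
  {τx : Measure Θx} {τy : Measure Θy} {Qx : Θx → E dx → E dx} {Qy : Θy → E dy → E dy}
  {idx : Ω → Fin m → Fin n} {coin : Ω → Fin m → Bool} {ξ : Ω → Fin m → Θx} {η : Ω → Fin m → Θy}
  {S S' : Ω → State m dx dy}

/-- The reference point update in expectation, for one of the two variables. -/
theorem _root_.CDPSVRG.reference_expectation {d : ℕ} {p : ℝ} {c : Ω → Fin m → Bool}
    (hc : Measurable c)
    (hp : ∀ i, P.real {ω | c ω i = true} = p)
    (hind : Indep m₀ (MeasurableSpace.comap c inferInstance) P) (hm : m₀ ≤ mΩ)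
    {u v w : Ω → Fin m → E d}
    (hu : ∀ i, Measurable[m₀] fun ω => u ω i) (hv : ∀ i, Measurable[m₀] fun ω => v ω i)
    (hu2 : ∀ i, MemLp (fun ω => u ω i) 2 P) (hv2 : ∀ i, MemLp (fun ω => v ω i) 2 P)
    (hw : ∀ ω i, w ω i = if c ω i then u ω i else v ω i) (z : E d) :
    (∀ i, MemLp (fun ω => w ω i) 2 P) ∧
    ∫ ω, sqDist (w ω) (fun _ => z) ∂P
      = p * ∫ ω, sqDist (u ω) (fun _ => z) ∂P + (1 - p) * ∫ ω, sqDist (v ω) (fun _ => z) ∂P := by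
  have hci : ∀ i, Measurable fun ω => c ω i := fun i => (measurable_pi_apply i).comp hc
  have hindi : ∀ i, Indep m₀ (MeasurableSpace.comap (fun ω => c ω i) inferInstance) P := fun i =>
    indep_of_indep_of_le_right hind (by
      change MeasurableSpace.comap ((fun f : Fin m → Bool => f i) ∘ c) _ ≤ _
      rw [← MeasurableSpace.comap_comp]
      exact MeasurableSpace.comap_mono (measurable_pi_apply i).comap_le)
  have hw2 : ∀ i, MemLp (fun ω => w ω i) 2 P := fun i => by
    simp only [hw]
    refine memLp_at_draw (F := fun b ω => if b = true then u ω i else v ω i) (fun b => ?_)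
      (fun b => ?_) (hci i)
    · cases b
      · simpa using (hv i).mono hm le_rfl
      · simpa using (hu i).mono hm le_rfl
    · cases b
      · simpa using hv2 i
      · simpa using hu2 i
  refine ⟨hw2, ?_⟩
  have iu : ∀ i, Integrable (fun ω => ‖u ω i - z‖ ^ 2) P := fun i =>
    integrable_norm_sq (memLp_fun_sub (hu2 i) (memLp_const _))
  have iv : ∀ i, Integrable (fun ω => ‖v ω i - z‖ ^ 2) P := fun i =>
    integrable_norm_sq (memLp_fun_sub (hv2 i) (memLp_const _))
  have iw : ∀ i, Integrable (fun ω => ‖w ω i - z‖ ^ 2) P := fun i =>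
    integrable_norm_sq (memLp_fun_sub (hw2 i) (memLp_const _))
  unfold sqDist
  rw [integral_finsetSum _ fun i _ => iu i, integral_finsetSum _ fun i _ => iv i,
    integral_finsetSum _ fun i _ => iw i]
  simp only [Finset.mul_sum, ← Finset.sum_add_distrib]
  refine Finset.sum_congr rfl fun i _ => ?_
  have hnsq : Measurable fun y : E d => ‖y - z‖ ^ 2 := by fun_prop
  have h := (integral_fresh_draw (P := P) (hci i) (hindi i)
    (F := fun b ω => if b = true then ‖u ω i - z‖ ^ 2 else ‖v ω i - z‖ ^ 2)
    (fun b => by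
      cases b
      · simpa [Function.comp_def] using hnsq.comp (hv i)
      · simpa [Function.comp_def] using hnsq.comp (hu i))
    (fun b => by
      cases b
      · simpa using iv i
      · simpa using iu i)).2
  have hfalse : P.real {ω | c ω i = false} = 1 - p := by
    have h1 : {ω | c ω i = false} = {ω | c ω i = true}ᶜ := by
      ext ω; simp
    have h2 : MeasurableSet {ω | c ω i = true} := hci i (measurableSet_singleton true)
    rw [h1, probReal_compl_eq_one_sub h2, hp]
  have hwi : ∀ ω, ‖w ω i - z‖ ^ 2
      = if c ω i = true then ‖u ω i - z‖ ^ 2 else ‖v ω i - z‖ ^ 2 := by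
    intro ω
    rw [hw]
    split_ifs <;> rfl
  simp only [hwi, h, Fintype.sum_bool, hp, hfalse]
  simp

/-- Integrability of the Lyapunov function, and its expectation term by term. -/
theorem Admissible.integral_PhiTilde (hS : D.Admissible m₀ P S) (xs : E dx) (ys : E dy) :
    Integrable (fun ω => D.PhiTilde xs ys (S ω)) P ∧
    Integrable (fun ω => errSq xs ys (S ω)) P ∧
    ∫ ω, D.PhiTilde xs ys (S ω) ∂P
      = ∫ ω, (D.Mx * sqDist (S ω).x (fun _ => xs)
          + 2 * D.s ^ 2 / D.γx * pinvNormSq (1 - D.W) (fun i => (S ω).Dx i - D.DxStar xs ys i)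
          + Real.sqrt D.δ * sqDist (S ω).Hx (D.HxStar xs ys)) ∂P
        + ∫ ω, (D.My * sqDist (S ω).y (fun _ => ys)
          + 2 * D.s ^ 2 / D.γy * pinvNormSq (1 - D.W) (fun i => (S ω).Dy i - D.DyStar xs ys i)
          + Real.sqrt D.δ * sqDist (S ω).Hy (D.HyStar xs ys)) ∂P
        + D.ctx * ∫ ω, sqDist (S ω).xr (fun _ => xs) ∂P
        + D.cty * ∫ ω, sqDist (S ω).yr (fun _ => ys) ∂P ∧
    ∫ ω, (D.Mx * sqDist (S ω).x (fun _ => xs)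
          + 2 * D.s ^ 2 / D.γx * pinvNormSq (1 - D.W) (fun i => (S ω).Dx i - D.DxStar xs ys i)
          + Real.sqrt D.δ * sqDist (S ω).Hx (D.HxStar xs ys)) ∂P
      = D.Mx * ∫ ω, sqDist (S ω).x (fun _ => xs) ∂P
        + 2 * D.s ^ 2 / D.γx *
          ∫ ω, pinvNormSq (1 - D.W) (fun i => (S ω).Dx i - D.DxStar xs ys i) ∂P
        + Real.sqrt D.δ * ∫ ω, sqDist (S ω).Hx (D.HxStar xs ys) ∂P ∧
    ∫ ω, (D.My * sqDist (S ω).y (fun _ => ys)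
          + 2 * D.s ^ 2 / D.γy * pinvNormSq (1 - D.W) (fun i => (S ω).Dy i - D.DyStar xs ys i)
          + Real.sqrt D.δ * sqDist (S ω).Hy (D.HyStar xs ys)) ∂P
      = D.My * ∫ ω, sqDist (S ω).y (fun _ => ys) ∂P
        + 2 * D.s ^ 2 / D.γy *
          ∫ ω, pinvNormSq (1 - D.W) (fun i => (S ω).Dy i - D.DyStar xs ys i) ∂P
        + Real.sqrt D.δ * ∫ ω, sqDist (S ω).Hy (D.HyStar xs ys) ∂P := by
  have x1 : Integrable (fun ω => sqDist (S ω).x (fun _ => xs)) P :=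
    integrable_sum_norm_sq (u := fun ω i => (S ω).x i - xs) fun i =>
      memLp_fun_sub (hS.memLp_x i) (memLp_const _)
  have x2 : Integrable (fun ω =>
      pinvNormSq (1 - D.W) (fun i => (S ω).Dx i - D.DxStar xs ys i)) P :=
    integrable_pinvNormSq _ (u := fun ω i => (S ω).Dx i - D.DxStar xs ys i) fun i =>
      memLp_fun_sub (hS.memLp_Dx i) (memLp_const _)
  have x3 : Integrable (fun ω => sqDist (S ω).Hx (D.HxStar xs ys)) P :=
    integrable_sum_norm_sq (u := fun ω i => (S ω).Hx i - D.HxStar xs ys i) fun i =>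
      memLp_fun_sub (hS.memLp_Hx i) (memLp_const _)
  have x4 : Integrable (fun ω => sqDist (S ω).xr (fun _ => xs)) P :=
    integrable_sum_norm_sq (u := fun ω i => (S ω).xr i - xs) fun i =>
      memLp_fun_sub (hS.memLp_xr i) (memLp_const _)
  have y1 : Integrable (fun ω => sqDist (S ω).y (fun _ => ys)) P :=
    integrable_sum_norm_sq (u := fun ω i => (S ω).y i - ys) fun i =>
      memLp_fun_sub (hS.memLp_y i) (memLp_const _)
  have y2 : Integrable (fun ω =>
      pinvNormSq (1 - D.W) (fun i => (S ω).Dy i - D.DyStar xs ys i)) P :=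
    integrable_pinvNormSq _ (u := fun ω i => (S ω).Dy i - D.DyStar xs ys i) fun i =>
      memLp_fun_sub (hS.memLp_Dy i) (memLp_const _)
  have y3 : Integrable (fun ω => sqDist (S ω).Hy (D.HyStar xs ys)) P :=
    integrable_sum_norm_sq (u := fun ω i => (S ω).Hy i - D.HyStar xs ys i) fun i =>
      memLp_fun_sub (hS.memLp_Hy i) (memLp_const _)
  have y4 : Integrable (fun ω => sqDist (S ω).yr (fun _ => ys)) P :=
    integrable_sum_norm_sq (u := fun ω i => (S ω).yr i - ys) fun i =>
      memLp_fun_sub (hS.memLp_yr i) (memLp_const _)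
  have x1' := x1.const_mul D.Mx
  have x2' := x2.const_mul (2 * D.s ^ 2 / D.γx)
  have x3' := x3.const_mul (Real.sqrt D.δ)
  have x4' := x4.const_mul D.ctx
  have y1' := y1.const_mul D.My
  have y2' := y2.const_mul (2 * D.s ^ 2 / D.γy)
  have y3' := y3.const_mul (Real.sqrt D.δ)
  have y4' := y4.const_mul D.cty
  set Ax : Ω → ℝ := fun ω => D.Mx * sqDist (S ω).x (fun _ => xs)
    + 2 * D.s ^ 2 / D.γx * pinvNormSq (1 - D.W) (fun i => (S ω).Dx i - D.DxStar xs ys i)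
    + Real.sqrt D.δ * sqDist (S ω).Hx (D.HxStar xs ys) with hAx
  set Ay : Ω → ℝ := fun ω => D.My * sqDist (S ω).y (fun _ => ys)
    + 2 * D.s ^ 2 / D.γy * pinvNormSq (1 - D.W) (fun i => (S ω).Dy i - D.DyStar xs ys i)
    + Real.sqrt D.δ * sqDist (S ω).Hy (D.HyStar xs ys) with hAy
  have hdec : (fun ω => D.PhiTilde xs ys (S ω)) = Ax + Ay
      + (fun ω => D.ctx * sqDist (S ω).xr (fun _ => xs))
      + (fun ω => D.cty * sqDist (S ω).yr (fun _ => ys)) := by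
    funext ω
    simp only [PhiTilde, Phi, Pi.add_apply, hAx, hAy]
    ring
  have ix : Integrable Ax P := (x1'.add x2').add x3'
  have iy : Integrable Ay P := (y1'.add y2').add y3'
  refine ⟨?_, x1.add y1, ?_, ?_, ?_⟩
  · rw [hdec]; exact ((ix.add iy).add x4').add y4'
  · rw [hdec, integral_add' ((ix.add iy).add x4') y4', integral_add' (ix.add iy) x4',
      integral_add' ix iy, integral_const_mul, integral_const_mul]
  · rw [← integral_const_mul, ← integral_const_mul, ← integral_const_mul,
      ← integral_add' x1' x2', ← integral_add' (x1'.add x2') x3']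
    rfl
  · rw [← integral_const_mul, ← integral_const_mul, ← integral_const_mul,
      ← integral_add' y1' y2', ← integral_add' (y1'.add y2') y3']
    rfl

theorem pinvNormSq_nonneg (hD : D.Assumptions G) {d : ℕ} (u : Fin m → E d) :
    0 ≤ pinvNormSq (1 - D.W) u := by
  obtain ⟨a, φ, hA⟩ := hD.spectral
  rw [hA.pinvNormSq_eq]
  exact Finset.sum_nonneg fun k _ => mul_nonneg (inv_nonneg.2 (hA.nonneg k)) (sq_nonneg _)

theorem _root_.CDPSVRG.sqDist_nonneg {d : ℕ} (u v : Fin m → E d) : 0 ≤ sqDist u v :=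
  Finset.sum_nonneg fun _ _ => sq_nonneg _

theorem ctx_nonneg (hD : D.Assumptions G) : 0 ≤ D.ctx := by
  have := hD.npmin_pos; have := hD.p_pos
  unfold ctx; positivity

theorem cty_nonneg (hD : D.Assumptions G) : 0 ≤ D.cty := by
  have := hD.npmin_pos; have := hD.p_pos
  unfold cty; positivity

/-- One iteration of the method: the next state is admissible, and the Lyapunov function contracts
by the factor `ρ` in expectation. -/
theorem Admissible.step (hD : D.Assumptions G) {xs : E dx} {ys : E dy} (hz : D.IsSolution xs ys)
    (hQx : IsCompressor τx Qx D.δ) (hQy : IsCompressor τy Qy D.δ) (hS : D.Admissible m₀ P S)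
    (hF : D.FreshDraws m₀ m₁ m₂ P τx τy idx coin ξ η)
    (hS' : ∀ ω, S' ω = D.step (idx ω) (coin ω) (fun i => Qx (ξ ω i)) (fun i => Qy (η ω i)) (S ω)) :
    D.Admissible m₂ P S' ∧
    ∫ ω, D.PhiTilde xs ys (S' ω) ∂P ≤ D.ρ * ∫ ω, D.PhiTilde xs ys (S ω) ∂P := by
  obtain ⟨a, φ, hA⟩ := hD.spectral
  have h1 := hF.le₁₂.trans hF.le₂
  have h0 := hF.le₀₁.trans h1
  have h02 := hF.le₀₁.trans hF.le₁₂
  have hs := hD.s_pos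
  have hi0 : Fin m := ⟨0, hD.m_pos⟩
  have hx' : ∀ ω i, (S' ω).x i = prox D.X D.g D.s (D.nuX (idx ω) (S ω) i - (D.γx / 2) •
      ((comm D.W (fun i => Qx (ξ ω i)) (D.nuX (idx ω) (S ω)) (S ω).Hx (S ω).Hwx D.αx).nuHat i
      - (comm D.W (fun i => Qx (ξ ω i)) (D.nuX (idx ω) (S ω)) (S ω).Hx (S ω).Hwx D.αx).nuHatW i)) :=
    fun ω i => by rw [hS' ω]; rfl
  have hDx' : ∀ ω i, (S' ω).Dx i = (S ω).Dx i + (D.γx / (2 * D.s)) •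
      ((comm D.W (fun i => Qx (ξ ω i)) (D.nuX (idx ω) (S ω)) (S ω).Hx (S ω).Hwx D.αx).nuHat i
      - (comm D.W (fun i => Qx (ξ ω i)) (D.nuX (idx ω) (S ω)) (S ω).Hx (S ω).Hwx D.αx).nuHatW i) :=
    fun ω i => by rw [hS' ω]; rfl
  have hHx' : ∀ ω i, (S' ω).Hx i = (comm D.W (fun i => Qx (ξ ω i)) (D.nuX (idx ω) (S ω))
      (S ω).Hx (S ω).Hwx D.αx).Hnew i := fun ω i => by rw [hS' ω]; rfl
  have hHwx' : ∀ ω i, (S' ω).Hwx i = (comm D.W (fun i => Qx (ξ ω i)) (D.nuX (idx ω) (S ω))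
      (S ω).Hx (S ω).Hwx D.αx).HWnew i := fun ω i => by rw [hS' ω]; rfl
  have hy' : ∀ ω i, (S' ω).y i = prox D.Y D.r D.s (D.nuY (idx ω) (S ω) i - (D.γy / 2) •
      ((comm D.W (fun i => Qy (η ω i)) (D.nuY (idx ω) (S ω)) (S ω).Hy (S ω).Hwy D.αy).nuHat i
      - (comm D.W (fun i => Qy (η ω i)) (D.nuY (idx ω) (S ω)) (S ω).Hy (S ω).Hwy D.αy).nuHatW i)) :=
    fun ω i => by rw [hS' ω]; rfl
  have hDy' : ∀ ω i, (S' ω).Dy i = (S ω).Dy i + (D.γy / (2 * D.s)) •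
      ((comm D.W (fun i => Qy (η ω i)) (D.nuY (idx ω) (S ω)) (S ω).Hy (S ω).Hwy D.αy).nuHat i
      - (comm D.W (fun i => Qy (η ω i)) (D.nuY (idx ω) (S ω)) (S ω).Hy (S ω).Hwy D.αy).nuHatW i) :=
    fun ω i => by rw [hS' ω]; rfl
  have hHy' : ∀ ω i, (S' ω).Hy i = (comm D.W (fun i => Qy (η ω i)) (D.nuY (idx ω) (S ω))
      (S ω).Hy (S ω).Hwy D.αy).Hnew i := fun ω i => by rw [hS' ω]; rfl
  have hHwy' : ∀ ω i, (S' ω).Hwy i = (comm D.W (fun i => Qy (η ω i)) (D.nuY (idx ω) (S ω))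
      (S ω).Hy (S ω).Hwy D.αy).HWnew i := fun ω i => by rw [hS' ω]; rfl
  have hxr' : ∀ ω i, (S' ω).xr i = if coin ω i then (S ω).x i else (S ω).xr i :=
    fun ω i => by rw [hS' ω]; rfl
  have hyr' : ∀ ω i, (S' ω).yr i = if coin ω i then (S ω).y i else (S ω).yr i :=
    fun ω i => by rw [hS' ω]; rfl
  have hν := hS.nu_regular hD hF
  have mHx := fun i => (hS.meas_Hx i).mono hF.le₀₁ le_rfl
  have mHy := fun i => (hS.meas_Hy i).mono hF.le₀₁ le_rfl
  have mDx := fun i => (hS.meas_Dx i).mono hF.le₀₁ le_rfl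
  have mDy := fun i => (hS.meas_Dy i).mono hF.le₀₁ le_rfl
  have bx := block_expectation (P := P) h1 hD.stepParams_x.1 hD.stepParams_x.2.1 hA hD.W_row_sum
    hD.X_compact hD.X_nonempty hD.g_convex hD.g_cont hQx (hF.meas_ξ.mono hF.le₂ le_rfl) hF.ξ_law
    hF.indep_ξ (fun i => (hν i).1) mHx mDx (fun i => (hν i).2.2.1) hS.memLp_Hx hS.memLp_Dx
    hS.Hwx hS.sum_Dx hx' hDx' hHx' (sum_DxStar hD xs ys) hz.1 (hD.saddle_variational_x hz hs hi0)
  have bY := block_expectation (P := P) h1 hD.stepParams_y.1 hD.stepParams_y.2.1 hA hD.W_row_sum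
    hD.Y_compact hD.Y_nonempty hD.r_convex hD.r_cont hQy (hF.meas_η.mono hF.le₂ le_rfl) hF.η_law
    hF.indep_η (fun i => (hν i).2.1) mHy mDy (fun i => (hν i).2.2.2) hS.memLp_Hy hS.memLp_Dy
    hS.Hwy hS.sum_Dy hy' hDy' hHy' (sum_DyStar hD xs ys) hz.2.1
    (hD.saddle_variational_y hz hs hi0)
  have rx := reference_expectation (P := P) (hF.meas_coin.mono hF.le₂ le_rfl) hF.coin_law
    hF.indep_coin h0 hS.meas_x hS.meas_xr hS.memLp_x hS.memLp_xr hxr' xs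
  have ry := reference_expectation (P := P) (hF.meas_coin.mono hF.le₂ le_rfl) hF.coin_law
    hF.indep_coin h0 hS.meas_y hS.meas_yr hS.memLp_y hS.memLp_yr hyr' ys
  have hpx := continuous_prox hD.X_compact hD.X_nonempty hD.g_convex hD.g_cont hs
  have hpy := continuous_prox hD.Y_compact hD.Y_nonempty hD.r_convex hD.r_cont hs
  have nx := fun i => @measurable_block m dx D.W Ω Θx _ m₂ _ _ _ D.γx D.αx hpx _ hQx.meas _ hF.meas_ξ
    _ _ _ _ (fun i => (hν i).1.mono hF.le₁₂ le_rfl) (fun i => (mHx i).mono hF.le₁₂ le_rfl)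
    (fun i => (mDx i).mono hF.le₁₂ le_rfl) hS.Hwx i
  have ny := fun i => @measurable_block m dy D.W Ω Θy _ m₂ _ _ _ D.γy D.αy hpy _ hQy.meas _ hF.meas_η
    _ _ _ _ (fun i => (hν i).2.1.mono hF.le₁₂ le_rfl) (fun i => (mHy i).mono hF.le₁₂ le_rfl)
    (fun i => (mDy i).mono hF.le₁₂ le_rfl) hS.Hwy i
  simp only [← hx', ← hDx', ← hHx'] at nx
  simp only [← hy', ← hDy', ← hHy'] at ny
  have hcoin : ∀ i, MeasurableSet[m₂] {ω | coin ω i = true} := fun i =>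
    ((measurable_pi_apply i).comp hF.meas_coin) (measurableSet_singleton true)
  have hadm : D.Admissible m₂ P S' :=
    { x_mem := fun ω i => by
        rw [hx']; exact (prox_spec hD.X_compact hD.X_nonempty hD.g_cont _ _).1
      y_mem := fun ω i => by
        rw [hy']; exact (prox_spec hD.Y_compact hD.Y_nonempty hD.r_cont _ _).1
      xr_mem := fun ω i => by
        rw [hxr']; split_ifs
        exacts [hS.x_mem ω i, hS.xr_mem ω i]
      yr_mem := fun ω i => by
        rw [hyr']; split_ifs
        exacts [hS.y_mem ω i, hS.yr_mem ω i]
      Hwx := fun ω i => by rw [hHwx']; simp only [hHx']; exact comm_HWnew (hS.Hwx ω) i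
      Hwy := fun ω i => by rw [hHwy']; simp only [hHy']; exact comm_HWnew (hS.Hwy ω) i
      sum_Dx := fun ω => by
        simp only [hDx', comm_sub (hS.Hwx ω), Finset.sum_add_distrib, hS.sum_Dx ω,
          ← Finset.smul_sum, sum_sum_one_sub_smul hD.W_symm hD.W_row_sum, smul_zero, add_zero]
      sum_Dy := fun ω => by
        simp only [hDy', comm_sub (hS.Hwy ω), Finset.sum_add_distrib, hS.sum_Dy ω,
          ← Finset.smul_sum, sum_sum_one_sub_smul hD.W_symm hD.W_row_sum, smul_zero, add_zero]
      meas_x := fun i => (nx i).1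
      meas_y := fun i => (ny i).1
      meas_xr := fun i => by
        simp only [hxr']
        exact Measurable.ite (hcoin i) ((hS.meas_x i).mono h02 le_rfl)
          ((hS.meas_xr i).mono h02 le_rfl)
      meas_yr := fun i => by
        simp only [hyr']
        exact Measurable.ite (hcoin i) ((hS.meas_y i).mono h02 le_rfl)
          ((hS.meas_yr i).mono h02 le_rfl)
      meas_Dx := fun i => (nx i).2.1
      meas_Dy := fun i => (ny i).2.1
      meas_Hx := fun i => (nx i).2.2
      meas_Hy := fun i => (ny i).2.2
      memLp_x := bx.1
      memLp_y := bY.1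
      memLp_xr := rx.1
      memLp_yr := ry.1
      memLp_Dx := bx.2.1
      memLp_Dy := bY.2.1
      memLp_Hx := bx.2.2.1
      memLp_Hy := bY.2.2.1 }
  refine ⟨hadm, ?_⟩
  have or := hS.oracle_expectation hD hF hz.1 hz.2.1
  have ex := bx.2.2.2
  have ey := bY.2.2.2
  simp only [nuX_error] at ex
  simp only [nuY_error] at ey
  have fx := rx.2
  have fy := ry.2
  obtain ⟨-, -, e1, e2, e3⟩ := hS.integral_PhiTilde xs ys
  obtain ⟨-, -, e1', -, -⟩ := hadm.integral_PhiTilde xs ys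
  have hHxs : ∀ u : Fin m → E dx, sqDist u (fun _ => D.HxStar xs ys hi0)
      = sqDist u (D.HxStar xs ys) := fun _ => rfl
  have hHys : ∀ u : Fin m → E dy, sqDist u (fun _ => D.HyStar xs ys hi0)
      = sqDist u (D.HyStar xs ys) := fun _ => rfl
  simp only [hHxs] at ex
  simp only [hHys] at ey
  rw [e1', e1, e2, e3, fx, fy]
  have p1 : 0 ≤ ∫ ω, sqDist (S ω).x (fun _ => xs) ∂P := integral_nonneg fun _ => sqDist_nonneg _ _
  have p2 : 0 ≤ ∫ ω, sqDist (S ω).y (fun _ => ys) ∂P := integral_nonneg fun _ => sqDist_nonneg _ _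
  have p3 : 0 ≤ ∫ ω, sqDist (S ω).xr (fun _ => xs) ∂P := integral_nonneg fun _ => sqDist_nonneg _ _
  have p4 : 0 ≤ ∫ ω, sqDist (S ω).yr (fun _ => ys) ∂P := integral_nonneg fun _ => sqDist_nonneg _ _
  have p5 : 0 ≤ ∫ ω, sqDist (S ω).Hx (D.HxStar xs ys) ∂P :=
    integral_nonneg fun _ => sqDist_nonneg _ _
  have p6 : 0 ≤ ∫ ω, sqDist (S ω).Hy (D.HyStar xs ys) ∂P :=
    integral_nonneg fun _ => sqDist_nonneg _ _
  have p7 : 0 ≤ ∫ ω, pinvNormSq (1 - D.W) (fun i => (S ω).Dx i - D.DxStar xs ys i) ∂P :=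
    integral_nonneg fun _ => pinvNormSq_nonneg hD _
  have p8 : 0 ≤ ∫ ω, pinvNormSq (1 - D.W) (fun i => (S ω).Dy i - D.DyStar xs ys i) ∂P :=
    integral_nonneg fun _ => pinvNormSq_nonneg hD _
  obtain ⟨r1, r2, r3, r4, r5, r6, r7⟩ := Assumptions.rho_bounds D
  rw [div_le_iff₀ (by linarith [hD.half_le_Mx])] at r1
  rw [div_le_iff₀ (by linarith [hD.half_le_My])] at r2
  have gx : 0 ≤ 2 * D.s ^ 2 / D.γx := by have := hD.stepParams_x.1.γ_pos; positivity
  have gy : 0 ≤ 2 * D.s ^ 2 / D.γy := by have := hD.stepParams_y.1.γ_pos; positivity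
  have t1 := mul_le_mul_of_nonneg_right r1 p1
  have t2 := mul_le_mul_of_nonneg_right r2 p2
  have t3 := mul_le_mul_of_nonneg_right r7 (mul_nonneg (ctx_nonneg hD) p3)
  have t4 := mul_le_mul_of_nonneg_right r7 (mul_nonneg (cty_nonneg hD) p4)
  have t5 := mul_le_mul_of_nonneg_right r5 (mul_nonneg (Real.sqrt_nonneg D.δ) p5)
  have t6 := mul_le_mul_of_nonneg_right r6 (mul_nonneg (Real.sqrt_nonneg D.δ) p6)
  have t7 := mul_le_mul_of_nonneg_right r3 (mul_nonneg gx p7)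
  have t8 := mul_le_mul_of_nonneg_right r4 (mul_nonneg gy p8)
  linarith

end Step

end Data

namespace Data

variable {m n dx dy : ℕ} {D : Data m n dx dy} {G : SimpleGraph (Fin m)}

/-! ### The trajectory of the method -/

/-- Each iteration makes one oracle call per node and two communication rounds, one for each of the
two variables. -/
theorem run_counters {Ω Θx Θy : Type*} {Qx : Θx → E dx → E dx} {Qy : Θy → E dy → E dy}
    {idx : ℕ → Ω → Fin m → Fin n} {coin : ℕ → Ω → Fin m → Bool} {ξ : ℕ → Ω → Fin m → Θx}
    {η : ℕ → Ω → Fin m → Θy} (D : Data m n dx dy) (x0 xr0 : Fin m → E dx) (y0 yr0 : Fin m → E dy)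
    (ω : Ω) (t : ℕ) :
    (D.run Qx Qy idx coin ξ η (D.init x0 y0 xr0 yr0) ω t).oracleCalls = t ∧
    (D.run Qx Qy idx coin ξ η (D.init x0 y0 xr0 yr0) ω t).commRounds = 2 * t := by
  induction t with
  | zero => exact ⟨rfl, rfl⟩
  | succ t ih =>
    constructor
    · change (D.run Qx Qy idx coin ξ η (D.init x0 y0 xr0 yr0) ω t).oracleCalls + 1 = t + 1
      rw [ih.1]
    · change (D.run Qx Qy idx coin ξ η (D.init x0 y0 xr0 yr0) ω t).commRounds + 2 = 2 * (t + 1)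
      rw [ih.2]; ring

section Run

variable {Ω Θx Θy : Type*} [MeasurableSpace Θx] [MeasurableSpace Θy]

/-- The `σ`-algebra generated by the draws of the iterations and kinds in `T`, where the kinds
`0, 1, 2, 3` are the indices, the Bernoulli variables and the seeds of the two compressors. -/
@[reducible]
def history (idx : ℕ → Ω → Fin m → Fin n) (coin : ℕ → Ω → Fin m → Bool) (ξ : ℕ → Ω → Fin m → Θx)
    (η : ℕ → Ω → Fin m → Θy) (T : Set (ℕ × Fin 4)) : MeasurableSpace Ω :=
  ⨆ k ∈ T, ![MeasurableSpace.comap (idx k.1) inferInstance,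
    MeasurableSpace.comap (coin k.1) inferInstance, MeasurableSpace.comap (ξ k.1) inferInstance,
    MeasurableSpace.comap (η k.1) inferInstance] k.2

variable {mΩ : MeasurableSpace Ω} {P : Measure Ω} {τx : Measure Θx} {τy : Measure Θy}
  {idx : ℕ → Ω → Fin m → Fin n} {coin : ℕ → Ω → Fin m → Bool}
  {ξ : ℕ → Ω → Fin m → Θx} {η : ℕ → Ω → Fin m → Θy}

theorem history_mono {T T' : Set (ℕ × Fin 4)} (h : T ⊆ T') :
    history idx coin ξ η T ≤ history idx coin ξ η T' := biSup_mono h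

theorem le_history {T : Set (ℕ × Fin 4)} {k : ℕ × Fin 4} (h : k ∈ T) :
    ![MeasurableSpace.comap (idx k.1) inferInstance,
      MeasurableSpace.comap (coin k.1) inferInstance, MeasurableSpace.comap (ξ k.1) inferInstance,
      MeasurableSpace.comap (η k.1) inferInstance] k.2 ≤ history idx coin ξ η T :=
  le_iSup₂ (f := fun (k : ℕ × Fin 4) (_ : k ∈ T) =>
    (![MeasurableSpace.comap (idx k.1) inferInstance,
      MeasurableSpace.comap (coin k.1) inferInstance, MeasurableSpace.comap (ξ k.1) inferInstance,
      MeasurableSpace.comap (η k.1) inferInstance] k.2 : MeasurableSpace Ω)) k h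

namespace IsSampling

theorem draw_le (h : D.IsSampling P τx τy idx coin ξ η) (k : ℕ × Fin 4) :
    ![MeasurableSpace.comap (idx k.1) inferInstance,
      MeasurableSpace.comap (coin k.1) inferInstance, MeasurableSpace.comap (ξ k.1) inferInstance,
      MeasurableSpace.comap (η k.1) inferInstance] k.2 ≤ mΩ := by
  obtain ⟨t, j⟩ := k
  fin_cases j
  · exact (h.meas_idx t).comap_le
  · exact (h.meas_coin t).comap_le
  · exact (h.meas_ξ t).comap_le
  · exact (h.meas_η t).comap_le

theorem history_le (h : D.IsSampling P τx τy idx coin ξ η) (T : Set (ℕ × Fin 4)) :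
    history idx coin ξ η T ≤ mΩ := iSup₂_le fun k _ => h.draw_le k

/-- A family of draws is independent of the draw of any other iteration and kind. -/
theorem indep_history (h : D.IsSampling P τx τy idx coin ξ η) {T : Set (ℕ × Fin 4)}
    {k : ℕ × Fin 4} (hk : k ∉ T) :
    Indep (history idx coin ξ η T) (![MeasurableSpace.comap (idx k.1) inferInstance,
      MeasurableSpace.comap (coin k.1) inferInstance, MeasurableSpace.comap (ξ k.1) inferInstance,
      MeasurableSpace.comap (η k.1) inferInstance] k.2) P := by
  have h1 := indep_iSup_of_disjoint h.draw_le h.indep (S := T) (T := {k})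
    (Set.disjoint_singleton_right.2 hk)
  exact indep_of_indep_of_le_right h1 (le_iSup₂ (f := fun (k' : ℕ × Fin 4)
    (_ : k' ∈ ({k} : Set (ℕ × Fin 4))) =>
    (![MeasurableSpace.comap (idx k'.1) inferInstance,
      MeasurableSpace.comap (coin k'.1) inferInstance, MeasurableSpace.comap (ξ k'.1) inferInstance,
      MeasurableSpace.comap (η k'.1) inferInstance] k'.2 : MeasurableSpace Ω)) k
    (Set.mem_singleton k))

/-- The draws of iteration `t` are fresh relative to the draws of the iterations before `t`. The seeds
of the compressors are also independent of the indices of iteration `t`, with which they are used. -/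
theorem freshDraws (hD : D.Assumptions G) (h : D.IsSampling P τx τy idx coin ξ η) (t : ℕ) :
    D.FreshDraws (history idx coin ξ η {k | k.1 < t})
      (history idx coin ξ η {k | k.1 < t ∨ k = (t, 0)})
      (history idx coin ξ η {k | k.1 < t + 1}) P τx τy (idx t) (coin t) (ξ t) (η t) where
  le₀₁ := history_mono fun k hk => Or.inl hk
  le₁₂ := history_mono fun k hk => by
    rcases hk with hk | hk
    · exact Nat.lt_succ_of_lt hk
    · subst hk; exact Nat.lt_succ_self t
  le₂ := h.history_le _
  meas_idx := Measurable.of_comap_le (le_history (k := (t, 0)) (Or.inr rfl))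
  meas_coin := Measurable.of_comap_le (le_history (k := (t, 1)) (Nat.lt_succ_self t))
  meas_ξ := Measurable.of_comap_le (le_history (k := (t, 2)) (Nat.lt_succ_self t))
  meas_η := Measurable.of_comap_le (le_history (k := (t, 3)) (Nat.lt_succ_self t))
  idx_law i j := by
    rw [Measure.real, h.idx_law, ENNReal.toReal_ofReal (hD.prob_pos i j).le]
  coin_law i := by
    rw [Measure.real, h.coin_law, ENNReal.toReal_ofReal hD.p_pos.le]
  ξ_law := h.ξ_law t
  η_law := h.η_law t
  indep_idx := h.indep_history (k := (t, 0)) (lt_irrefl t)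
  indep_coin := h.indep_history (k := (t, 1)) (lt_irrefl t)
  indep_ξ := h.indep_history (k := (t, 2)) (by simp)
  indep_η := h.indep_history (k := (t, 3)) (by simp)

end IsSampling

theorem admissible_init [IsProbabilityMeasure P] (m₀ : MeasurableSpace Ω)
    {x0 xr0 : Fin m → E dx} {y0 yr0 : Fin m → E dy}
    (hx : ∀ i, x0 i ∈ D.X) (hxr : ∀ i, xr0 i ∈ D.X) (hy : ∀ i, y0 i ∈ D.Y)
    (hyr : ∀ i, yr0 i ∈ D.Y) : D.Admissible m₀ P (fun _ => D.init x0 y0 xr0 yr0) where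
  x_mem _ := hx
  y_mem _ := hy
  xr_mem _ := hxr
  yr_mem _ := hyr
  Hwx _ _ := rfl
  Hwy _ _ := rfl
  sum_Dx _ := by simp [init]
  sum_Dy _ := by simp [init]
  meas_x _ := measurable_const
  meas_y _ := measurable_const
  meas_xr _ := measurable_const
  meas_yr _ := measurable_const
  meas_Dx _ := measurable_const
  meas_Dy _ := measurable_const
  meas_Hx _ := measurable_const
  meas_Hy _ := measurable_const
  memLp_x _ := memLp_const _
  memLp_y _ := memLp_const _
  memLp_xr _ := memLp_const _
  memLp_yr _ := memLp_const _
  memLp_Dx _ := memLp_const _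
  memLp_Dy _ := memLp_const _
  memLp_Hx _ := memLp_const _
  memLp_Hy _ := memLp_const _

variable {Qx : Θx → E dx → E dx} {Qy : Θy → E dy → E dy}

/-- Linear convergence of the Lyapunov function along the trajectory. -/
theorem run_contraction [IsProbabilityMeasure P] (hD : D.Assumptions G) {xs : E dx} {ys : E dy}
    (hz : D.IsSolution xs ys) (hQx : IsCompressor τx Qx D.δ) (hQy : IsCompressor τy Qy D.δ)
    (h : D.IsSampling P τx τy idx coin ξ η) {x0 xr0 : Fin m → E dx} {y0 yr0 : Fin m → E dy}
    (hx : ∀ i, x0 i ∈ D.X) (hxr : ∀ i, xr0 i ∈ D.X) (hy : ∀ i, y0 i ∈ D.Y)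
    (hyr : ∀ i, yr0 i ∈ D.Y) (t : ℕ) :
    D.Admissible (history idx coin ξ η {k | k.1 < t}) P
      (fun ω => D.run Qx Qy idx coin ξ η (D.init x0 y0 xr0 yr0) ω t) ∧
    ∫ ω, D.PhiTilde xs ys (D.run Qx Qy idx coin ξ η (D.init x0 y0 xr0 yr0) ω t) ∂P
      ≤ D.ρ ^ t * D.PhiTilde xs ys (D.init x0 y0 xr0 yr0) := by
  induction t with
  | zero =>
    refine ⟨admissible_init _ hx hxr hy hyr, ?_⟩
    simp [run]
  | succ t ih =>
    have hstep := ih.1.step hD hz hQx hQy (h.freshDraws hD t)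
      (S' := fun ω => D.run Qx Qy idx coin ξ η (D.init x0 y0 xr0 yr0) ω (t + 1)) fun ω => rfl
    refine ⟨hstep.1, hstep.2.trans ?_⟩
    rw [pow_succ', mul_assoc]
    exact mul_le_mul_of_nonneg_left ih.2 hD.rho_pos.le

end Run

/-! ### Iteration complexity -/

/-- All terms of the Lyapunov function are nonnegative, and the weights `M_x`, `M_y` are at least
`1 / 2`. -/
theorem errSq_le_PhiTilde (hD : D.Assumptions G) (xs : E dx) (ys : E dy) (S : State m dx dy) :
    0 ≤ errSq xs ys S ∧ errSq xs ys S ≤ 2 * D.PhiTilde xs ys S := by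
  have gx : 0 ≤ 2 * D.s ^ 2 / D.γx := by have := hD.stepParams_x.1.γ_pos; positivity
  have gy : 0 ≤ 2 * D.s ^ 2 / D.γy := by have := hD.stepParams_y.1.γ_pos; positivity
  have t1 := mul_nonneg gx (pinvNormSq_nonneg hD fun i => S.Dx i - D.DxStar xs ys i)
  have t2 := mul_nonneg gy (pinvNormSq_nonneg hD fun i => S.Dy i - D.DyStar xs ys i)
  have t3 := mul_nonneg (Real.sqrt_nonneg D.δ) (sqDist_nonneg S.Hx (D.HxStar xs ys))
  have t4 := mul_nonneg (Real.sqrt_nonneg D.δ) (sqDist_nonneg S.Hy (D.HyStar xs ys))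
  have t5 := mul_nonneg (ctx_nonneg hD) (sqDist_nonneg S.xr fun _ => xs)
  have t6 := mul_nonneg (cty_nonneg hD) (sqDist_nonneg S.yr fun _ => ys)
  have t7 := mul_le_mul_of_nonneg_right hD.half_le_Mx (sqDist_nonneg S.x fun _ => xs)
  have t8 := mul_le_mul_of_nonneg_right hD.half_le_My (sqDist_nonneg S.y fun _ => ys)
  have t9 := sqDist_nonneg S.x fun _ => xs
  have t10 := sqDist_nonneg S.y fun _ => ys
  unfold PhiTilde Phi errSq
  constructor <;> linarith

/-- A sequence bounded by `2 ρ^t Φ` with `ρ ≤ 1 - 1 / (1152 F)` is below `ε` after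
`O(F max (1, log₂ (Φ / ε)))` steps. -/
theorem _root_.CDPSVRG.exists_iteration {ρ F Φ ε : ℝ} (h0 : 0 < ρ) (hF : 2 ≤ F)
    (hρ : ρ ≤ 1 - 1 / (1152 * F)) (hΦ : 0 ≤ Φ) (hε : 0 < ε) :
    ∃ T : ℕ, 2 * (T : ℝ) ≤ 5000 * (F * max 1 (Real.logb 2 (Φ / ε))) ∧
      ∀ t : ℕ, T ≤ t → 2 * (ρ ^ t * Φ) ≤ ε := by
  set l := max 1 (Real.logb 2 (Φ / ε)) with hl
  have hl1 : 1 ≤ l := le_max_left _ _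
  have hK : 0 < 1152 * F := by linarith
  refine ⟨⌈2 * (1152 * F) * l⌉₊, ?_, fun t ht => ?_⟩
  · have h1 := (Nat.ceil_lt_add_one (by positivity : 0 ≤ 2 * (1152 * F) * l)).le
    have h2 : 2 ≤ F * l := by nlinarith
    linarith
  · have ht' : 2 * (1152 * F) * l ≤ t := (Nat.le_ceil _).trans (by exact_mod_cast ht)
    -- `ρ ^ t ≤ exp (-t / (1152 F)) ≤ exp (-2 l)`
    have h1 : ρ ^ t ≤ Real.exp (-(2 * l)) := by
      have h2 : ρ ≤ Real.exp (-(1 / (1152 * F))) := by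
        have := Real.add_one_le_exp (-(1 / (1152 * F)))
        linarith
      calc ρ ^ t ≤ Real.exp (-(1 / (1152 * F))) ^ t := pow_le_pow_left₀ h0.le h2 t
        _ = Real.exp (t * -(1 / (1152 * F))) := (Real.exp_nat_mul _ _).symm
        _ ≤ Real.exp (-(2 * l)) := by
            apply Real.exp_le_exp.2
            have h3 : 2 * l ≤ t * (1 / (1152 * F)) := by
              rw [mul_one_div, le_div_iff₀ hK]; linarith
            linarith
    have h4 : Φ ≤ ε * Real.exp l := by
      rcases hΦ.eq_or_lt with h5 | h5
      · rw [← h5]; positivity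
      · have h6 : 0 < Φ / ε := div_pos h5 hε
        have h7 : Φ / ε ≤ 2 ^ l := (Real.logb_le_iff_le_rpow one_lt_two h6).1 (le_max_right _ _)
        have h8 : (2 : ℝ) ^ l ≤ Real.exp l := by
          rw [← Real.exp_one_rpow]
          have := Real.add_one_le_exp (1 : ℝ)
          exact Real.rpow_le_rpow (by norm_num) (by linarith) (by linarith)
        rw [div_le_iff₀ hε] at h7
        nlinarith
    have h9 : 2 ≤ Real.exp l := by
      have := Real.add_one_le_exp l
      linarith
    have h10 : Real.exp (-(2 * l)) * (Real.exp l * Real.exp l) = 1 := by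
      rw [← Real.exp_add, ← Real.exp_add]
      simp; ring
    have hpos := Real.exp_pos (-(2 * l))
    have hel := Real.exp_pos l
    calc 2 * (ρ ^ t * Φ) ≤ 2 * (Real.exp (-(2 * l)) * (ε * Real.exp l)) := by gcongr
      _ = ε * (Real.exp (-(2 * l)) * (2 * Real.exp l)) := by ring
      _ ≤ ε * (Real.exp (-(2 * l)) * (Real.exp l * Real.exp l)) := by gcongr
      _ = ε := by rw [h10, mul_one]

end Data

end CDPSVRG

theorem theorem2 :
    ∃ C : ℝ, 0 < C ∧
      ∀ (m n dx dy : ℕ) (D : CDPSVRG.Data m n dx dy) (G : SimpleGraph (Fin m)),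
      D.Assumptions G →
      ∀ (xs : CDPSVRG.E dx) (ys : CDPSVRG.E dy), D.IsSolution xs ys →
      ∀ (Ω Θx Θy : Type*) [MeasurableSpace Ω] [MeasurableSpace Θx] [MeasurableSpace Θy]
        (P : Measure Ω) [IsProbabilityMeasure P]
        (τx : Measure Θx) (τy : Measure Θy)
        (Qx : Θx → CDPSVRG.E dx → CDPSVRG.E dx) (Qy : Θy → CDPSVRG.E dy → CDPSVRG.E dy),
      CDPSVRG.IsCompressor τx Qx D.δ → CDPSVRG.IsCompressor τy Qy D.δ →
      ∀ (idx : ℕ → Ω → Fin m → Fin n) (coin : ℕ → Ω → Fin m → Bool)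
        (ξ : ℕ → Ω → Fin m → Θx) (η : ℕ → Ω → Fin m → Θy),
      D.IsSampling P τx τy idx coin ξ η →
      ∀ (x0 xr0 : Fin m → CDPSVRG.E dx) (y0 yr0 : Fin m → CDPSVRG.E dy),
      (∀ i, x0 i ∈ D.X) → (∀ i, xr0 i ∈ D.X) → (∀ i, y0 i ∈ D.Y) → (∀ i, yr0 i ∈ D.Y) →
      let S0 := D.init x0 y0 xr0 yr0
      let S : ℕ → Ω → CDPSVRG.State m dx dy := fun t ω => D.run Qx Qy idx coin ξ η S0 ω t
      -- linear convergence of the Lyapunov function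
      (0 < D.ρ ∧ D.ρ < 1 ∧
        ∀ t : ℕ, Integrable (fun ω => D.PhiTilde xs ys (S t ω)) P ∧
          ∫ ω, D.PhiTilde xs ys (S t ω) ∂P ≤ D.ρ ^ t * D.PhiTilde xs ys S0) ∧
      -- gradient and communication complexity
      ∀ ε : ℝ, 0 < ε →
        ∃ T : ℕ,
          (∀ ω, ((S T ω).oracleCalls : ℝ) ≤
            C * (D.complexityFactor * max 1 (Real.logb 2 (D.PhiTilde xs ys S0 / ε)))) ∧
          (∀ ω, ((S T ω).commRounds : ℝ) ≤
            C * (D.complexityFactor * max 1 (Real.logb 2 (D.PhiTilde xs ys S0 / ε)))) ∧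
          ∀ t : ℕ, T ≤ t →
            Integrable (fun ω => CDPSVRG.errSq xs ys (S t ω)) P ∧
              ∫ ω, CDPSVRG.errSq xs ys (S t ω) ∂P ≤ ε := by
  refine ⟨5000, by norm_num, ?_⟩
  intro m n dx dy D G hD xs ys hz Ω Θx Θy _ _ _ P _ τx τy Qx Qy hQx hQy idx coin ξ η hsamp
    x0 xr0 y0 yr0 hx hxr hy hyr S0 S
  have hrun := CDPSVRG.Data.run_contraction hD hz hQx hQy hsamp hx hxr hy hyr
  have hint := fun t => (hrun t).1.integral_PhiTilde xs ys
  refine ⟨⟨hD.rho_pos, hD.rho_lt_one, fun t => ⟨(hint t).1, (hrun t).2⟩⟩, fun ε hε => ?_⟩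
  have hΦ : 0 ≤ D.PhiTilde xs ys S0 := by
    have := CDPSVRG.Data.errSq_le_PhiTilde hD xs ys S0
    linarith
  obtain ⟨T, hT, hlate⟩ := CDPSVRG.exists_iteration hD.rho_pos hD.two_le_complexityFactor hD.rho_le
    hΦ hε
  have hcnt := fun ω => CDPSVRG.Data.run_counters (Qx := Qx) (Qy := Qy) (idx := idx) (coin := coin)
    (ξ := ξ) (η := η) D x0 xr0 y0 yr0 ω T
  refine ⟨T, fun ω => ?_, fun ω => ?_, fun t ht => ⟨(hint t).2.1, ?_⟩⟩
  · refine le_trans ?_ hT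
    rw [(hcnt ω).1]
    have : (0 : ℝ) ≤ T := Nat.cast_nonneg T
    linarith
  · refine le_trans (le_of_eq ?_) hT
    rw [(hcnt ω).2]
    push_cast
    ring
  · calc ∫ ω, CDPSVRG.errSq xs ys (S t ω) ∂P ≤ ∫ ω, 2 * D.PhiTilde xs ys (S t ω) ∂P :=
          integral_mono (hint t).2.1 ((hint t).1.const_mul 2) fun ω =>
            (CDPSVRG.Data.errSq_le_PhiTilde hD xs ys (S t ω)).2
      _ = 2 * ∫ ω, D.PhiTilde xs ys (S t ω) ∂P := integral_const_mul _ _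
      _ ≤ 2 * (D.ρ ^ t * D.PhiTilde xs ys S0) :=
          mul_le_mul_of_nonneg_left (hrun t).2 zero_le_two
      _ ≤ ε := hlate t ht
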